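/- **Nets.** A Petri net $\mathcal N=(P,T,W^-,W^+)$ has finite sets of places and transitions and matrices $W^\pm\in\mathbb N^{P\times T}$; $\mathcal R(m_0)\subseteq\mathbb N^P$ is the set of markings reachable from $m_0$, and $(\mathcal N,m_0)$ is live if from every $m\in\mathcal R(m_0)$ and for every $t\in T$ one can reach a marking enabling $t$. Its bags are the columns $W^-(t),W^+(t)$, and its bag graph has an edge $W^-(t)\to W^+(t)$ for each $t$. An $N$-closed $\Pi^3$-net is a net without useless transitions ($W^-(t)=W^+(t)$) or duplicated transitions, with a bijection $p\mapsto b_p$ from places to bags such that $b_p(p)=1$ and a partition $P=P_1\sqcup\dots\sqcup P_N$ into non-empty layers such that the sets $\{b_p: p\in P_i\}$ are the connected components of the bag graph, all strongly connected, and such that $q\ne p\in P_i$, $b_p(q)>0$ imply $q\in P_{i-1}^{\max}$, the set of places of maximal potential in $P_{i-1}$ ($P_0^{\max}=P_0=\emptyset$), where $\mathsf{pot}(p)=\|b_p\|-1$. An $N$-open $\Pi^3$-net is obtained from it by deleting a place $p_{\mathsf{ext}}$ of layer $N$; from then on $P$ and $P_i$ refer to the remaining places. For an open net put $\mathsf{POT}_i=\max_{P_i}\mathsf{pot}$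 for $i<N$, $\mathsf{POT}_N=\mathsf{pot}(p_{\mathsf{ext}})$, and $\mathsf{cin}(p)=\mathsf{POT}_i-\mathsf{pot}(p)$ for $p\in P_i$. **Rates.** Let $\lambda:T\to\mathbb R_{>0}$, let $\mathbf Q$ be the generator of the associated continuous-time Markov chain on $\mathcal R(m_0)$, and call $(\mathcal N,\lambda,m_0)$ ergodic if there is a probability distribution $\pi$ on $\mathcal R(m_0)$ with $\pi\mathbf Q=0$. For a bag $b$ put $\lambda(b)=\sum_{W^-(t)=b}\lambda(t)$; let $\mathbf{vis}$ be any positive solution of $\mathbf{vis}\cdot\mathbf P=\mathbf{vis}$, where $\mathbf P(W^-(t),W^+(t))=\lambda(t)/\lambda(W^-(t))$ and all other entries are $0$; let $\mathit{wit}_b\in\mathbb Q^P$ be any witness of $b$, i.e. $\mathit{wit}_b\cdot(W^+(t)-W^-(t))$ is $-1$ if $W^-(t)=b$, $1$ if $W^+(t)=b$, and $0$ otherwise. Put $\mu_p=\prod_b(\mathbf{vis}(b)/\lambda(b))^{\mathit{wit}_b(p)}$. **Classes.** Let $Y=P_{N-1}^{\max}\cup P_N$ and let $\mathfrak M_Y$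 be the set of classes of markings modulo coincidence on $Y$; put $\hat v(\mathfrak m)=\prod_{p\in Y}\mu_p^{\mathfrak m(p)}$ for $\mathfrak m\in\mathfrak M_Y$. For an integer $c\ge0$ let $\mathcal D_{m_0}(c)$ be the set of those $\mathfrak m\in\mathfrak M_Y$ that contain some marking of $\mathcal R(m_0)$ and satisfy $$c+\sum_{p\in P_{N-1}^{\max}}\mathfrak m(p)+\sum_{p\in P_N}\mathsf{cin}(p)\,\mathfrak m(p)=\sum_{p\in P_{N-1}}m_0(p)+\sum_{p\in P_N}\mathsf{cin}(p)\,m_0(p).$$ **Proposition.** There is one algorithm (a program of a real random access machine, with unit-cost exact field operations and comparisons on reals and unit-cost addition, subtraction and comparison on integers) and one polynomial $f$ such that for every $N$-open $\Pi^3$-net (with any $N$), all $\lambda,\mathbf{vis},\mathit{wit}$ as above, every $m_0\in\mathbb N^P$ such that $(\mathcal N,\lambda,m_0)$ is live and ergodic, and every integer $c\ge0$: on input the net (the closed net with its layers and $p_{\mathsf{ext}}$), the constants $(\mu_p)_{p\in P}$, $m_0$ and $c$, the algorithm halts after at most $f(|P|+|T|+\mathbf W+c+\|m_0\|)$ elementary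 steps, where $\mathbf W$ is the maximal entry of $W^-,W^+$ (of the open net) and $\|m_0\|=\sum_p m_0(p)$, and its output is $\sum_{\mathfrak m\in\mathcal D_{m_0}(c)}\hat v(\mathfrak m)$, this possibly infinite sum being convergent. -/

import Mathlib

open scoped BigOperators

noncomputable section

/-! ### Petri nets -/

/-- A Petri net with places `P` and transitions `T`: backward and forward incidence matrices. -/
structure PetriNet (P T : Type) where
  /-- the backward incidence matrix `W⁻` -/
  pre : P → T → ℕ
  /-- the forward incidence matrix `W⁺` -/
  post : P → T → ℕ

namespace PetriNet

variable {P T : Type}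

/-- The bag consumed by `t`, i.e. the column `W⁻(t)`. -/
def inBag (N : PetriNet P T) (t : T) : P → ℕ := fun p => N.pre p t

/-- The bag produced by `t`, i.e. the column `W⁺(t)`. -/
def outBag (N : PetriNet P T) (t : T) : P → ℕ := fun p => N.post p t

/-- The standing assumption on nets: no useless and no duplicated transition. -/
def Proper (N : PetriNet P T) : Prop :=
  (∀ t, N.inBag t ≠ N.outBag t) ∧
  (∀ t t', t ≠ t' → N.inBag t ≠ N.inBag t' ∨ N.outBag t ≠ N.outBag t')

/-- `t` is enabled by the marking `m`. -/
def Enabled (N : PetriNet P T) (m : P → ℕ) (t : T) : Prop := ∀ p, N.pre p t ≤ m p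

/-- The marking obtained by firing `t` in `m` (used only when `t` is enabled by `m`). -/
def fire (N : PetriNet P T) (m : P → ℕ) (t : T) : P → ℕ :=
  fun p => m p - N.pre p t + N.post p t

/-- One firing leads from `m` to `m'`. -/
def Step (N : PetriNet P T) (m m' : P → ℕ) : Prop := ∃ t, N.Enabled m t ∧ m' = N.fire m t

/-- The reachability set of `m₀`. -/
def reach (N : PetriNet P T) (m₀ : P → ℕ) : Set (P → ℕ) :=
  {m | Relation.ReflTransGen N.Step m₀ m}

/-- Liveness of the marked net `(N, m₀)`. -/
def Live (N : PetriNet P T) (m₀ : P → ℕ) : Prop :=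
  ∀ t, ∀ m ∈ N.reach m₀, ∃ m' ∈ N.reach m, N.Enabled m' t

/-- The maximal weight of the edges of the net. -/
def maxWeight [Fintype P] [Fintype T] (N : PetriNet P T) : ℕ :=
  Finset.univ.sup fun p => Finset.univ.sup fun t => max (N.pre p t) (N.post p t)

/-! ### The bag graph -/

open Classical in
/-- The vertices of the bag graph. -/
def bags [Fintype T] (N : PetriNet P T) : Finset (P → ℕ) :=
  Finset.univ.image N.inBag ∪ Finset.univ.image N.outBag

/-- The edges of the bag graph, without their labels. -/
def BagEdge (N : PetriNet P T) (b b' : P → ℕ) : Prop := ∃ t, N.inBag t = b ∧ N.outBag t = b'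

/-- `w` is a witness of the bag `b`. -/
def IsWitness [Fintype P] (N : PetriNet P T) (b : P → ℕ) (w : P → ℚ) : Prop :=
  ∀ t, (N.inBag t = b → ∑ p, w p * ((N.post p t : ℚ) - N.pre p t) = -1) ∧
    (N.outBag t = b → ∑ p, w p * ((N.post p t : ℚ) - N.pre p t) = 1) ∧
    (N.inBag t ≠ b → N.outBag t ≠ b → ∑ p, w p * ((N.post p t : ℚ) - N.pre p t) = 0)

/-! ### Stochastic Petri nets with firing rates `rate` -/

open Classical in
/-- The infinitesimal generator of the underlying continuous-time Markov chain: off the diagonal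
the total rate of the transitions leading from `m` to `m'`, on the diagonal minus the total rate
of the transitions leading from `m` to some other marking. -/
def generator [Fintype T] (N : PetriNet P T) (rate : T → ℝ) (m m' : P → ℕ) : ℝ :=
  if m = m' then - ∑ t with N.Enabled m t ∧ N.fire m t ≠ m, rate t
  else ∑ t with N.Enabled m t ∧ N.fire m t = m', rate t

/-- Ergodicity: there is a probability distribution `π` over the reachability set with
`π · Q = 0`. -/
def Ergodic [Fintype T] (N : PetriNet P T) (rate : T → ℝ) (m₀ : P → ℕ) : Prop :=
  ∃ π : N.reach m₀ → ℝ, (∀ m, 0 ≤ π m) ∧ HasSum π 1 ∧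
    ∀ m' : N.reach m₀, HasSum (fun m : N.reach m₀ => π m * N.generator rate m m') 0

open Classical in
/-- The firing rate of a bag. -/
def bagRate [Fintype T] (N : PetriNet P T) (rate : T → ℝ) (b : P → ℕ) : ℝ :=
  ∑ t with N.inBag t = b, rate t

open Classical in
/-- The routing matrix of bags (the sum has at most one term, as no transition is duplicated). -/
def routing [Fintype T] (N : PetriNet P T) (rate : T → ℝ) (b b' : P → ℕ) : ℝ :=
  ∑ t with N.inBag t = b ∧ N.outBag t = b', rate t / N.bagRate rate b

/-- `vis` is a positive solution of `vis · 𝐏 = vis`. -/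
def IsVisit [Fintype T] (N : PetriNet P T) (rate : T → ℝ) (vis : (P → ℕ) → ℝ) : Prop :=
  (∀ b ∈ N.bags, 0 < vis b) ∧
  ∀ b' ∈ N.bags, ∑ b ∈ N.bags, vis b * N.routing rate b b' = vis b'

/-- The constants `μ_p` of the product form. -/
def mu [Fintype T] (N : PetriNet P T) (rate : T → ℝ) (vis : (P → ℕ) → ℝ)
    (wit : (P → ℕ) → P → ℚ) (p : P) : ℝ :=
  ∏ b ∈ N.bags, (vis b / N.bagRate rate b) ^ ((wit b p : ℚ) : ℝ)

/-- Deletion of the place `none` and of its input and output edges. -/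
def deleteNone (N : PetriNet (Option P) T) : PetriNet P T where
  pre p t := N.pre (some p) t
  post p t := N.post (some p) t

end PetriNet

/-! ### Closed and open `Π³`-nets -/

/-- The structure of an `L`-closed `Π³`-net on the net `N`: the bijection `p ↦ b_p` between places
and bags, and the layer (between `1` and `L`) of each place. -/
structure ClosedPi3 {P T : Type} [Fintype P] [Fintype T] (N : PetriNet P T) (L : ℕ) where
  /-- the bag `b_p` of the place `p` -/
  bag : P → (P → ℕ)
  bag_bij : Set.BijOn bag Set.univ ↑N.bags
  bag_self : ∀ p, bag p p = 1
  /-- the index `i` such that `p ∈ P_i`, i.e. `b_p ∈ V_i` -/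
  layer : P → ℕ
  one_le_layer : ∀ p, 1 ≤ layer p
  layer_le : ∀ p, layer p ≤ L
  /-- the sets `V_1, …, V_L` are non-empty -/
  layer_surj : ∀ i, 1 ≤ i → i ≤ L → ∃ p, layer p = i
  /-- the sets `V_1, …, V_L` are the connected components of the bag graph, and each of them is
  strongly connected -/
  component : ∀ p q, layer p = layer q ↔ Relation.ReflTransGen N.BagEdge (bag p) (bag q)
  /-- a place `q ≠ p` occurring in `b_p` lies in the previous layer and has maximal potential
  `‖b_q‖ - 1` there -/
  resource : ∀ p q, q ≠ p → 0 < bag p q → layer q + 1 = layer p ∧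
    ∀ r, layer r = layer q → (∑ s, bag r s) - 1 ≤ (∑ s, bag q s) - 1

/-- The potential `‖b_p‖ - 1` of a place. -/
def ClosedPi3.pot {P T : Type} [Fintype P] [Fintype T] {N : PetriNet P T} {L : ℕ}
    (S : ClosedPi3 N L) (p : P) : ℕ := (∑ q, S.bag p q) - 1

/-- An open `Π³`-net with places `P` and transitions `T`, given by the closed `Π³`-net from which
it is obtained by deleting a place `p_ext` (here `none`) of the last layer. -/
structure OpenPi3 (P T : Type) [Fintype P] [Fintype T] where
  /-- the closed net -/
  closed : PetriNet (Option P) T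
  proper : closed.Proper
  /-- the number of layers -/
  N : ℕ
  str : ClosedPi3 closed N
  layer_ext : str.layer none = N

namespace OpenPi3

variable {P T : Type} [Fintype P] [Fintype T]

/-- The open net itself. -/
def net (O : OpenPi3 P T) : PetriNet P T := O.closed.deleteNone

/-- The potential of a place of the open net. -/
def pot (O : OpenPi3 P T) (p : P) : ℕ := O.str.pot (some p)

open Classical in
/-- The set `P_i` of places of the open net (so `P_0 = ∅`). -/
def layerSet (O : OpenPi3 P T) (i : ℕ) : Finset P :=
  Finset.univ.filter fun p => O.str.layer (some p) = i

open Classical in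
/-- The set `P_i^max` of places of maximal potential in `P_i` (used for `i < N`). -/
def maxSet (O : OpenPi3 P T) (i : ℕ) : Finset P :=
  (O.layerSet i).filter fun p => ∀ q ∈ O.layerSet i, O.pot q ≤ O.pot p

/-- `POT_i` is the maximal potential in `P_i` for `i < N`, and `POT_N` is the potential of
`p_ext`. -/
def POT (O : OpenPi3 P T) (i : ℕ) : ℕ :=
  if i = O.N then O.str.pot none else (O.layerSet i).sup O.pot

/-- `cin(p) = POT_i - pot(p)` for `p ∈ P_i`; it may be negative when `i = N`. -/
def cin (O : OpenPi3 P T) (p : P) : ℤ := (O.POT (O.str.layer (some p)) : ℤ) - O.pot p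

/-- The constant `𝐂_i^{m₀} = m₀ · v^{(i)}` with `v^{(i)} = P_i + cin(P_{i+1})`. -/
def invConst (O : OpenPi3 P T) (i : ℕ) (m₀ : P → ℕ) : ℤ :=
  ∑ p ∈ O.layerSet i, (m₀ p : ℤ) + ∑ p ∈ O.layerSet (i + 1), O.cin p * (m₀ p : ℤ)

open Classical in
/-- The set `Y = P_{N-1}^max ∪ P_N`. -/
def Y (O : OpenPi3 P T) : Finset P := O.maxSet (O.N - 1) ∪ O.layerSet O.N

end OpenPi3

/-! ### Classes of markings -/

/-- The relation `m ∼_Z m'`: `m` and `m'` coincide on `Z`. -/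
def coincideOn {P : Type} (Z : Finset P) : Setoid (P → ℕ) where
  r m m' := ∀ p ∈ Z, m p = m' p
  iseqv := ⟨fun _ _ _ => rfl, fun h p hp => (h p hp).symm,
    fun h h' p hp => (h p hp).trans (h' p hp)⟩

/-- The quotient `𝔐_Z` of the set of markings by `∼_Z`. -/
def MarkingClass {P : Type} (Z : Finset P) : Type := Quotient (coincideOn Z)

namespace MarkingClass

variable {P : Type} {Z : Finset P}

/-- The class of a marking. -/
def mk (Z : Finset P) (m : P → ℕ) : MarkingClass Z := Quotient.mk (coincideOn Z) m

/-- The number of tokens in the place `p ∈ Z`, common to all markings of a class. -/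
def coord (M : MarkingClass Z) (p : {p // p ∈ Z}) : ℕ :=
  Quotient.lift (fun m : P → ℕ => m p.1) (fun m m' (h : ∀ q ∈ Z, m q = m' q) => h p.1 p.2) M

/-- The product `∏_{p ∈ Z} μ_p ^ M(p)`. -/
def weight (μ : P → ℝ) (M : MarkingClass Z) : ℝ := ∏ p : {p // p ∈ Z}, μ p.1 ^ M.coord p

end MarkingClass

open Classical in
/-- The set `𝒟_{m₀}(c)` of classes `M ∈ 𝔐_Y` that contain a reachable marking and satisfy
`c + M · P_{N-1}^max + M · cin(P_N) = 𝐂_{N-1}^{m₀}`. -/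
def OpenPi3.classesD {P T : Type} [Fintype P] [Fintype T] (O : OpenPi3 P T) (m₀ : P → ℕ) (c : ℕ) :
    Set (MarkingClass O.Y) :=
  {M | (c : ℤ) + ∑ p : {p // p ∈ O.Y} with p.1 ∈ O.maxSet (O.N - 1), (M.coord p : ℤ)
        + ∑ p : {p // p ∈ O.Y} with p.1 ∈ O.layerSet O.N, O.cin p.1 * (M.coord p : ℤ)
        = O.invConst (O.N - 1) m₀ ∧
      ∃ m ∈ O.net.reach m₀, MarkingClass.mk O.Y m = M}

/-! ### The machine model

A real random access machine, programmed in a small imperative language. Its memory consists of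
arrays of integers and arrays of real numbers; an array cell is addressed by a finite list of
integers, whose length is fixed in the program text. Every elementary operation costs one time
unit. On integers the only operations are addition and subtraction (as usual for the uniform cost
criterion), on reals they are the four field operations (exact, without rounding to integers, and
with `x / 0 = 0`). -/

namespace RealRAM

/-- The contents of the memory: `ints a l` is the cell of the integer array `a` at address `l`. -/
structure State where
  ints : ℕ → List ℤ → ℤ
  reals : ℕ → List ℤ → ℝ

/-- Integer expressions. -/
inductive IExpr : Type
  | const (z : ℤ)
  | read (a d : ℕ) (idx : Fin d → IExpr)
  | add (e₁ e₂ : IExpr)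
  | sub (e₁ e₂ : IExpr)

namespace IExpr

/-- The value of an integer expression. -/
def eval (s : State) : IExpr → ℤ
  | const z => z
  | read a _ idx => s.ints a (List.ofFn fun i => (idx i).eval s)
  | add e₁ e₂ => e₁.eval s + e₂.eval s
  | sub e₁ e₂ => e₁.eval s - e₂.eval s

/-- The number of elementary operations needed to evaluate an integer expression. -/
def cost : IExpr → ℕ
  | const _ => 1
  | read _ _ idx => 1 + ∑ i, (idx i).cost
  | add e₁ e₂ => 1 + e₁.cost + e₂.cost
  | sub e₁ e₂ => 1 + e₁.cost + e₂.cost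

end IExpr

/-- Real expressions. -/
inductive RExpr : Type
  | const (z : ℤ)
  | read (a d : ℕ) (idx : Fin d → IExpr)
  | add (e₁ e₂ : RExpr)
  | sub (e₁ e₂ : RExpr)
  | mul (e₁ e₂ : RExpr)
  | div (e₁ e₂ : RExpr)

namespace RExpr

/-- The value of a real expression. -/
def eval (s : State) : RExpr → ℝ
  | const z => z
  | read a _ idx => s.reals a (List.ofFn fun i => (idx i).eval s)
  | add e₁ e₂ => e₁.eval s + e₂.eval s
  | sub e₁ e₂ => e₁.eval s - e₂.eval s
  | mul e₁ e₂ => e₁.eval s * e₂.eval s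
  | div e₁ e₂ => e₁.eval s / e₂.eval s

/-- The number of elementary operations needed to evaluate a real expression. -/
def cost : RExpr → ℕ
  | const _ => 1
  | read _ _ idx => 1 + ∑ i, (idx i).cost
  | add e₁ e₂ => 1 + e₁.cost + e₂.cost
  | sub e₁ e₂ => 1 + e₁.cost + e₂.cost
  | mul e₁ e₂ => 1 + e₁.cost + e₂.cost
  | div e₁ e₂ => 1 + e₁.cost + e₂.cost

end RExpr

/-- Tests. -/
inductive Test : Type
  | leInt (e₁ e₂ : IExpr)
  | ltReal (e₁ e₂ : RExpr)
  | not (b : Test)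
  | and (b₁ b₂ : Test)

namespace Test

/-- The truth value of a test. -/
def Holds (s : State) : Test → Prop
  | leInt e₁ e₂ => e₁.eval s ≤ e₂.eval s
  | ltReal e₁ e₂ => e₁.eval s < e₂.eval s
  | not b => ¬ b.Holds s
  | and b₁ b₂ => b₁.Holds s ∧ b₂.Holds s

/-- The number of elementary operations needed to evaluate a test. -/
def cost : Test → ℕ
  | leInt e₁ e₂ => 1 + e₁.cost + e₂.cost
  | ltReal e₁ e₂ => 1 + e₁.cost + e₂.cost
  | not b => 1 + b.cost
  | and b₁ b₂ => 1 + b₁.cost + b₂.cost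

end Test

/-- Programs. -/
inductive Prog : Type
  | skip
  | setInt (a d : ℕ) (idx : Fin d → IExpr) (e : IExpr)
  | setReal (a d : ℕ) (idx : Fin d → IExpr) (e : RExpr)
  | seq (c₁ c₂ : Prog)
  | ite (b : Test) (c₁ c₂ : Prog)
  | while (b : Test) (c : Prog)

/-- Writing an integer into a cell. -/
def State.writeInt (s : State) (a : ℕ) (l : List ℤ) (z : ℤ) : State where
  ints a' l' := if a' = a ∧ l' = l then z else s.ints a' l'
  reals := s.reals

/-- Writing a real number into a cell. -/
def State.writeReal (s : State) (a : ℕ) (l : List ℤ) (x : ℝ) : State where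
  ints := s.ints
  reals a' l' := if a' = a ∧ l' = l then x else s.reals a' l'

/-- `Exec c s s' n`: started in the state `s`, the program `c` halts in the state `s'` after
exactly `n` elementary operations. -/
inductive Exec : Prog → State → State → ℕ → Prop
  | skip (s : State) : Exec Prog.skip s s 1
  | setInt (s : State) (a d : ℕ) (idx : Fin d → IExpr) (e : IExpr) :
      Exec (Prog.setInt a d idx e) s
        (s.writeInt a (List.ofFn fun i => (idx i).eval s) (e.eval s))
        (1 + ∑ i, (idx i).cost + e.cost)
  | setReal (s : State) (a d : ℕ) (idx : Fin d → IExpr) (e : RExpr) :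
      Exec (Prog.setReal a d idx e) s
        (s.writeReal a (List.ofFn fun i => (idx i).eval s) (e.eval s))
        (1 + ∑ i, (idx i).cost + e.cost)
  | seq {c₁ c₂ : Prog} {s s' s'' : State} {n₁ n₂ : ℕ} :
      Exec c₁ s s' n₁ → Exec c₂ s' s'' n₂ → Exec (Prog.seq c₁ c₂) s s'' (n₁ + n₂)
  | iteTrue {b : Test} {c₁ c₂ : Prog} {s s' : State} {n : ℕ} :
      b.Holds s → Exec c₁ s s' n → Exec (Prog.ite b c₁ c₂) s s' (1 + b.cost + n)
  | iteFalse {b : Test} {c₁ c₂ : Prog} {s s' : State} {n : ℕ} :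
      ¬ b.Holds s → Exec c₂ s s' n → Exec (Prog.ite b c₁ c₂) s s' (1 + b.cost + n)
  | whileFalse {b : Test} {c : Prog} {s : State} :
      ¬ b.Holds s → Exec (Prog.while b c) s s (1 + b.cost)
  | whileTrue {b : Test} {c : Prog} {s s' s'' : State} {n₁ n₂ : ℕ} :
      b.Holds s → Exec c s s' n₁ → Exec (Prog.while b c) s' s'' n₂ →
      Exec (Prog.while b c) s s'' (1 + b.cost + n₁ + n₂)

/-- A finite table as the contents of an array, with `0` outside its range. -/
def table {α : Type} [Zero α] {n : ℕ} (f : Fin n → α) (z : ℤ) : α :=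
  if h : 0 ≤ z ∧ z.toNat < n then f ⟨z.toNat, h.2⟩ else 0

/-- The input: the numbers `|P|`, `|T|`, `N`, `c`, the layer of each place of the closed net, the
initial marking, the two incidence matrices of the closed net, and the constants `μ_p`. The places
are numbered `0, …, |P| - 1`, and `p_ext` has number `|P|`. -/
def input {n k : ℕ} (O : OpenPi3 (Fin n) (Fin k)) (μ : Fin n → ℝ) (m₀ : Fin n → ℕ) (c : ℕ) :
    State where
  ints a l := match a, l with
    | 0, [] => n
    | 1, [] => k
    | 2, [] => O.N
    | 3, [] => c
    | 4, [p] => table (fun i : Fin (n + 1) => (O.str.layer (finSuccEquivLast i) : ℤ)) p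
    | 5, [p] => table (fun i : Fin n => (m₀ i : ℤ)) p
    | 6, [p, t] =>
        table (fun i : Fin (n + 1) =>
          table (fun j : Fin k => (O.closed.pre (finSuccEquivLast i) j : ℤ)) t) p
    | 7, [p, t] =>
        table (fun i : Fin (n + 1) =>
          table (fun j : Fin k => (O.closed.post (finSuccEquivLast i) j : ℤ)) t) p
    | _, _ => 0
  reals a l := match a, l with
    | 0, [p] => table μ p
    | _, _ => 0

/-- The output register: the cell of the real array `1` at the empty address. -/
def State.output (s : State) : ℝ := s.reals 1 []

end RealRAM

end

/-! The proof describes the classes by finitely many arithmetic conditions, turns the sum into a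
combination of partition functions with one linear constraint each, and computes these by a dynamic
programme of polynomial size.

Reachability. The resources in a bag of layer i+1 lie in places of maximal potential of layer i, so
`invConst i` has the same value on all bags of one component and is invariant under firing. A layer
is active (`Act`) if the layer below holds enough tokens either for every place of maximal potential
(for the deleted place in the case of the last layer) or for a token that is present. Activity is
preserved by firing, and liveness makes all layers active. Conversely, two markings with all layers
active and equal invariants are connected (`conn_of_full`): the tokens of each lower layer can be
redistributed over its places of maximal potential, and those of the last layer can be gathered in
one place, the deleted place acting as an unlimited source. This gives `mem_reach_iff`. It follows
(`mem_classesD_iff`) that a class belongs to the sum exactly if its weighted number of tokens, with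
the signed weights `wt`, is C - c, if c is `Feasible`, and if the last layer is active. Inactivity
means that the last but one layer has s tokens with s < POT_N and that all occupied places of the
last layer have potential greater than s. Subtracting these cases yields `classSum`: one partition
function over Y minus a short sum of products of two others.

Convergence. Since `wt` takes both signs, the hyperplane of admissible vectors may be infinite. The
product form solves the global balance equations (`balanced_weightOf`). Its minimum with a multiple
of the stationary distribution is summable and hence again balanced, and weak reversibility then
bounds the product form by that multiple (`le_mul_of_summable`, `summable_weightOf`). A non-zero
direction d in Y of weight zero keeps all the markings m₀ + k d reachable, so its product is less
than 1. Comparing places of opposite sign produces one τ with μ_p exp(τ wt p) < 1 on all of Y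
(`exists_tilt`). On a hyperplane this tilt is only a constant factor, so all the series are
dominated by products of geometric series.

Computation. Adding a place p gives G(K) = G'(K) + ν_p G(K - w_p) (`part_insert`). With weights of a
single sign this is a finite recursion. With a place of weight a > 0 and one of weight -b < 0, two
such recurrences run in opposite directions. Applying them alternately, K is changed along a walk
that remains within bounded distance and returns after a + b steps. This gives G(K) = acc + u^b v^a
G(K) with u^b v^a < 1, and the equation is solved by one division (`walk_value`). Places of weight
zero contribute factors 1 / (1 - ν_p).

The machine. The program is a list of phases, each filling one table in lexicographic order. As
every cell is written once and refers only to earlier arrays or smaller addresses, the final memory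
satisfies the recurrences as plain equations (`exec_phases`), and correctness becomes a statement
about that one state (`Tables`, `Run`). All loop bounds are polynomial in the input parameter. -/

set_option linter.unusedSectionVars false

noncomputable section

namespace RealRAM

/-! ### Table-filling phases of the real random access machine -/

/-- The contents of the integer cell and of the real cell with a given name and address. -/
def State.cell (s : State) (a : ℕ) (l : List ℤ) : ℤ × ℝ := (s.ints a l, s.reals a l)

/-- Integer expressions with case distinctions. -/
inductive ITree : Type
  | leaf (e : IExpr)
  | ite (b : Test) (t u : ITree)

/-- Real expressions with case distinctions. -/
inductive RTree : Type
  | leaf (e : RExpr)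
  | ite (b : Test) (t u : RTree)

open Classical in
/-- The value of an integer expression with case distinctions. -/
def ITree.eval (s : State) : ITree → ℤ
  | leaf e => e.eval s
  | ite b t u => if b.Holds s then t.eval s else u.eval s

open Classical in
/-- The value of a real expression with case distinctions. -/
def RTree.eval (s : State) : RTree → ℝ
  | leaf e => e.eval s
  | ite b t u => if b.Holds s then t.eval s else u.eval s

/-- A scalar integer variable. -/
def IExpr.var (a : ℕ) : IExpr := IExpr.read a 0 Fin.elim0

/-- The loop counter of depth `i`. -/
def IExpr.ctr (i : ℕ) : IExpr := IExpr.var (100 + i)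

/-- The values of the first `d` loop counters. -/
def State.addr (s : State) (d : ℕ) : List ℤ := List.ofFn fun i : Fin d => s.ints (100 + i) []

/-- The assignment of a case distinction to a cell of the array `a` addressed by the counters. -/
def ITree.assign (a d : ℕ) : ITree → Prog
  | leaf e => Prog.setInt a d (fun i => IExpr.ctr i) e
  | ite b t u => Prog.ite b (t.assign a d) (u.assign a d)

/-- The assignment of a case distinction to a cell of the array `a` addressed by the counters. -/
def RTree.assign (a d : ℕ) : RTree → Prog
  | leaf e => Prog.setReal a d (fun i => IExpr.ctr i) e
  | ite b t u => Prog.ite b (t.assign a d) (u.assign a d)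

/-- A bound for the cost of an assignment. -/
def ITree.cost (d : ℕ) : ITree → ℕ
  | leaf e => 1 + d + e.cost
  | ite b t u => 1 + b.cost + t.cost d + u.cost d

/-- A bound for the cost of an assignment. -/
def RTree.cost (d : ℕ) : RTree → ℕ
  | leaf e => 1 + d + e.cost
  | ite b t u => 1 + b.cost + t.cost d + u.cost d

/-- The right-hand side of a table-filling assignment. -/
inductive Rhs : Type
  | int (t : ITree)
  | real (t : RTree)

namespace Rhs

/-- The assignment of a right-hand side. -/
def assign (a d : ℕ) : Rhs → Prog
  | int t => t.assign a d
  | real t => t.assign a d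

/-- A bound for the cost of the assignment. -/
def cost (d : ℕ) : Rhs → ℕ
  | int t => t.cost d
  | real t => t.cost d

/-- The effect of the assignment. -/
def write (a d : ℕ) (s : State) : Rhs → State
  | int t => s.writeInt a (s.addr d) (t.eval s)
  | real t => s.writeReal a (s.addr d) (t.eval s)

/-- The new contents of the assigned cell. -/
def val (a d : ℕ) (s : State) : Rhs → ℤ × ℝ
  | int t => (t.eval s, s.reals a (s.addr d))
  | real t => (s.ints a (s.addr d), t.eval s)

end Rhs

@[simp] lemma IExpr.eval_var (s : State) (a : ℕ) : (IExpr.var a).eval s = s.ints a [] := by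
  simp [IExpr.var, IExpr.eval]

@[simp] lemma IExpr.cost_var (a : ℕ) : (IExpr.var a).cost = 1 := by
  simp [IExpr.var, IExpr.cost]

@[simp] lemma IExpr.eval_ctr (s : State) (i : ℕ) : (IExpr.ctr i).eval s = s.ints (100 + i) [] := by
  simp [IExpr.ctr]

@[simp] lemma IExpr.cost_ctr (a : ℕ) : (IExpr.ctr a).cost = 1 := by
  simp [IExpr.ctr]

lemma ITree.exec_assign (a d : ℕ) (s : State) (t : ITree) :
    ∃ n, Exec (t.assign a d) s (s.writeInt a (s.addr d) (t.eval s)) n ∧ n ≤ t.cost d := by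
  induction t with
  | leaf e =>
    have h := Exec.setInt s a d (fun i => IExpr.ctr i) e
    refine ⟨_, ?_, le_refl _⟩
    simpa [ITree.assign, ITree.eval, ITree.cost, State.addr] using h
  | ite b t u iht ihu =>
    obtain ⟨n, h, hn⟩ := iht
    obtain ⟨n', h', hn'⟩ := ihu
    by_cases hb : b.Holds s
    · refine ⟨1 + b.cost + n, ?_, by simp only [ITree.cost]; omega⟩
      simp only [ITree.assign, ITree.eval, hb, if_true]
      exact Exec.iteTrue hb h
    · refine ⟨1 + b.cost + n', ?_, by simp only [ITree.cost]; omega⟩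
      simp only [ITree.assign, ITree.eval, hb, if_false]
      exact Exec.iteFalse hb h'

lemma RTree.exec_assign (a d : ℕ) (s : State) (t : RTree) :
    ∃ n, Exec (t.assign a d) s (s.writeReal a (s.addr d) (t.eval s)) n ∧ n ≤ t.cost d := by
  induction t with
  | leaf e =>
    have h := Exec.setReal s a d (fun i => IExpr.ctr i) e
    refine ⟨_, ?_, le_refl _⟩
    simpa [RTree.assign, RTree.eval, RTree.cost, State.addr] using h
  | ite b t u iht ihu =>
    obtain ⟨n, h, hn⟩ := iht
    obtain ⟨n', h', hn'⟩ := ihu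
    by_cases hb : b.Holds s
    · refine ⟨1 + b.cost + n, ?_, by simp only [RTree.cost]; omega⟩
      simp only [RTree.assign, RTree.eval, hb, if_true]
      exact Exec.iteTrue hb h
    · refine ⟨1 + b.cost + n', ?_, by simp only [RTree.cost]; omega⟩
      simp only [RTree.assign, RTree.eval, hb, if_false]
      exact Exec.iteFalse hb h'

lemma Rhs.exec_assign (a d : ℕ) (s : State) (r : Rhs) :
    ∃ n, Exec (r.assign a d) s (r.write a d s) n ∧ n ≤ r.cost d := by
  cases r with
  | int t => exact t.exec_assign a d s
  | real t => exact t.exec_assign a d s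

lemma Rhs.cell_write (a d : ℕ) (s : State) (r : Rhs) (a' : ℕ) (l : List ℤ) :
    (r.write a d s).cell a' l = if a' = a ∧ l = s.addr d then r.val a d s else s.cell a' l := by
  by_cases h : a' = a ∧ l = s.addr d
  · obtain ⟨rfl, rfl⟩ := h
    cases r <;> simp [Rhs.write, Rhs.val, State.cell, State.writeInt, State.writeReal]
  · rw [if_neg h]
    cases r <;> simp [Rhs.write, State.cell, State.writeInt, State.writeReal, h]

/-! ### Traces of a table-filling loop and the equations that they leave behind -/

/-- Two states agree on all arrays but the loop counters. -/
def State.Equiv (s s' : State) : Prop := ∀ a < 100, s.cell a = s'.cell a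

/-- The assignment `r` is performed successively at the addresses in a list. -/
inductive Runs (a d : ℕ) (r : Rhs) : List (List ℤ) → State → State → Prop
  | nil {s s' : State} : s.Equiv s' → Runs a d r [] s s'
  | cons {l : List ℤ} {L : List (List ℤ)} {s s₁ s' : State} : s.Equiv s₁ → s₁.addr d = l →
      Runs a d r L (r.write a d s₁) s' → Runs a d r (l :: L) s s'

lemma State.Equiv.trans {s s' s'' : State} (h : s.Equiv s') (h' : s'.Equiv s'') : s.Equiv s'' :=
  fun a ha => (h a ha).trans (h' a ha)

lemma Runs.congr_left {a d : ℕ} {r : Rhs} {L : List (List ℤ)} {s s₀ s' : State}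
    (h : Runs a d r L s s') (h₀ : s₀.Equiv s) : Runs a d r L s₀ s' := by
  cases h with
  | nil h => exact Runs.nil (h₀.trans h)
  | cons h h' h'' => exact Runs.cons (h₀.trans h) h' h''

lemma Runs.append {a d : ℕ} {r : Rhs} {L L' : List (List ℤ)} {s s' s'' : State}
    (h : Runs a d r L s s') (h' : Runs a d r L' s' s'') : Runs a d r (L ++ L') s s'' := by
  induction h with
  | nil h => exact h'.congr_left h
  | cons h h1 _ ih => exact Runs.cons h h1 (ih h')

lemma Runs.frame {a d : ℕ} {r : Rhs} {L : List (List ℤ)} {s s' : State}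
    (h : Runs a d r L s s') :
    (∀ a' < 100, a' ≠ a → s'.cell a' = s.cell a') ∧
      (a < 100 → ∀ l, l ∉ L → s'.cell a l = s.cell a l) := by
  induction h with
  | nil h => exact ⟨fun a' h' _ => (h a' h').symm, fun h' l _ => by rw [h a h']⟩
  | @cons l L s s₁ s' h h1 _ ih =>
    refine ⟨fun a' h' hne => ?_, fun h' l' hl => ?_⟩
    · rw [ih.1 a' h' hne, h a' h']
      funext l
      simp [Rhs.cell_write, hne]
    · simp only [List.mem_cons, not_or] at hl
      rw [ih.2 h' l' hl.2, h a h']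
      rw [Rhs.cell_write, h1, if_neg (fun h => hl.1 h.2)]

/-- The cell at the address `l` of the array `a` is determined by the right-hand side `r`,
evaluated in an intermediate state that agrees with `s` on the cells written earlier. -/
def CellEq (a d : ℕ) (r : Rhs) (L : List (List ℤ)) (s : State) (l : List ℤ) : Prop :=
  ∃ tmp : State, tmp.addr d = l ∧ (∀ a' < 100, a' ≠ a → tmp.cell a' = s.cell a') ∧
    (∀ l', l' ∉ L ∨ l' < l → tmp.cell a l' = s.cell a l') ∧ s.cell a l = r.val a d tmp

/-- Strict increase means that each address is written only once. Hence the state just before the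
write at `l` already agrees with the final state at all smaller addresses, and a recurrence through
smaller addresses can be read off the final state alone. -/
lemma Runs.cellEq {a d : ℕ} {r : Rhs} {L : List (List ℤ)} {s s' : State}
    (h : Runs a d r L s s') (ha : a < 100) (hL : L.Pairwise (· < ·)) :
    ∀ l ∈ L, CellEq a d r L s' l := by
  induction h with
  | nil h => simp
  | @cons l L s s₁ s' h h1 h2 ih =>
    rw [List.pairwise_cons] at hL
    have hfr := h2.frame
    intro l' hl'
    rcases List.mem_cons.1 hl' with rfl | hl'
    · have hnot : l' ∉ L := fun hh => lt_irrefl _ (hL.1 l' hh)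
      refine ⟨s₁, h1, fun a' h' hne => ?_, fun l'' hl'' => ?_, ?_⟩
      · rw [hfr.1 a' h' hne]
        funext x
        simp [Rhs.cell_write, hne]
      · have h3 : l'' ∉ l' :: L := by
          rcases hl'' with h3 | h3
          · exact h3
          · intro h4
            rcases List.mem_cons.1 h4 with h5 | h5
            · exact absurd h3 (by rw [h5]; exact lt_irrefl _)
            · exact lt_irrefl _ (h3.trans (hL.1 _ h5))
        simp only [List.mem_cons, not_or] at h3
        rw [hfr.2 ha l'' h3.2, Rhs.cell_write, h1, if_neg (fun h => h3.1 h.2)]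
      · rw [hfr.2 ha l' hnot, Rhs.cell_write, h1]
        simp
    · obtain ⟨tmp, t1, t2, t3, t4⟩ := ih hL.2 l' hl'
      refine ⟨tmp, t1, t2, fun l'' hl'' => t3 l'' ?_, t4⟩
      rcases hl'' with h3 | h3
      · exact Or.inl fun h4 => h3 (List.mem_cons_of_mem _ h4)
      · exact Or.inr h3

/-! ### Boxes of addresses and loop nests -/

/-- The list of the addresses in a box, in lexicographic order. -/
def boxList : List ℕ → List (List ℤ)
  | [] => [[]]
  | b :: bs => (List.range b).flatMap fun i : ℕ => (boxList bs).map ((i : ℤ) :: ·)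

@[simp] lemma mem_boxList_nil (l : List ℤ) : l ∈ boxList [] ↔ l = [] := by simp [boxList]

@[simp] lemma cons_mem_boxList (x : ℤ) (l : List ℤ) (b : ℕ) (bs : List ℕ) :
    x :: l ∈ boxList (b :: bs) ↔ (0 ≤ x ∧ x < b) ∧ l ∈ boxList bs := by
  simp only [boxList, List.mem_flatMap, List.mem_range, List.mem_map, List.cons.injEq]
  constructor
  · rintro ⟨i, hi, l', hl', rfl, rfl⟩
    exact ⟨⟨by positivity, by exact_mod_cast hi⟩, hl'⟩
  · rintro ⟨⟨h0, h1⟩, hl⟩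
    exact ⟨x.toNat, by omega, l, hl, by omega, rfl⟩

/-- This order rules out double writes, and it is the well-founded order along which all the tables
are later defined. -/
lemma pairwise_boxList (bs : List ℕ) : (boxList bs).Pairwise (· < ·) := by
  induction bs with
  | nil => simp [boxList]
  | cons b bs ih =>
    rw [boxList, List.pairwise_flatMap]
    refine ⟨fun i _ => ?_, ?_⟩
    · rw [List.pairwise_map]
      exact ih.imp fun h => List.cons_lt_cons_iff.2 (Or.inr ⟨rfl, h⟩)
    · refine List.pairwise_lt_range.imp fun {i j} hij => ?_
      intro x hx y hy
      simp only [List.mem_map] at hx hy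
      obtain ⟨x', _, rfl⟩ := hx
      obtain ⟨y', _, rfl⟩ := hy
      exact List.cons_lt_cons_iff.2 (Or.inl (by exact_mod_cast hij))

/-- A loop nest with counters from depth `k` on; the bounds are scalar variables. -/
def nest (body : Prog) : ℕ → List ℕ → Prog
  | _, [] => body
  | k, b :: bs => Prog.seq (Prog.setInt (100 + k) 0 Fin.elim0 (IExpr.const 0))
      (Prog.while (Test.leInt (IExpr.add (IExpr.ctr k) (IExpr.const 1)) (IExpr.var b))
        (Prog.seq (nest body (k + 1) bs)
          (Prog.setInt (100 + k) 0 Fin.elim0 (IExpr.add (IExpr.ctr k) (IExpr.const 1)))))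

open Polynomial in
/-- The cost of a loop nest of depth `d`, as a polynomial in a common bound of the ranges. -/
def nestPoly (cb : ℕ) : ℕ → ℕ[X]
  | 0 => C cb
  | d + 1 => X * (nestPoly cb d + C 10) + C 8

/-- The value of a loop bound. -/
def State.bound (s : State) (b : ℕ) : ℕ := (s.ints b []).toNat

lemma State.addr_succ (s : State) (k : ℕ) : s.addr (k + 1) = s.addr k ++ [s.ints (100 + k) []] := by
  simp only [State.addr]
  rw [List.ofFn_succ', List.concat_eq_append]
  simp

lemma exec_setCtr (s : State) (k : ℕ) (e : IExpr) :
    Exec (Prog.setInt (100 + k) 0 Fin.elim0 e) s (s.writeInt (100 + k) [] (e.eval s))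
      (1 + e.cost) := by
  have h := Exec.setInt s (100 + k) 0 Fin.elim0 e
  simpa using h

lemma cell_writeInt_of_ne (s : State) (a a' : ℕ) (l : List ℤ) (z : ℤ) (h : a' ≠ a) :
    (s.writeInt a l z).cell a' = s.cell a' := by
  funext l'
  simp [State.cell, State.writeInt, h]

lemma State.ints_of_cell {s s' : State} {a : ℕ} (h : s.cell a = s'.cell a) :
    s.ints a = s'.ints a := by
  funext l
  exact congrArg Prod.fst (congrFun h l)

lemma State.reals_of_cell {s s' : State} {a : ℕ} (h : s.cell a = s'.cell a) :
    s.reals a = s'.reals a := by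
  funext l
  exact congrArg Prod.snd (congrFun h l)

lemma State.bound_of_cell {s s' : State} {a : ℕ} (h : s.cell a = s'.cell a) :
    s.bound a = s'.bound a := by
  rw [State.bound, State.bound, State.ints_of_cell h]

lemma State.addr_of_cell {s s' : State} {k : ℕ}
    (h : ∀ j < k, s.cell (100 + j) = s'.cell (100 + j)) : s.addr k = s'.addr k := by
  simp only [State.addr]
  congr 1
  funext i
  rw [State.ints_of_cell (h i i.2)]

/-- Induction on the remaining loop bounds. The bounds are scalars distinct from the table `a`, and
from the counters, whose names start at 100. The body therefore cannot change them, and each number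
of iterations is known when the nest is entered. -/
lemma exec_nest (a d : ℕ) (r : Rhs) (ha : a < 100) (B : ℕ) (bs : List ℕ) :
    ∀ (k : ℕ) (_ : k + bs.length = d) (s : State)
      (_ : ∀ b ∈ bs, b < 100 ∧ b ≠ a ∧ s.bound b ≤ B),
      ∃ s' n, Exec (nest (r.assign a d) k bs) s s' n ∧
        n ≤ (nestPoly (r.cost d) bs.length).eval B ∧
        (∀ j < k, s'.cell (100 + j) = s.cell (100 + j)) ∧
        Runs a d r ((boxList (bs.map s.bound)).map (s.addr k ++ ·)) s s' := by
  induction bs with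
  | nil =>
    intro k hk s _
    simp only [List.length_nil, add_zero] at hk
    subst hk
    obtain ⟨n, h, hn⟩ := r.exec_assign a k s
    refine ⟨_, n, h, by simpa [nestPoly] using hn, fun j hj => ?_, ?_⟩
    · funext l
      rw [Rhs.cell_write, if_neg (fun h => by omega)]
    · simp only [List.map_nil, boxList, List.map_cons, List.append_nil]
      exact Runs.cons (fun _ _ => rfl) rfl (Runs.nil fun _ _ => rfl)
  | cons b bs ih =>
    intro k hk s hb
    have hk' : k + 1 + bs.length = d := by simp only [List.length_cons] at hk; omega
    obtain ⟨hb1, hb2, hb3⟩ := hb b (by simp)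
    set c := (nestPoly (r.cost d) bs.length).eval B with hc
    -- the loop from iteration `i` on
    have loop : ∀ (j : ℕ) (i : ℕ) (s₁ : State), i + j = s.bound b →
        (∀ j < k, s₁.cell (100 + j) = s.cell (100 + j)) → s₁.ints (100 + k) [] = i →
        (∀ a' < 100, a' ≠ a → s₁.cell a' = s.cell a') →
        ∃ s' n, Exec (Prog.while
            (Test.leInt (IExpr.add (IExpr.ctr k) (IExpr.const 1)) (IExpr.var b))
            (Prog.seq (nest (r.assign a d) (k + 1) bs)
              (Prog.setInt (100 + k) 0 Fin.elim0 (IExpr.add (IExpr.ctr k) (IExpr.const 1)))))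
            s₁ s' n ∧ n ≤ j * (c + 10) + 6 ∧
          (∀ j < k, s'.cell (100 + j) = s.cell (100 + j)) ∧
          Runs a d r ((List.range' i j).flatMap fun i' : ℕ =>
            (boxList (bs.map s.bound)).map (fun l => s.addr k ++ (i' : ℤ) :: l)) s₁ s' := by
      intro j
      induction j with
      | zero =>
        intro i s₁ hi h1 h2 h3
        refine ⟨s₁, _, Exec.whileFalse ?_, ?_, h1, Runs.nil fun _ _ => rfl⟩
        · have : s₁.ints b [] = s.ints b [] := by rw [State.ints_of_cell (h3 b hb1 hb2)]
          simp only [Test.Holds, IExpr.eval, IExpr.eval_ctr, IExpr.eval_var, h2, this]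
          simp only [State.bound] at hi
          omega
        · simp [Test.cost, IExpr.cost]
      | succ j ihj =>
        intro i s₁ hi h1 h2 h3
        obtain ⟨s₂, n, e1, e2, e3, e4⟩ := ih (k + 1) hk' s₁ (fun b' hb' => by
          obtain ⟨q1, q2, q3⟩ := hb b' (by simp [hb'])
          exact ⟨q1, q2, by rwa [State.bound_of_cell (h3 b' q1 q2)]⟩)
        have hfr := e4.frame
        have hbd : bs.map s₁.bound = bs.map s.bound := by
          refine List.map_congr_left fun b' hb' => ?_
          obtain ⟨q1, q2, q3⟩ := hb b' (by simp [hb'])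
          exact State.bound_of_cell (h3 b' q1 q2)
        have hck : s₂.ints (100 + k) [] = i := by
          rw [State.ints_of_cell (e3 k (by omega)), h2]
        set s₃ := s₂.writeInt (100 + k) [] ((IExpr.add (IExpr.ctr k) (IExpr.const 1)).eval s₂)
          with hs₃
        have hs₃c : s₃.ints (100 + k) [] = ((i + 1 : ℕ) : ℤ) := by
          simp [hs₃, State.writeInt, IExpr.eval, hck]
        obtain ⟨s', n', f1, f2, f3, f4⟩ := ihj (i + 1) s₃ (by omega)
          (fun j' hj' => by
            rw [hs₃, cell_writeInt_of_ne _ _ _ _ _ (by omega), e3 j' (by omega), h1 j' hj'])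
          hs₃c
          (fun a' h' hne => by
            rw [hs₃, cell_writeInt_of_ne _ _ _ _ _ (by omega), hfr.1 a' h' hne, h3 a' h' hne])
        refine ⟨s', _, Exec.whileTrue ?_ (Exec.seq e1 (exec_setCtr _ _ _)) f1, ?_, f3, ?_⟩
        · have : s₁.ints b [] = s.ints b [] := by rw [State.ints_of_cell (h3 b hb1 hb2)]
          simp only [Test.Holds, IExpr.eval, IExpr.eval_ctr, IExpr.eval_var, h2, this]
          simp only [State.bound] at hi
          omega
        · simp only [Test.cost, IExpr.cost, IExpr.cost_ctr, IExpr.cost_var]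
          have : (j + 1) * (c + 10) = j * (c + 10) + (c + 10) := by ring
          omega
        · rw [List.range'_succ, List.flatMap_cons]
          refine Runs.append (s' := s₂) ?_ (f4.congr_left fun a' h' => ?_)
          · rw [hbd] at e4
            have haddr : s₁.addr (k + 1) = s.addr k ++ [(i : ℤ)] := by
              rw [State.addr_succ, h2, State.addr_of_cell h1]
            rw [haddr] at e4
            simpa using e4
          · rw [hs₃, cell_writeInt_of_ne _ _ _ _ _ (by omega)]
    set s₀ := s.writeInt (100 + k) [] ((IExpr.const 0).eval s) with hs₀
    obtain ⟨s', n, e1, e2, e3, e4⟩ := loop (s.bound b) 0 s₀ (by simp)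
      (fun j hj => by rw [hs₀, cell_writeInt_of_ne _ _ _ _ _ (by omega)])
      (by simp [hs₀, State.writeInt, IExpr.eval])
      (fun a' h' _ => by rw [hs₀, cell_writeInt_of_ne _ _ _ _ _ (by omega)])
    refine ⟨s', _, Exec.seq (exec_setCtr _ _ _) e1, ?_, e3, ?_⟩
    · simp only [List.length_cons, nestPoly, Polynomial.eval_add, Polynomial.eval_mul,
        Polynomial.eval_X, Polynomial.eval_C, IExpr.cost, ← hc]
      have : s.bound b * (c + 10) ≤ B * (c + 10) := Nat.mul_le_mul_right _ hb3
      omega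
    · have e5 := e4.congr_left (s₀ := s) (fun a' h' => by
        rw [hs₀, cell_writeInt_of_ne _ _ _ _ _ (by omega)])
      rw [← List.range_eq_range'] at e5
      convert e5 using 1
      simp only [List.map_cons, boxList, List.map_flatMap, List.map_map]
      rfl

/-! ### Sequences of phases -/

/-- A phase fills a table: a loop nest with given bounds around a single assignment. -/
structure Phase where
  bounds : List ℕ
  rhs : Rhs

/-- The dimension of the table. -/
abbrev Phase.dim (p : Phase) : ℕ := p.bounds.length

/-- The program of a phase that fills the array `a`. -/
def Phase.prog (p : Phase) (a : ℕ) : Prog := nest (p.rhs.assign a p.dim) 0 p.bounds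

/-- The box of addresses that are filled by a phase. -/
def Phase.box (p : Phase) (s : State) : List (List ℤ) := boxList (p.bounds.map s.bound)

/-- The cost of a phase. -/
def Phase.poly (p : Phase) : Polynomial ℕ := nestPoly (p.rhs.cost p.dim) p.dim

/-- The equations satisfied by the table of a phase: the cells outside the box are zero, and those
inside are determined by earlier ones. -/
def Phase.Ok (p : Phase) (a : ℕ) (s : State) : Prop :=
  (∀ l ∉ p.box s, s.cell a l = 0) ∧
  ∀ l ∈ p.box s, ∃ tmp : State, tmp.addr p.dim = l ∧ (∀ a' < a, tmp.cell a' = s.cell a') ∧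
    (∀ l', l' ∉ p.box s ∨ l' < l → tmp.cell a l' = s.cell a l') ∧
    s.cell a l = p.rhs.val a p.dim tmp

/-- The program that runs the given phases, filling the arrays `a, a + 1, …`. -/
def phasesProg : ℕ → List Phase → Prog
  | _, [] => Prog.skip
  | a, p :: ps => Prog.seq (p.prog a) (phasesProg (a + 1) ps)

/-- The cost of the program of several phases. -/
def phasesPoly : List Phase → Polynomial ℕ
  | [] => Polynomial.C 1
  | p :: ps => p.poly + phasesPoly ps

/-- Polynomials with natural coefficients are monotone. -/
lemma eval_mono (p : Polynomial ℕ) : Monotone fun x => p.eval x := by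
  intro x y h
  simp only [Polynomial.eval_eq_sum, Polynomial.sum]
  gcongr

/-- An array is zero before its own phase and untouched afterwards, so the equations of each phase
survive to the end. For the same reason the loop bounds may be read in the final state, which is
where their values will be known; the cost estimate is phrased accordingly. -/
lemma exec_phases (ps : List Phase) : ∀ (a : ℕ) (_ : a + ps.length ≤ 100) (s : State)
    (_ : ∀ (i : ℕ) (hi : i < ps.length), ∀ b ∈ ps[i].bounds, b < a + i)
    (_ : ∀ a' < 100, a ≤ a' → s.cell a' = 0),
    ∃ s' n, Exec (phasesProg a ps) s s' n ∧ (∀ a' < a, s'.cell a' = s.cell a') ∧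
      (∀ B : ℕ, (∀ p ∈ ps, ∀ b ∈ p.bounds, s'.bound b ≤ B) → n ≤ (phasesPoly ps).eval B) ∧
      ∀ (i : ℕ) (hi : i < ps.length), ps[i].Ok (a + i) s' := by
  induction ps with
  | nil =>
    intro a _ s _ _
    exact ⟨s, 1, Exec.skip s, fun _ _ => rfl, fun B _ => by simp [phasesPoly],
      fun i hi => absurd hi (by simp)⟩
  | cons p ps ih =>
    intro a hlen s hb hz
    simp only [List.length_cons] at hlen
    have hb0 : ∀ b ∈ p.bounds, b < a := fun b hb' => by
      have := hb 0 (by simp) b (by simpa using hb'); simpa using this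
    have key : ∀ B : ℕ, (∀ b ∈ p.bounds, s.bound b ≤ B) → ∃ s' n, Exec (p.prog a) s s' n ∧
        n ≤ p.poly.eval B ∧ Runs a p.dim p.rhs (p.box s) s s' := by
      intro B hB
      obtain ⟨s', n, h1, h2, _, h4⟩ := exec_nest a p.dim p.rhs (by omega) B p.bounds 0
        (by simp) s (fun b hb' => ⟨by have := hb0 b hb'; omega, (hb0 b hb').ne, hB b hb'⟩)
      refine ⟨s', n, h1, h2, ?_⟩
      simpa [State.addr, Phase.box] using h4
    -- The run has to be fixed before an arbitrary common bound is given, so it is taken with the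
    -- least one; monotonicity of the cost polynomial then covers every larger bound.
    set B₀ := (p.bounds.map s.bound).foldr max 0 with hB₀
    have hB₀' : ∀ b ∈ p.bounds, s.bound b ≤ B₀ := by
      have : ∀ L : List ℕ, ∀ x ∈ L, x ≤ L.foldr max 0 := by
        intro L
        induction L with
        | nil => simp
        | cons y L ih =>
          intro x hx
          rcases List.mem_cons.1 hx with rfl | hx
          · simp
          · exact (ih x hx).trans (by simp)
      exact fun b hb' => this _ _ (List.mem_map_of_mem hb')
    have hmin : ∀ B : ℕ, (∀ b ∈ p.bounds, s.bound b ≤ B) → B₀ ≤ B := by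
      have : ∀ (L : List ℕ) (B : ℕ), (∀ x ∈ L, x ≤ B) → L.foldr max 0 ≤ B := by
        intro L B
        induction L with
        | nil => simp
        | cons y L ih =>
          intro hx
          simp only [List.foldr_cons, max_le_iff]
          exact ⟨hx y (by simp), ih fun x hx' => hx x (by simp [hx'])⟩
      exact fun B hB => this _ _ (by simpa using hB)
    obtain ⟨s₁, n₁, e1, e2, e3⟩ := key B₀ hB₀'
    have hfr := e3.frame
    obtain ⟨s', n, f1, f2, f3, f4⟩ := ih (a + 1) (by omega) s₁
      (fun i hi b hb' => by
        have := hb (i + 1) (by simpa using hi) b (by simpa using hb'); omega)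
      (fun a' h h' => by rw [hfr.1 a' h (by omega), hz a' h (by omega)])
    have hs' : ∀ a' < a, s'.cell a' = s.cell a' := fun a' h => by
      rw [f2 a' (by omega), hfr.1 a' (by omega) (by omega)]
    have hbd : p.bounds.map s'.bound = p.bounds.map s.bound :=
      List.map_congr_left fun b hb' => State.bound_of_cell (hs' b (hb0 b hb'))
    refine ⟨s', _, Exec.seq e1 f1, hs', fun B hB => ?_, fun i hi => ?_⟩
    · simp only [phasesPoly, Polynomial.eval_add]
      refine Nat.add_le_add (e2.trans (eval_mono _ ?_))
        (f3 B fun p' hp' => hB p' (by simp [hp']))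
      refine hmin B fun b hb' => ?_
      have := hB p (by simp) b hb'
      rwa [State.bound_of_cell (hs' b (hb0 b hb'))] at this
    · cases i with
      | succ i =>
        have := f4 i (by simpa using hi)
        rw [show a + (i + 1) = a + 1 + i by ring]
        simpa using this
      | zero =>
        simp only [List.getElem_cons_zero, add_zero]
        have hbox : p.box s' = p.box s := by rw [Phase.box, Phase.box, hbd]
        have hcell : s'.cell a = s₁.cell a := f2 a (by omega)
        refine ⟨fun l hl => ?_, fun l hl => ?_⟩
        · rw [hbox] at hl
          rw [hcell, hfr.2 (by omega) l hl, hz a (by omega) le_rfl]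
          rfl
        · rw [hbox] at hl ⊢
          obtain ⟨tmp, t1, t2, t3, t4⟩ := e3.cellEq (by omega) (pairwise_boxList _) l hl
          refine ⟨tmp, t1, fun a' h => ?_, fun l' hl' => ?_, ?_⟩
          · rw [t2 a' (by omega) (by omega), f2 a' (by omega)]
          · rw [t3 l' hl', hcell]
          · rw [hcell, t4]

end RealRAM

end

noncomputable section

namespace PetriNet

/-! ### Stationary measures of stochastic Petri nets -/

variable {P T : Type}

/-- Every firing can be undone by further firings. -/
def WeaklyReversible (N : PetriNet P T) : Prop :=
  ∀ m m', N.Step m m' → Relation.ReflTransGen N.Step m' m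

lemma fire_eq (N : PetriNet P T) (m : P → ℕ) (t : T) :
    N.fire m t = m - N.inBag t + N.outBag t := rfl

lemma enabled_iff (N : PetriNet P T) (m : P → ℕ) (t : T) : N.Enabled m t ↔ N.inBag t ≤ m := Iff.rfl

lemma step_add (N : PetriNet P T) (r : P → ℕ) (t : T) :
    N.Step (r + N.inBag t) (r + N.outBag t) :=
  ⟨t, (N.enabled_iff _ _).2 le_add_self, by rw [fire_eq, add_tsub_cancel_right]⟩

/-- The untouched remainder `r` replaces truncated subtraction by addition. -/
lemma step_iff (N : PetriNet P T) (m m' : P → ℕ) :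
    N.Step m m' ↔ ∃ t r, m = r + N.inBag t ∧ m' = r + N.outBag t := by
  constructor
  · rintro ⟨t, h, rfl⟩
    exact ⟨t, m - N.inBag t, (tsub_add_cancel_of_le h).symm, rfl⟩
  · rintro ⟨t, r, rfl, rfl⟩
    exact N.step_add r t

lemma WeaklyReversible.symm {N : PetriNet P T} (h : N.WeaklyReversible) {m m' : P → ℕ}
    (hm : Relation.ReflTransGen N.Step m m') : Relation.ReflTransGen N.Step m' m := by
  induction hm with
  | refl => exact Relation.ReflTransGen.refl
  | tail _ h2 ih => exact (h _ _ h2).trans ih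

/-! ### Flows, global balance, and comparison of balanced measures -/

open Classical in
/-- The total flow of the measure `f` into the marking `m`. -/
def inflow [Fintype T] (N : PetriNet P T) (rate : T → ℝ) (f : (P → ℕ) → ℝ) (m : P → ℕ) : ℝ :=
  ∑ t, rate t * if N.outBag t ≤ m then f (m - N.outBag t + N.inBag t) else 0

open Classical in
/-- The total flow of the measure `f` out of the marking `m`. -/
def outflow [Fintype T] (N : PetriNet P T) (rate : T → ℝ) (f : (P → ℕ) → ℝ) (m : P → ℕ) : ℝ :=
  ∑ t, rate t * if N.inBag t ≤ m then f m else 0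

/-- The global balance equations. -/
def Balanced [Fintype T] (N : PetriNet P T) (rate : T → ℝ) (f : (P → ℕ) → ℝ) : Prop :=
  ∀ m, N.inflow rate f m = N.outflow rate f m

-- A column of π Q is inflow minus outflow. Firings that leave the marking unchanged are missing
-- from the diagonal of the generator but occur in both flows, where they cancel. Extending π by
-- zero is harmless because weak reversibility closes the reachability set under predecessors, so
-- that both flows vanish outside it.
open Classical in
lemma balanced_of_stationary [Fintype T] (N : PetriNet P T) (rate : T → ℝ)
    (hrev : N.WeaklyReversible) (m₀ : P → ℕ) (π : N.reach m₀ → ℝ)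
    (hπ : ∀ m' : N.reach m₀, HasSum (fun m : N.reach m₀ => π m * N.generator rate m m') 0) :
    N.Balanced rate (fun m => if h : m ∈ N.reach m₀ then π ⟨m, h⟩ else 0) := by
  intro m'
  set f : (P → ℕ) → ℝ := fun m => if h : m ∈ N.reach m₀ then π ⟨m, h⟩ else 0 with hf
  have hpred : ∀ t, N.outBag t ≤ m' →
      (m' - N.outBag t + N.inBag t ∈ N.reach m₀ ↔ m' ∈ N.reach m₀) := by
    intro t ht
    have hst := N.step_add (m' - N.outBag t) t
    rw [tsub_add_cancel_of_le ht] at hst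
    exact ⟨fun h => Relation.ReflTransGen.tail h hst, fun h => h.trans (hrev _ _ hst)⟩
  by_cases hm' : m' ∈ N.reach m₀
  swap
  · have h1 : N.inflow rate f m' = 0 := by
      refine Finset.sum_eq_zero fun t _ => ?_
      split_ifs with h
      · simp [hf, hpred t h, hm']
      · simp
    have h2 : N.outflow rate f m' = 0 := by
      refine Finset.sum_eq_zero fun t _ => ?_
      simp [hf, hm']
    rw [h1, h2]
  have hin : ∀ t, HasSum (fun m : N.reach m₀ =>
      if N.Enabled m t ∧ N.fire m t = m' then rate t * π m else 0)
      (rate t * if N.outBag t ≤ m' then f (m' - N.outBag t + N.inBag t) else 0) := by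
    intro t
    by_cases ht : N.outBag t ≤ m'
    · have hr := (hpred t ht).2 hm'
      rw [if_pos ht]
      convert hasSum_single (⟨m' - N.outBag t + N.inBag t, hr⟩ : N.reach m₀) ?_ using 1
      · have e1 : N.Enabled (m' - N.outBag t + N.inBag t) t := by
          rw [enabled_iff]; exact le_add_self
        have e2 : N.fire (m' - N.outBag t + N.inBag t) t = m' := by
          rw [fire_eq, add_tsub_cancel_right, tsub_add_cancel_of_le ht]
        simp only [hf]
        rw [dif_pos hr, if_pos ⟨e1, e2⟩]
      · rintro ⟨m, hm⟩ hne
        refine if_neg ?_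
        rintro ⟨h1, h2⟩
        refine hne (Subtype.ext ?_)
        change N.fire m t = m' at h2
        change m = m' - N.outBag t + N.inBag t
        rw [← h2, fire_eq, add_tsub_cancel_right, tsub_add_cancel_of_le h1]
    · rw [if_neg ht, mul_zero]
      convert hasSum_zero using 2 with m
      refine if_neg ?_
      rintro ⟨_, h2⟩
      exact ht (by rw [← h2, fire_eq]; exact le_add_self)
  have hout : HasSum (fun m : N.reach m₀ =>
      if (m : P → ℕ) = m' then ∑ t, (if N.Enabled m t then rate t * π m else 0) else 0)
      (N.outflow rate f m') := by
    convert hasSum_single (⟨m', hm'⟩ : N.reach m₀) ?_ using 1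
    · simp only [if_true, outflow]
      refine Finset.sum_congr rfl fun t _ => ?_
      simp [hf, hm', enabled_iff]
    · rintro ⟨m, hm⟩ hne
      exact if_neg fun h => hne (Subtype.ext h)
  have hdiff := (hasSum_sum (s := Finset.univ) fun t _ => hin t).sub hout
  have hzero := hπ ⟨m', hm'⟩
  have hcongr : (fun m : N.reach m₀ => π m * N.generator rate m m') = fun m : N.reach m₀ =>
      (∑ t, if N.Enabled m t ∧ N.fire m t = m' then rate t * π m else 0) -
      if (m : P → ℕ) = m' then ∑ t, (if N.Enabled m t then rate t * π m else 0) else 0 := by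
    funext m
    by_cases h : (m : P → ℕ) = m'
    · simp only [generator, if_pos h]
      rw [← Finset.sum_sub_distrib, Finset.sum_filter, ← Finset.sum_neg_distrib, Finset.mul_sum]
      refine Finset.sum_congr rfl fun t _ => ?_
      rw [← h]
      by_cases h1 : N.Enabled m t <;> by_cases h2 : N.fire m t = m <;> simp [h1, h2, mul_comm]
    · simp only [generator, if_neg h]
      rw [sub_zero, Finset.sum_filter, Finset.mul_sum]
      refine Finset.sum_congr rfl fun t _ => ?_
      split_ifs <;> ring
  rw [hcongr] at hzero
  exact sub_eq_zero.1 (hdiff.unique hzero)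

open Classical in
lemma hasSum_shift (f : (P → ℕ) → ℝ) (hf : Summable f) (b b' : P → ℕ) :
    HasSum (fun m => if b ≤ m then f (m - b + b') else 0) (∑' r, f (r + b')) := by
  have hinj : Function.Injective fun r : P → ℕ => r + b := add_left_injective b
  have hinj' : Function.Injective fun r : P → ℕ => r + b' := add_left_injective b'
  refine (hinj.hasSum_iff ?_).1 ?_
  · intro m hm
    refine if_neg fun h => hm ⟨m - b, tsub_add_cancel_of_le h⟩
  · have h : ((fun m => if b ≤ m then f (m - b + b') else 0) ∘ fun r : P → ℕ => r + b) =
        f ∘ fun r => r + b' := by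
      funext r
      simp
    rw [h]
    exact (hf.comp_injective hinj').hasSum

-- A transition carries r + W⁻ to r + W⁺, so summing its inflow over all markings gives the sum of
-- f(r + W⁻) over r. The total outflow is the same number, and this equality drives the comparison
-- below.
open Classical in
lemma hasSum_inflow [Fintype T] (N : PetriNet P T) (rate : T → ℝ) (f : (P → ℕ) → ℝ)
    (hf : Summable f) :
    HasSum (N.inflow rate f) (∑ t, rate t * ∑' r, f (r + N.inBag t)) :=
  hasSum_sum fun t _ => (hasSum_shift f hf (N.outBag t) (N.inBag t)).mul_left (rate t)

open Classical in
lemma hasSum_outflow [Fintype T] (N : PetriNet P T) (rate : T → ℝ) (f : (P → ℕ) → ℝ)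
    (hf : Summable f) :
    HasSum (N.outflow rate f) (∑ t, rate t * ∑' r, f (r + N.inBag t)) := by
  refine hasSum_sum fun t _ => HasSum.mul_left (rate t) ?_
  have h : (fun m => if N.inBag t ≤ m then f m else 0) =
      fun m => if N.inBag t ≤ m then f (m - N.inBag t + N.inBag t) else 0 := by
    funext m
    split_ifs with h
    · rw [tsub_add_cancel_of_le h]
    · rfl
  rw [h]
  exact hasSum_shift f hf (N.inBag t) (N.inBag t)

open Classical in
lemma outflow_eq [Fintype T] (N : PetriNet P T) (rate : T → ℝ) (f : (P → ℕ) → ℝ) (m : P → ℕ) :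
    N.outflow rate f m = (∑ t, rate t * if N.inBag t ≤ m then 1 else 0) * f m := by
  rw [outflow, Finset.sum_mul]
  refine Finset.sum_congr rfl fun t _ => ?_
  split_ifs <;> ring

/-- A non-negative solution of the balance equations is dominated, on the markings that lead to
`x₀`, by any summable one that is positive at `x₀`. -/
lemma Balanced.le_mul_of_summable [Fintype T] {N : PetriNet P T} {rate : T → ℝ}
    (hrate : ∀ t, 0 < rate t) {v u : (P → ℕ) → ℝ} (hv : N.Balanced rate v)
    (hu : N.Balanced rate u) (hv0 : ∀ m, 0 ≤ v m) (hu0 : ∀ m, 0 ≤ u m) (hus : Summable u)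
    (x₀ : P → ℕ) (hx₀ : 0 < u x₀) :
    ∀ m, Relation.ReflTransGen N.Step m x₀ → v m ≤ v x₀ / u x₀ * u m := by
  classical
  set a := v x₀ / u x₀ with ha
  have ha0 : 0 ≤ a := div_nonneg (hv0 _) hx₀.le
  -- Both functions being balanced, the inflow of their minimum is at most its outflow; unlike `v`,
  -- the minimum is summable.
  set w : (P → ℕ) → ℝ := fun m => min (v m) (a * u m) with hw
  have hw0 : ∀ m, 0 ≤ w m := fun m => le_min (hv0 m) (mul_nonneg ha0 (hu0 m))
  have hws : Summable w :=
    Summable.of_nonneg_of_le hw0 (fun m => min_le_right _ _) (hus.mul_left a)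
  have hle : ∀ m, N.inflow rate w m ≤ N.outflow rate w m := by
    intro m
    have h1 : N.inflow rate w m ≤ N.inflow rate v m := by
      refine Finset.sum_le_sum fun t _ => mul_le_mul_of_nonneg_left ?_ (hrate t).le
      split_ifs
      · exact min_le_left _ _
      · exact le_rfl
    have h2 : N.inflow rate w m ≤ a * N.inflow rate u m := by
      rw [inflow, inflow, Finset.mul_sum]
      refine Finset.sum_le_sum fun t _ => ?_
      rw [mul_left_comm]
      refine mul_le_mul_of_nonneg_left ?_ (hrate t).le
      split_ifs
      · exact min_le_right _ _
      · simp
    rw [hv m, outflow_eq] at h1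
    rw [hu m, outflow_eq, mul_left_comm] at h2
    rw [outflow_eq, hw]
    simp only
    rw [mul_min_of_nonneg _ _ (Finset.sum_nonneg fun t _ => mul_nonneg (hrate t).le (by
      split_ifs <;> norm_num))]
    exact le_min h1 h2
  -- The total inflow and outflow of a summable function coincide, so the non-negative differences
  -- sum to zero and each of them vanishes.
  have hwB : N.Balanced rate w := by
    have h := (N.hasSum_outflow rate w hws).sub (N.hasSum_inflow rate w hws)
    rw [sub_self, hasSum_zero_iff_of_nonneg (fun m => sub_nonneg.2 (hle m))] at h
    exact fun m => (sub_eq_zero.1 (congrFun h m)).symm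
  intro m hm
  suffices h : v m - w m = 0 by
    have h1 : v m = w m := by linarith
    rw [h1]
    exact min_le_right _ _
  induction hm using Relation.ReflTransGen.head_induction_on with
  | refl =>
    have : a * u x₀ = v x₀ := div_mul_cancel₀ _ hx₀.ne'
    simp [hw, this]
  | @head m m' hst _ ih =>
    obtain ⟨t, r, rfl, rfl⟩ := (N.step_iff _ _).1 hst
    -- As `v - w` vanishes at the successor, so does its outflow there and hence, by balance, its
    -- inflow. The inflow is a sum of non-negative terms, one of which is a positive multiple of `v
    -- - w` at the predecessor.
    have h1 : N.outflow rate v (r + N.outBag t) - N.outflow rate w (r + N.outBag t) = 0 := by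
      rw [outflow_eq, outflow_eq, ← mul_sub, ih, mul_zero]
    rw [← hv, ← hwB, inflow, inflow, ← Finset.sum_sub_distrib] at h1
    have h2 : ∀ t' ∈ Finset.univ, 0 ≤ (rate t' *
          if N.outBag t' ≤ r + N.outBag t then v (r + N.outBag t - N.outBag t' + N.inBag t') else 0)
        - rate t' *
          if N.outBag t' ≤ r + N.outBag t then w (r + N.outBag t - N.outBag t' + N.inBag t')
            else 0 := by
      intro t' _
      rw [← mul_sub]
      refine mul_nonneg (hrate t').le (sub_nonneg.2 ?_)
      split_ifs
      · exact min_le_left _ _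
      · exact le_rfl
    have h3 := (Finset.sum_eq_zero_iff_of_nonneg h2).1 h1 t (Finset.mem_univ t)
    rw [if_pos le_add_self, if_pos le_add_self, ← mul_sub, add_tsub_cancel_right] at h3
    exact (mul_eq_zero.1 h3).resolve_left (hrate t).ne'

/-! ### The product-form measure -/

section ProductForm

variable [Fintype T] {N : PetriNet P T} {rate : T → ℝ} {vis : (P → ℕ) → ℝ}
  {wit : (P → ℕ) → P → ℚ}

lemma inBag_mem_bags (N : PetriNet P T) (t : T) : N.inBag t ∈ N.bags := by
  classical
  simp [bags]

lemma outBag_mem_bags (N : PetriNet P T) (t : T) : N.outBag t ∈ N.bags := by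
  classical
  simp [bags]

/-- Every bag is consumed by some transition. -/
def AllConsumed (N : PetriNet P T) : Prop := ∀ t, ∃ t', N.inBag t' = N.outBag t

lemma exists_inBag (hN : N.AllConsumed) {b : P → ℕ} (hb : b ∈ N.bags) : ∃ t, N.inBag t = b := by
  classical
  simp only [bags, Finset.mem_union, Finset.mem_image, Finset.mem_univ, true_and] at hb
  rcases hb with ⟨t, rfl⟩ | ⟨t, rfl⟩
  · exact ⟨t, rfl⟩
  · exact hN t

lemma bagRate_pos (hrate : ∀ t, 0 < rate t) (hN : N.AllConsumed) {b : P → ℕ} (hb : b ∈ N.bags) :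
    0 < N.bagRate rate b := by
  classical
  obtain ⟨t, ht⟩ := exists_inBag hN hb
  exact Finset.sum_pos (fun t _ => hrate t) ⟨t, by simp [ht]⟩

lemma mu_pos (hrate : ∀ t, 0 < rate t) (hN : N.AllConsumed) (hvis : N.IsVisit rate vis) (p : P) :
    0 < N.mu rate vis wit p :=
  Finset.prod_pos fun b hb =>
    Real.rpow_pos_of_pos (div_pos (hvis.1 b hb) (bagRate_pos hrate hN hb)) _

variable [Fintype P]

/-- The product-form measure of a marking. -/
def weightOf (μ : P → ℝ) (m : P → ℕ) : ℝ := ∏ p, μ p ^ m p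

lemma weightOf_add (μ : P → ℝ) (m m' : P → ℕ) :
    weightOf μ (m + m') = weightOf μ m * weightOf μ m' := by
  simp [weightOf, pow_add, Finset.prod_mul_distrib]

lemma weightOf_pos {μ : P → ℝ} (hμ : ∀ p, 0 < μ p) (m : P → ℕ) : 0 < weightOf μ m :=
  Finset.prod_pos fun p _ => pow_pos (hμ p) _

/-- Take logarithms: log μ is the combination of the log φ(b), φ(b) = vis(b)/λ(b), with the
witnesses as coefficients. Pairing it with W⁺(t) - W⁻(t) leaves, by the witness equations, only log
φ of the produced bag minus log φ of the consumed one. -/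
lemma weightOf_inBag_mul (hrate : ∀ t, 0 < rate t) (hN : N.AllConsumed)
    (hvis : N.IsVisit rate vis) (hwit : ∀ b ∈ N.bags, N.IsWitness b (wit b)) (t : T) :
    weightOf (N.mu rate vis wit) (N.inBag t) * (vis (N.outBag t) / N.bagRate rate (N.outBag t)) =
      weightOf (N.mu rate vis wit) (N.outBag t) *
        (vis (N.inBag t) / N.bagRate rate (N.inBag t)) := by
  classical
  set φ : (P → ℕ) → ℝ := fun b => vis b / N.bagRate rate b with hφ
  have hφ0 : ∀ b ∈ N.bags, 0 < φ b := fun b hb =>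
    div_pos (hvis.1 b hb) (bagRate_pos hrate hN hb)
  set μ := N.mu rate vis wit with hμ
  have hμ0 : ∀ p, 0 < μ p := fun p => mu_pos hrate hN hvis p
  have hlog : ∀ p, Real.log (μ p) = ∑ b ∈ N.bags, (wit b p : ℝ) * Real.log (φ b) := by
    intro p
    rw [hμ, mu, Real.log_prod (fun b hb => (Real.rpow_pos_of_pos (hφ0 b hb) _).ne')]
    exact Finset.sum_congr rfl fun b hb => Real.log_rpow (hφ0 b hb) _
  have hlogw : ∀ m, Real.log (weightOf μ m) = ∑ p, (m p : ℝ) * Real.log (μ p) := by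
    intro m
    rw [weightOf, Real.log_prod (fun p _ => (pow_pos (hμ0 p) _).ne')]
    exact Finset.sum_congr rfl fun p _ => Real.log_pow _ _
  have hi := hφ0 _ (N.inBag_mem_bags t)
  have ho := hφ0 _ (N.outBag_mem_bags t)
  -- If the two bags coincided, the witness equations would give -1 = 1.
  have hne : N.inBag t ≠ N.outBag t := by
    intro h
    have h1 := (hwit _ (N.inBag_mem_bags t) t).1 rfl
    have h2 := (hwit _ (N.inBag_mem_bags t) t).2.1 h.symm
    rw [h1] at h2
    norm_num at h2
  refine Real.log_injOn_pos (mul_pos (weightOf_pos hμ0 _) ho) (mul_pos (weightOf_pos hμ0 _) hi) ?_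
  change Real.log (_ * φ _) = Real.log (_ * φ _)
  rw [Real.log_mul (weightOf_pos hμ0 _).ne' ho.ne', Real.log_mul (weightOf_pos hμ0 _).ne' hi.ne',
    hlogw, hlogw]
  have key : ∑ p, ((N.outBag t p : ℝ) - N.inBag t p) * Real.log (μ p) =
      Real.log (φ (N.outBag t)) - Real.log (φ (N.inBag t)) := by
    have h1 : ∀ b ∈ N.bags, (∑ p, (wit b p : ℝ) * ((N.outBag t p : ℝ) - N.inBag t p)) =
        (if b = N.outBag t then 1 else 0) - (if b = N.inBag t then 1 else 0) := by
      intro b hb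
      obtain ⟨w1, w2, w3⟩ := hwit b hb t
      have hc : (∑ p, (wit b p : ℝ) * ((N.outBag t p : ℝ) - N.inBag t p)) =
          ((∑ p, wit b p * ((N.post p t : ℚ) - N.pre p t) : ℚ) : ℝ) := by
        push_cast
        rfl
      rw [hc]
      by_cases e1 : N.inBag t = b
      · rw [w1 e1, if_neg (by rw [← e1]; exact hne), if_pos e1.symm]; norm_num
      · by_cases e2 : N.outBag t = b
        · rw [w2 e2, if_pos e2.symm, if_neg (fun h => e1 h.symm)]; norm_num
        · rw [w3 e1 e2, if_neg (fun h => e2 h.symm), if_neg (fun h => e1 h.symm)]; norm_num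
    calc ∑ p, ((N.outBag t p : ℝ) - N.inBag t p) * Real.log (μ p)
        = ∑ b ∈ N.bags, (∑ p, (wit b p : ℝ) * ((N.outBag t p : ℝ) - N.inBag t p)) *
            Real.log (φ b) := by
          simp only [hlog, Finset.mul_sum, Finset.sum_mul]
          rw [Finset.sum_comm]
          refine Finset.sum_congr rfl fun b _ => Finset.sum_congr rfl fun p _ => by ring
      _ = ∑ b ∈ N.bags, ((if b = N.outBag t then 1 else 0) - (if b = N.inBag t then 1 else 0)) *
            Real.log (φ b) := Finset.sum_congr rfl fun b hb => by rw [h1 b hb]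
      _ = _ := by
          simp only [sub_mul, ite_mul, one_mul, zero_mul, Finset.sum_sub_distrib,
            Finset.sum_ite_eq', N.inBag_mem_bags t, N.outBag_mem_bags t, if_true]
  simp only [sub_mul, Finset.sum_sub_distrib] at key
  linarith

/-- After division by the weight of the marking, group the inflow by produced bags and the outflow
by consumed bags. For each bag b contained in the marking the traffic equation vis 𝐏 = vis turns the
first group into vis(b)/φ(b) = λ(b), which is the second group. -/
lemma balanced_weightOf (hrate : ∀ t, 0 < rate t) (hN : N.AllConsumed)
    (hvis : N.IsVisit rate vis) (hwit : ∀ b ∈ N.bags, N.IsWitness b (wit b)) :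
    N.Balanced rate (weightOf (N.mu rate vis wit)) := by
  classical
  intro m
  set μ := N.mu rate vis wit with hμ
  set φ : (P → ℕ) → ℝ := fun b => vis b / N.bagRate rate b with hφ
  have hφ0 : ∀ b ∈ N.bags, 0 < φ b := fun b hb =>
    div_pos (hvis.1 b hb) (bagRate_pos hrate hN hb)
  have h1 : N.inflow rate (weightOf μ) m = weightOf μ m *
      ∑ t, if N.outBag t ≤ m then rate t * φ (N.inBag t) / φ (N.outBag t) else 0 := by
    rw [inflow, Finset.mul_sum]
    refine Finset.sum_congr rfl fun t _ => ?_
    split_ifs with h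
    · have h2 := weightOf_inBag_mul hrate hN hvis hwit t
      change weightOf μ _ * φ _ = weightOf μ _ * φ _ at h2
      have ho := hφ0 _ (N.outBag_mem_bags t)
      have h3 : weightOf μ m = weightOf μ (m - N.outBag t) * weightOf μ (N.outBag t) := by
        rw [← weightOf_add, tsub_add_cancel_of_le h]
      rw [weightOf_add, h3]
      field_simp
      linear_combination weightOf μ (m - N.outBag t) * rate t * h2
    · simp
  rw [h1, outflow_eq, mul_comm]
  congr 1
  have g1 : (∑ t, if N.outBag t ≤ m then rate t * φ (N.inBag t) / φ (N.outBag t) else 0) =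
      ∑ b ∈ N.bags, ∑ t with N.outBag t = b,
        if b ≤ m then rate t * φ (N.inBag t) / φ b else 0 := by
    rw [← Finset.sum_fiberwise_of_maps_to (s := Finset.univ) (t := N.bags) (g := N.outBag)
      (fun t _ => N.outBag_mem_bags t)]
    refine Finset.sum_congr rfl fun b _ => Finset.sum_congr rfl fun t ht => ?_
    rw [(Finset.mem_filter.1 ht).2]
  have g2 : (∑ t, rate t * if N.inBag t ≤ m then (1 : ℝ) else 0) =
      ∑ b ∈ N.bags, ∑ t with N.inBag t = b, if b ≤ m then rate t else 0 := by
    rw [← Finset.sum_fiberwise_of_maps_to (s := Finset.univ) (t := N.bags) (g := N.inBag)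
      (fun t _ => N.inBag_mem_bags t)]
    refine Finset.sum_congr rfl fun b _ => Finset.sum_congr rfl fun t ht => ?_
    rw [(Finset.mem_filter.1 ht).2]
    split_ifs <;> simp
  rw [g1, g2]
  refine Finset.sum_congr rfl fun b hb => ?_
  split_ifs with h
  swap
  · simp
  have hr := bagRate_pos (rate := rate) hrate hN hb
  have hv := hvis.1 b hb
  have h4 : (∑ t with N.outBag t = b, rate t * φ (N.inBag t)) = vis b := by
    rw [← hvis.2 b hb]
    rw [← Finset.sum_fiberwise_of_maps_to (s := Finset.univ.filter fun t => N.outBag t = b)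
      (t := N.bags) (g := N.inBag) (fun t _ => N.inBag_mem_bags t)]
    refine Finset.sum_congr rfl fun b' _ => ?_
    rw [routing, Finset.mul_sum, Finset.filter_filter, Finset.sum_filter, Finset.sum_filter]
    refine Finset.sum_congr rfl fun t ht => ?_
    by_cases e1 : N.inBag t = b' <;> by_cases e2 : N.outBag t = b
    · simp only [e1, e2, and_self, if_true, hφ]
      ring
    all_goals simp [e1, e2]
  rw [← Finset.sum_div, h4]
  have h5 : (∑ t with N.inBag t = b, rate t) = N.bagRate rate b := by
    rw [bagRate, Finset.sum_filter, Finset.sum_filter]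
    exact Finset.sum_congr rfl fun t _ => by congr
  rw [h5]
  change vis b / (vis b / N.bagRate rate b) = N.bagRate rate b
  field_simp

/-- The product-form measure of an ergodic net is summable over the reachability set. -/
theorem summable_weightOf (hrate : ∀ t, 0 < rate t) (hN : N.AllConsumed)
    (hrev : N.WeaklyReversible) (hvis : N.IsVisit rate vis)
    (hwit : ∀ b ∈ N.bags, N.IsWitness b (wit b)) (m₀ : P → ℕ) (herg : N.Ergodic rate m₀) :
    Summable fun m : N.reach m₀ => weightOf (N.mu rate vis wit) m := by
  classical
  obtain ⟨π, h0, h1, h2⟩ := herg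
  have hb := N.balanced_of_stationary rate hrev m₀ π h2
  set u : (P → ℕ) → ℝ := fun m => if h : m ∈ N.reach m₀ then π ⟨m, h⟩ else 0 with hu
  have hu0 : ∀ m, 0 ≤ u m := fun m => by
    simp only [hu]; split_ifs
    · exact h0 _
    · exact le_rfl
  have hur : ∀ m : N.reach m₀, u m = π m := fun m => by simp [hu]
  have hus : Summable u := by
    have : Summable (u ∘ ((↑) : N.reach m₀ → P → ℕ)) := by
      convert h1.summable using 1
      funext m
      exact hur m
    refine (Function.Injective.summable_iff Subtype.val_injective ?_).1 this
    intro m hm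
    simp only [Subtype.range_coe_subtype, Set.ofPred_mem_eq] at hm
    simp [hu, hm]
  obtain ⟨x₀, hx₀⟩ : ∃ x₀ : N.reach m₀, π x₀ ≠ 0 := by
    by_contra! h
    have : π = fun _ => 0 := funext h
    rw [this] at h1
    exact zero_ne_one (hasSum_zero.unique h1)
  have hpos : 0 < u x₀ := by rw [hur]; exact lt_of_le_of_ne (h0 _) hx₀.symm
  have hdom := (balanced_weightOf hrate hN hvis hwit).le_mul_of_summable hrate hb
    (fun m => (weightOf_pos (fun p => mu_pos hrate hN hvis p) m).le) hu0 hus x₀ hpos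
  exact Summable.of_nonneg_of_le
    (fun m => (weightOf_pos (fun p => mu_pos hrate hN hvis p) m.1).le)
    (fun m : N.reach m₀ => hdom m ((hrev.symm m.2).trans x₀.2))
    ((hus.comp_injective Subtype.val_injective).mul_left _)

end ProductForm

end PetriNet

end


noncomputable section

namespace OpenPi3

/-! ### Reachability in open `Π³`-nets -/

variable {P T : Type} [Fintype P] [Fintype T] (O : OpenPi3 P T)

/-- The restriction to the places of the open net of the bag of a place of the closed net. -/
def obag (x : Option P) : P → ℕ := fun p => O.str.bag x (some p)

open Classical in
/-- The marking with a single token in `x`, and the empty marking if `x` is the deleted place. -/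
def unit (x : Option P) : P → ℕ := fun p => if some p = x then 1 else 0

open Classical in
/-- The resources consumed together with a token in `x`. -/
def rho (x : Option P) : P → ℕ := fun p => if some p = x then 0 else O.obag x p

/-- The number of tokens in the layer `i`. -/
def count (i : ℕ) (m : P → ℕ) : ℕ := ∑ p ∈ O.layerSet i, m p

@[simp] lemma mem_layerSet {i : ℕ} {p : P} : p ∈ O.layerSet i ↔ O.str.layer (some p) = i := by
  simp [layerSet]

lemma mem_maxSet {i : ℕ} {p : P} :
    p ∈ O.maxSet i ↔ O.str.layer (some p) = i ∧ ∀ q, O.str.layer (some q) = i → O.pot q ≤ O.pot p := by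
  simp [maxSet]

lemma one_le_N : 1 ≤ O.N := by
  rw [← O.layer_ext]; exact O.str.one_le_layer none

lemma obag_eq (x : Option P) : O.obag x = unit x + O.rho x := by
  funext p
  by_cases h : some p = x
  · subst h
    simp [obag, unit, rho, O.str.bag_self]
  · simp [unit, rho, h]

lemma mem_maxSet_of_rho_pos {x : Option P} {p : P} (h : 0 < O.rho x p) :
    O.str.layer (some p) + 1 = O.str.layer x ∧ p ∈ O.maxSet (O.str.layer (some p)) := by
  have hne : some p ≠ x := by
    rintro rfl
    simp [rho] at h
  simp only [rho, hne, if_false] at h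
  obtain ⟨h1, h2⟩ := O.str.resource x (some p) hne h
  refine ⟨h1, O.mem_maxSet.2 ⟨rfl, fun q hq => h2 (some q) hq⟩⟩

/-- A resource lies one layer below the place that uses it, and the deleted place is in the last
layer. -/
lemma bag_none {x : Option P} (hx : x ≠ none) : O.str.bag x none = 0 := by
  by_contra h
  have h1 := (O.str.resource x none hx.symm (Nat.pos_of_ne_zero h)).1
  have h2 := O.str.layer_le x
  have h3 := O.layer_ext
  omega

open Classical in
lemma sum_unit (s : Finset P) (f : P → ℤ) (p : P) :
    ∑ q ∈ s, f q * (unit (some p) q : ℤ) = if p ∈ s then f p else 0 := by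
  simp [unit, Finset.sum_ite_eq']

lemma sum_unit_none (s : Finset P) (f : P → ℤ) :
    ∑ q ∈ s, f q * (unit (none : Option P) q : ℤ) = 0 := by
  simp [unit]

lemma sum_rho_univ (x : Option P) : ∑ p, O.rho x p = O.str.pot x := by
  classical
  rw [ClosedPi3.pot, Fintype.sum_option]
  have h : ∀ p, O.str.bag x (some p) = unit x p + O.rho x p := fun p => congrFun (O.obag_eq x) p
  simp only [h, Finset.sum_add_distrib]
  cases x with
  | none => simp [O.str.bag_self, unit]
  | some q =>
    rw [O.bag_none (by simp)]
    simp [unit]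

lemma sum_rho (x : Option P) (i : ℕ) :
    O.count i (O.rho x) = if i + 1 = O.str.layer x then O.str.pot x else 0 := by
  split_ifs with h
  · rw [← O.sum_rho_univ]
    refine Finset.sum_subset (Finset.subset_univ _) fun p _ hp => ?_
    by_contra h0
    have := (O.mem_maxSet_of_rho_pos (Nat.pos_of_ne_zero h0)).1
    exact hp (O.mem_layerSet.2 (by omega))
  · refine Finset.sum_eq_zero fun p hp => ?_
    by_contra h0
    have := (O.mem_maxSet_of_rho_pos (Nat.pos_of_ne_zero h0)).1
    rw [O.mem_layerSet.1 hp] at this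
    exact h this

lemma count_add (i : ℕ) (m m' : P → ℕ) : O.count i (m + m') = O.count i m + O.count i m' := by
  simp [count, Finset.sum_add_distrib]

lemma count_unit {i : ℕ} {x : Option P} (hi : i = O.N → x ≠ none) :
    O.count i (unit x) = if O.str.layer x = i then 1 else 0 := by
  classical
  cases x with
  | none =>
    have : O.str.layer none ≠ i := fun h => hi (by rw [← h, O.layer_ext]) rfl
    simp [count, unit, this]
  | some p => simp [count, unit]

lemma count_obag {i : ℕ} (hi : i < O.N) (x : Option P) : O.count i (O.obag x) =
    (if O.str.layer x = i then 1 else 0) + if i + 1 = O.str.layer x then O.str.pot x else 0 := by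
  rw [obag_eq, count_add, sum_rho, O.count_unit (fun h => absurd h hi.ne)]

lemma POT_N : O.POT O.N = O.str.pot none := by simp [POT]

lemma pot_le_POT {i : ℕ} (hi : i < O.N) {p : P} (hp : O.str.layer (some p) = i) :
    O.pot p ≤ O.POT i := by
  rw [POT, if_neg hi.ne]
  exact Finset.le_sup (f := O.pot) (O.mem_layerSet.2 hp)

lemma pot_of_mem_maxSet {i : ℕ} (hi : i < O.N) {p : P} (hp : p ∈ O.maxSet i) :
    O.pot p = O.POT i := by
  obtain ⟨h1, h2⟩ := O.mem_maxSet.1 hp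
  refine le_antisymm (O.pot_le_POT hi h1) ?_
  rw [POT, if_neg hi.ne]
  exact Finset.sup_le fun q hq => h2 q (O.mem_layerSet.1 hq)

lemma mem_maxSet_iff {i : ℕ} (hi : i < O.N) {p : P} :
    p ∈ O.maxSet i ↔ O.str.layer (some p) = i ∧ O.pot p = O.POT i := by
  refine ⟨fun h => ⟨(O.mem_maxSet.1 h).1, O.pot_of_mem_maxSet hi h⟩, fun h => ?_⟩
  exact O.mem_maxSet.2 ⟨h.1, fun q hq => by rw [h.2]; exact O.pot_le_POT hi hq⟩

lemma maxSet_nonempty {i : ℕ} (h : (O.layerSet i).Nonempty) : (O.maxSet i).Nonempty := by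
  obtain ⟨p, hp, hmax⟩ := Finset.exists_max_image (O.layerSet i) O.pot h
  exact ⟨p, O.mem_maxSet.2 ⟨O.mem_layerSet.1 hp, fun q hq => hmax q (O.mem_layerSet.2 hq)⟩⟩

lemma cin_of_mem_maxSet {i : ℕ} (hi : i < O.N) {p : P} (hp : p ∈ O.maxSet i) : O.cin p = 0 := by
  rw [cin, (O.mem_maxSet.1 hp).1, O.pot_of_mem_maxSet hi hp, sub_self]

/-! #### Steps of the open net -/

lemma exists_inBag_eq (t : T) : ∃ x, O.closed.inBag t = O.str.bag x := by
  classical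
  have h : O.closed.inBag t ∈ (O.closed.bags : Set (Option P → ℕ)) := O.closed.inBag_mem_bags t
  obtain ⟨x, _, hx⟩ := O.str.bag_bij.surjOn h
  exact ⟨x, hx.symm⟩

lemma exists_outBag_eq (t : T) : ∃ x, O.closed.outBag t = O.str.bag x := by
  classical
  have h : O.closed.outBag t ∈ (O.closed.bags : Set (Option P → ℕ)) := O.closed.outBag_mem_bags t
  obtain ⟨x, _, hx⟩ := O.str.bag_bij.surjOn h
  exact ⟨x, hx.symm⟩

lemma net_inBag {t : T} {x : Option P} (h : O.closed.inBag t = O.str.bag x) :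
    O.net.inBag t = O.obag x := by
  funext p
  exact congrFun h (some p)

lemma net_outBag {t : T} {x : Option P} (h : O.closed.outBag t = O.str.bag x) :
    O.net.outBag t = O.obag x := by
  funext p
  exact congrFun h (some p)

lemma exists_endpoints (t : T) : ∃ x y, O.closed.inBag t = O.str.bag x ∧
    O.closed.outBag t = O.str.bag y ∧ O.str.layer x = O.str.layer y ∧ x ≠ y := by
  obtain ⟨x, hx⟩ := O.exists_inBag_eq t
  obtain ⟨y, hy⟩ := O.exists_outBag_eq t
  refine ⟨x, y, hx, hy, ?_, ?_⟩
  · exact (O.str.component x y).2 (Relation.ReflTransGen.single ⟨t, hx, hy⟩)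
  · rintro rfl
    exact O.proper.1 t (hx.trans hy.symm)

/-- Mutual reachability of markings. -/
abbrev Conn (m m' : P → ℕ) : Prop := Relation.ReflTransGen O.net.Step m m'

/-- Strong connectivity gives a path in the bag graph, and the same remainder `r` is carried along
each of its edges. -/
lemma conn_obag {x y : Option P} (h : O.str.layer x = O.str.layer y) (r : P → ℕ) :
    O.Conn (r + O.obag x) (r + O.obag y) := by
  have h1 := (O.str.component x y).1 h
  have h2 : ∀ b b', Relation.ReflTransGen O.closed.BagEdge b b' →
      O.Conn (r + fun p => b (some p)) (r + fun p => b' (some p)) := by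
    intro b b' hb
    induction hb with
    | refl => exact Relation.ReflTransGen.refl
    | tail _ h ih =>
      obtain ⟨t, rfl, rfl⟩ := h
      exact ih.tail (O.net.step_add r t)
  exact h2 _ _ h1

lemma step_cases {m m' : P → ℕ} (h : O.net.Step m m') :
    ∃ x y r, O.str.layer x = O.str.layer y ∧ m = r + O.obag x ∧ m' = r + O.obag y := by
  obtain ⟨t, r, rfl, rfl⟩ := (O.net.step_iff _ _).1 h
  obtain ⟨x, y, hx, hy, hxy, _⟩ := O.exists_endpoints t
  exact ⟨x, y, r, hxy, by rw [O.net_inBag hx], by rw [O.net_outBag hy]⟩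

lemma weaklyReversible : O.net.WeaklyReversible := by
  intro m m' h
  obtain ⟨x, y, r, hxy, rfl, rfl⟩ := O.step_cases h
  exact O.conn_obag hxy.symm r

lemma Conn.symm {O : OpenPi3 P T} {m m' : P → ℕ} (h : O.Conn m m') : O.Conn m' m :=
  O.weaklyReversible.symm h

/-- The produced bag differs from the consumed one and strong connectivity leads back to it; the
first edge of this path consumes the produced bag. -/
lemma allConsumed : O.net.AllConsumed := by
  intro t
  obtain ⟨x, y, hx, hy, hxy, hne⟩ := O.exists_endpoints t
  have h := (O.str.component y x).1 hxy.symm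
  rcases Relation.ReflTransGen.cases_head h with h | ⟨b, ⟨t', h1, _⟩, _⟩
  · exact absurd (O.str.bag_bij.injOn (Set.mem_univ _) (Set.mem_univ _) h) hne.symm
  · exact ⟨t', by rw [O.net_inBag h1, O.net_outBag hy]⟩

/-! ### Activity of layers -/

/-- The layer `i + 1` is active: a token in it, or one that may arrive, can be moved. -/
def Act (i : ℕ) (m : P → ℕ) : Prop :=
  O.POT (i + 1) ≤ O.count i m ∨ ∃ p ∈ O.layerSet (i + 1), 0 < m p ∧ O.pot p ≤ O.count i m

lemma act_of_obag {i : ℕ} {x : Option P} (hx : O.str.layer x = i + 1) (r : P → ℕ) :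
    O.Act i (r + O.obag x) := by
  have hi : i < O.N := by have := O.str.layer_le x; omega
  have hc : O.str.pot x ≤ O.count i (r + O.obag x) := by
    rw [count_add, O.count_obag hi, hx, if_pos rfl]
    omega
  cases x with
  | none =>
    rw [O.layer_ext] at hx
    left
    rw [← hx, POT_N]
    exact hc
  | some p =>
    right
    refine ⟨p, O.mem_layerSet.2 hx, ?_, hc⟩
    have : O.obag (some p) p = 1 := O.str.bag_self (some p)
    simp [this]

/-- If the step takes place in layer `i + 1`, the bag just produced is itself a reason for activity.
Otherwise the number of tokens in layer `i` is unchanged. A token witnessing activity can then be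
lost only as a resource of layer `i + 2`; in that case its place has maximal potential, and the
first alternative of `Act` holds. -/
lemma act_obag {i : ℕ} (hi : i < O.N) {x y : Option P} (hxy : O.str.layer x = O.str.layer y)
    (r : P → ℕ) (h : O.Act i (r + O.obag x)) : O.Act i (r + O.obag y) := by
  by_cases h1 : O.str.layer y = i + 1
  · exact O.act_of_obag h1 r
  have hcount : O.count i (r + O.obag y) = O.count i (r + O.obag x) := by
    rw [count_add, count_add, O.count_obag hi, O.count_obag hi, hxy, if_neg (Ne.symm h1),
      if_neg (Ne.symm h1)]
  rw [Act, hcount]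
  rcases h with h | ⟨p, hp, hmp, hpot⟩
  · exact Or.inl h
  by_cases hr : 0 < r p
  · exact Or.inr ⟨p, hp, Nat.add_pos_left hr _, hpot⟩
  have hxp : 0 < O.obag x p := by
    simp only [Pi.add_apply] at hmp; omega
  have hp' := O.mem_layerSet.1 hp
  have hne : some p ≠ x := by rintro rfl; omega
  rw [obag_eq, Pi.add_apply, unit, if_neg hne, zero_add] at hxp
  obtain ⟨h3, h4⟩ := O.mem_maxSet_of_rho_pos hxp
  rw [hp'] at h3 h4
  have := O.str.layer_le x
  rw [O.pot_of_mem_maxSet (by omega) h4] at hpot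
  exact Or.inl hpot

lemma act_conn {i : ℕ} (hi : i < O.N) {m m' : P → ℕ} (h : O.Conn m m') (hm : O.Act i m) :
    O.Act i m' := by
  induction h with
  | refl => exact hm
  | tail _ h ih =>
    obtain ⟨x, y, r, hxy, rfl, rfl⟩ := O.step_cases h
    exact O.act_obag hi hxy r ih

/-- All layers are active. -/
def Full (m : P → ℕ) : Prop := ∀ i < O.N, O.Act i m

variable {O} in
lemma Full.conn {m m' : P → ℕ} (hm : O.Full m) (h : O.Conn m m') : O.Full m' :=
  fun i hi => O.act_conn hi h (hm i hi)

/-- For each layer, liveness enables some transition of that layer in a reachable marking. The bag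
it consumes shows activity there, and activity is carried back to `m₀` by reversibility. -/
lemma full_of_live {m₀ : P → ℕ} (h : O.net.Live m₀) : O.Full m₀ := by
  intro i hi
  obtain ⟨x, hx⟩ := O.str.layer_surj (i + 1) (by omega) hi
  have hxb : O.str.bag x ∈ O.closed.bags := O.str.bag_bij.mapsTo (Set.mem_univ x)
  obtain ⟨t, ht⟩ : ∃ t, ∃ x, O.closed.inBag t = O.str.bag x ∧ O.str.layer x = i + 1 := by
    classical
    simp only [PetriNet.bags, Finset.mem_union, Finset.mem_image, Finset.mem_univ,
      true_and] at hxb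
    rcases hxb with ⟨t, ht⟩ | ⟨t, ht⟩
    · exact ⟨t, x, ht, hx⟩
    · obtain ⟨x', y', h1, h2, h3, _⟩ := O.exists_endpoints t
      have : y' = x := O.str.bag_bij.injOn (Set.mem_univ _) (Set.mem_univ _) (h2.symm.trans ht)
      exact ⟨t, x', h1, by rw [h3, this, hx]⟩
  obtain ⟨x', h1, h2⟩ := ht
  obtain ⟨m', hm', hen⟩ := h t m₀ Relation.ReflTransGen.refl
  have hle : O.net.inBag t ≤ m' := hen
  rw [O.net_inBag h1] at hle
  have hact := O.act_of_obag h2 (m' - O.obag x')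
  rw [tsub_add_cancel_of_le hle] at hact
  exact O.act_conn hi (Conn.symm hm') hact

/-! #### Invariants -/

lemma invConst_add (i : ℕ) (m m' : P → ℕ) :
    O.invConst i (m + m') = O.invConst i m + O.invConst i m' := by
  simp only [invConst, Pi.add_apply, Nat.cast_add, mul_add, Finset.sum_add_distrib]
  ring

/-- Only the layer of `x` enters. If `x` lies in layer `i + 1`, its pot(x) resources in layer `i`
and its own weight cin(x) add up to the maximal potential; resources lying in layer `i + 1` have cin
zero. Since firing stays within a component, `invConst i` is invariant. -/
lemma invConst_obag {i : ℕ} (hi : i < O.N) (x : Option P) : O.invConst i (O.obag x) =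
    (if O.str.layer x = i then 1 else 0) +
      if i + 1 = O.str.layer x then (O.POT (O.str.layer x) : ℤ) else 0 := by
  have h1 : ∑ p ∈ O.layerSet i, (O.obag x p : ℤ) = (O.count i (O.obag x) : ℤ) := by
    simp [count]
  have h2 : ∑ p ∈ O.layerSet (i + 1), O.cin p * (O.rho x p : ℤ) = 0 := by
    refine Finset.sum_eq_zero fun p hp => ?_
    by_cases h0 : O.rho x p = 0
    · simp [h0]
    · obtain ⟨h3, h4⟩ := O.mem_maxSet_of_rho_pos (Nat.pos_of_ne_zero h0)
      rw [O.mem_layerSet.1 hp] at h3 h4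
      have := O.str.layer_le x
      rw [O.cin_of_mem_maxSet (by omega) h4, zero_mul]
  have h3 : ∑ p ∈ O.layerSet (i + 1), O.cin p * (unit x p : ℤ) =
      if i + 1 = O.str.layer x then (O.POT (O.str.layer x) : ℤ) - O.str.pot x else 0 := by
    cases x with
    | none =>
      rw [sum_unit_none, O.layer_ext, POT_N]
      simp
    | some p =>
      rw [sum_unit]
      simp only [mem_layerSet, eq_comm (a := i + 1)]
      rfl
  rw [invConst, h1, O.count_obag hi]
  simp only [obag_eq, Pi.add_apply, Nat.cast_add, mul_add, Finset.sum_add_distrib]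
  rw [h2, h3]
  split_ifs <;> push_cast <;> ring

lemma invConst_conn {i : ℕ} (hi : i < O.N) {m m' : P → ℕ} (h : O.Conn m m') :
    O.invConst i m' = O.invConst i m := by
  induction h with
  | refl => rfl
  | tail _ h ih =>
    obtain ⟨x, y, r, hxy, rfl, rfl⟩ := O.step_cases h
    rw [← ih, invConst_add, invConst_add, O.invConst_obag hi, O.invConst_obag hi, hxy]

/-! #### Redistribution of tokens -/

lemma exists_dist {i : ℕ} {n : ℕ} (h : 0 < n → (O.layerSet i).Nonempty) :
    ∃ d : P → ℕ, (∀ p, 0 < d p → p ∈ O.maxSet i) ∧ O.count i d = n := by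
  classical
  rcases Nat.eq_zero_or_pos n with rfl | hn
  · exact ⟨0, by simp, by simp [count]⟩
  · obtain ⟨z, hz⟩ := O.maxSet_nonempty (h hn)
    refine ⟨fun p => if p = z then n else 0, fun p hp => ?_, ?_⟩
    · by_cases h : p = z
      · exact h ▸ hz
      · simp [h] at hp
    · simp [count, (O.mem_maxSet.1 hz).1]

/-- The tokens of the layer `i` can be distributed arbitrarily over the places of maximal
potential, without changing the higher layers. -/
def Redistributable (i : ℕ) : Prop := ∀ m, O.Full m → ∀ d : P → ℕ,
  (∀ p, 0 < d p → p ∈ O.maxSet i) → O.count i d = O.count i m →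
  ∃ m', O.Conn m m' ∧ (∀ p ∈ O.layerSet i, m' p = d p) ∧
    ∀ p, i < O.str.layer (some p) → m' p = m p

/-- The tokens of layer `i` are first arranged so that the resources of `x` are present; then the
bag of `x` is turned into that of `y`. A move to higher potential increases the number of tokens in
layer `i`. Either place may be the deleted one, which makes this also a creation or a removal of a
token. -/
lemma exists_move {i : ℕ} (hi : i < O.N) (hr : O.Redistributable i) {m : P → ℕ} (hm : O.Full m)
    {x y : Option P} (hx : O.str.layer x = i + 1) (hy : O.str.layer y = i + 1) (hxm : unit x ≤ m)
    (hpot : O.str.pot x ≤ O.count i m) :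
    ∃ m', O.Conn m m' ∧ (∀ p, i < O.str.layer (some p) → m' p + unit x p = m p + unit y p) ∧
      O.count i m' + O.str.pot x = O.count i m + O.str.pot y := by
  have hrho : ∀ x : Option P, O.str.layer x = i + 1 → ∀ p, 0 < O.rho x p → p ∈ O.maxSet i := by
    intro x hx p hp
    obtain ⟨h1, h2⟩ := O.mem_maxSet_of_rho_pos hp
    rwa [show O.str.layer (some p) = i by omega] at h2
  have hrho0 : ∀ x : Option P, O.str.layer x = i + 1 → ∀ p, i < O.str.layer (some p) →
      O.rho x p = 0 := by
    intro x hx p hp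
    by_contra h0
    have := (O.mem_maxSet.1 (hrho x hx p (Nat.pos_of_ne_zero h0))).1
    omega
  -- The remainder beyond the resources of `x`; it is zero when layer `i` has no places.
  obtain ⟨d, hd1, hd2⟩ := O.exists_dist (i := i) (n := O.count i m - O.str.pot x) (by
    intro h
    by_contra hne
    rw [Finset.not_nonempty_iff_eq_empty] at hne
    simp [count, hne] at h)
  obtain ⟨m₁, h1, h2, h3⟩ := hr m hm (O.rho x + d) (fun p hp => by
    by_cases h0 : 0 < O.rho x p
    · exact hrho x hx p h0
    · exact hd1 p (by simp only [Pi.add_apply] at hp; omega)) (by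
    rw [count_add, hd2, sum_rho, if_pos hx.symm]
    omega)
  have hle : O.obag x ≤ m₁ := by
    intro p
    change O.obag x p ≤ m₁ p
    rw [obag_eq, Pi.add_apply]
    by_cases hp : some p = x
    · have hl : i < O.str.layer (some p) := by rw [hp]; omega
      rw [hrho0 x hx p hl, h3 p hl]
      simpa using hxm p
    · rw [unit, if_neg hp, zero_add]
      by_cases h0 : 0 < O.rho x p
      · rw [h2 p (O.mem_layerSet.2 (O.mem_maxSet.1 (hrho x hx p h0)).1)]
        simp
      · omega
  obtain ⟨r, rfl⟩ : ∃ r, m₁ = r + O.obag x := ⟨m₁ - O.obag x, (tsub_add_cancel_of_le hle).symm⟩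
  refine ⟨r + O.obag y, h1.trans (O.conn_obag (hx.trans hy.symm) r), fun p hp => ?_, ?_⟩
  · rw [← h3 p hp]
    simp only [obag_eq, Pi.add_apply, hrho0 x hx p hp, hrho0 y hy p hp]
    omega
  · have h4 : O.count i (r + O.obag x) = O.count i m := by
      have : O.count i (r + O.obag x) = O.count i (O.rho x + d) := Finset.sum_congr rfl h2
      rw [this, count_add, hd2, sum_rho, if_pos hx.symm]
      omega
    rw [← h4, count_add, count_add, O.count_obag hi, O.count_obag hi, hx, hy]
    simp
    ring

lemma count_congr_move {i : ℕ} {m m' : P → ℕ} {p q : P} (hp : O.str.layer (some p) = i)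
    (hq : O.str.layer (some q) = i)
    (h : ∀ r ∈ O.layerSet i, m' r + unit (some p) r = m r + unit (some q) r) :
    O.count i m' = O.count i m := by
  have h1 := Finset.sum_congr rfl h
  rw [Finset.sum_add_distrib, Finset.sum_add_distrib] at h1
  have h2 := O.count_unit (i := i) (x := some p) (by simp)
  have h3 := O.count_unit (i := i) (x := some q) (by simp)
  rw [if_pos hp] at h2
  rw [if_pos hq] at h3
  simp only [count] at *
  omega

lemma unit_some_le {m : P → ℕ} {p : P} (h : 0 < m p) : unit (some p) ≤ m := by
  intro q
  by_cases hq : q = p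
  · subst hq; simpa [unit] using Nat.succ_le_of_lt h
  · simp [unit, hq]

/-- Induction on the excess of `m` over `d`: one token at a time goes from an overfull place to an
underfull one. As the target has maximal potential, no move reduces the tokens of layer `i`, so the
next move is possible as well. -/
lemma redistribute_aux {i : ℕ} (hi : i + 1 < O.N) (hr : O.Redistributable i) (d : P → ℕ)
    (hd : ∀ p, 0 < d p → p ∈ O.maxSet (i + 1)) : ∀ (k : ℕ) (m : P → ℕ), O.Full m →
    O.POT (i + 1) ≤ O.count i m → O.count (i + 1) d = O.count (i + 1) m →
    ∑ p ∈ O.layerSet (i + 1), (m p - d p) ≤ k →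
    ∃ m', O.Conn m m' ∧ (∀ p ∈ O.layerSet (i + 1), m' p = d p) ∧
      ∀ p, i + 1 < O.str.layer (some p) → m' p = m p := by
  intro k
  induction k with
  | zero =>
    intro m _ _ hc hk
    have hle : ∀ p ∈ O.layerSet (i + 1), m p ≤ d p := by
      intro p hp
      have := (Finset.sum_eq_zero_iff.1 (Nat.le_zero.1 hk)) p hp
      omega
    refine ⟨m, Relation.ReflTransGen.refl, ?_, fun _ _ => rfl⟩
    exact (Finset.sum_eq_sum_iff_of_le hle).1 hc.symm
  | succ k ih =>
    intro m hm hfree hc hk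
    by_cases hle : ∀ p ∈ O.layerSet (i + 1), m p ≤ d p
    · exact ⟨m, Relation.ReflTransGen.refl, (Finset.sum_eq_sum_iff_of_le hle).1 hc.symm,
        fun _ _ => rfl⟩
    push Not at hle
    obtain ⟨p, hp, hpd⟩ := hle
    obtain ⟨q, hq, hqd⟩ : ∃ q ∈ O.layerSet (i + 1), m q < d q := by
      by_contra! h
      exact absurd hc (Finset.sum_lt_sum h ⟨p, hp, hpd⟩).ne
    -- `q` has maximal potential because `d q` is positive.
    have hp' := O.mem_layerSet.1 hp
    have hq' := O.mem_layerSet.1 hq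
    have hqm := hd q (by omega)
    have hpq : p ≠ q := by rintro rfl; omega
    have e1 : O.str.pot (some p) ≤ O.POT (i + 1) := O.pot_le_POT hi hp'
    have e2 : O.str.pot (some q) = O.POT (i + 1) := O.pot_of_mem_maxSet hi hqm
    obtain ⟨m₁, h1, h2, h3⟩ := O.exists_move (by omega) hr hm hp' hq'
      (unit_some_le (by omega)) (e1.trans hfree)
    obtain ⟨m', g1, g2, g3⟩ := ih m₁ (hm.conn h1) (by omega)
      (by rw [hc]; exact (O.count_congr_move hp' hq' fun r hr' =>
        h2 r (by rw [O.mem_layerSet.1 hr']; omega)).symm)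
      (by
        refine Nat.le_of_lt_succ (lt_of_lt_of_le (Finset.sum_lt_sum ?_ ⟨p, hp, ?_⟩) hk)
        · intro r hr'
          have := h2 r (by rw [O.mem_layerSet.1 hr']; omega)
          by_cases hrq : r = q
          · subst hrq
            have : (unit (some r) r) = 1 := by simp [unit]
            have : (unit (some p) r) = 0 := by simp [unit, hpq.symm]
            omega
          · have : (unit (some q) r) = 0 := by simp [unit, hrq]
            omega
        · have := h2 p (by rw [hp']; omega)
          have : (unit (some p) p) = 1 := by simp [unit]
          have : (unit (some q) p) = 0 := by simp [unit, hpq]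
          omega)
    refine ⟨m', h1.trans g1, g2, fun r hr' => ?_⟩
    rw [g3 r hr']
    have := h2 r (by omega)
    have : (unit (some p) r) = 0 := by
      rw [unit, if_neg]; rintro h; rw [Option.some_inj] at h; subst h; omega
    have : (unit (some q) r) = 0 := by
      rw [unit, if_neg]; rintro h; rw [Option.some_inj] at h; subst h; omega
    omega

/-- Induction on the layer; layer zero is empty. Activity provides either enough tokens below for
all moves, or one token that can be moved. Moving the latter to a place of maximal potential
releases enough tokens below to reduce to the first case. -/
lemma redistributable (i : ℕ) (hi : i < O.N) : O.Redistributable i := by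
  induction i with
  | zero =>
    intro m _ d _ _
    refine ⟨m, Relation.ReflTransGen.refl, fun p hp => ?_, fun _ _ => rfl⟩
    have := O.str.one_le_layer (some p)
    rw [O.mem_layerSet.1 hp] at this
    omega
  | succ i ih =>
    have hr := ih (by omega)
    intro m hm d hd hc
    rcases hm i (by omega) with h | ⟨p, hp, hmp, hpot⟩
    · exact O.redistribute_aux hi hr d hd _ m hm h hc le_rfl
    · obtain ⟨z, hz⟩ := O.maxSet_nonempty ⟨p, hp⟩
      have hp' := O.mem_layerSet.1 hp
      have hz' := (O.mem_maxSet.1 hz).1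
      have e2 : O.str.pot (some z) = O.POT (i + 1) := O.pot_of_mem_maxSet hi hz
      obtain ⟨m₁, h1, h2, h3⟩ := O.exists_move (by omega) hr hm hp' hz' (unit_some_le hmp) hpot
      change O.str.pot (some p) ≤ _ at hpot
      obtain ⟨m', g1, g2, g3⟩ := O.redistribute_aux hi hr d hd _ m₁ (hm.conn h1) (by omega)
        (by rw [hc]; exact (O.count_congr_move hp' hz' fun r hr' =>
          h2 r (by rw [O.mem_layerSet.1 hr']; omega)).symm) le_rfl
      refine ⟨m', h1.trans g1, g2, fun r hr' => ?_⟩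
      rw [g3 r hr']
      have := h2 r (by omega)
      have : (unit (some p) r) = 0 := by
        rw [unit, if_neg]; rintro h; rw [Option.some_inj] at h; subst h; omega
      have : (unit (some z) r) = 0 := by
        rw [unit, if_neg]; rintro h; rw [Option.some_inj] at h; subst h; omega
      omega

/-! ### The last layer and the reachability set -/

/-- The tokens of the last layer can be gathered in a place `y` of maximal potential. -/
lemma exists_gather {y : Option P} (hy : O.str.layer y = O.N)
    (hmax : ∀ x, O.str.layer x = O.N → O.str.pot x ≤ O.str.pot y) {m : P → ℕ} (hm : O.Full m) :
    ∃ k, ∀ K ≥ k, ∃ m', O.Conn m m' ∧ ∀ p ∈ O.layerSet O.N, m' p = K * unit y p := by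
  classical
  obtain ⟨i, hi⟩ : ∃ i, O.N = i + 1 := ⟨O.N - 1, by have := O.one_le_N; omega⟩
  have hr := O.redistributable i (by omega)
  have hy' : O.str.layer y = i + 1 := hy.trans hi
  -- a token of maximal potential can be created
  obtain ⟨m₁, h1, hfree⟩ : ∃ m₁, O.Conn m m₁ ∧ O.str.pot y ≤ O.count i m₁ := by
    rcases hm i (by omega) with h | ⟨p, hp, hmp, hpot⟩
    · rw [← hi, POT_N] at h
      obtain ⟨m₁, h1, h2, h3⟩ := O.exists_move (by omega) hr hm (x := none)
        (by rw [O.layer_ext, hi]) hy' (fun p => by simp [unit]) h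
      exact ⟨m₁, h1, by omega⟩
    · change O.str.pot (some p) ≤ _ at hpot
      obtain ⟨m₁, h1, h2, h3⟩ := O.exists_move (by omega) hr hm (O.mem_layerSet.1 hp) hy'
        (unit_some_le hmp) hpot
      exact ⟨m₁, h1, by omega⟩
  -- then all tokens can be moved to `y`
  have gather : ∀ (k : ℕ) (m : P → ℕ), O.Full m → O.str.pot y ≤ O.count i m →
      (∑ p ∈ O.layerSet O.N, if some p = y then 0 else m p) ≤ k →
      ∃ m' K, O.Conn m m' ∧ O.str.pot y ≤ O.count i m' ∧
        ∀ p ∈ O.layerSet O.N, m' p = K * unit y p := by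
    have base : ∀ m : P → ℕ, (∀ p ∈ O.layerSet O.N, some p ≠ y → m p = 0) →
        ∃ K, ∀ p ∈ O.layerSet O.N, m p = K * unit y p := by
      intro m h
      cases y with
      | none => exact ⟨0, fun p hp => by simp [h p hp]⟩
      | some q =>
        refine ⟨m q, fun p hp => ?_⟩
        by_cases hpq : p = q
        · subst hpq; simp [unit]
        · rw [h p hp (by simpa using hpq)]; simp [unit, hpq]
    intro k
    induction k with
    | zero =>
      intro m _ hf hk
      obtain ⟨K, hK⟩ := base m (fun p hp hpy => by
        have := (Finset.sum_eq_zero_iff.1 (Nat.le_zero.1 hk)) p hp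
        rwa [if_neg hpy] at this)
      exact ⟨m, K, Relation.ReflTransGen.refl, hf, hK⟩
    | succ k ih =>
      intro m hm hf hk
      by_cases hall : ∀ p ∈ O.layerSet O.N, some p ≠ y → m p = 0
      · obtain ⟨K, hK⟩ := base m hall
        exact ⟨m, K, Relation.ReflTransGen.refl, hf, hK⟩
      push Not at hall
      obtain ⟨p, hp, hpy, hmp⟩ := hall
      have hp' := O.mem_layerSet.1 hp
      have e1 := hmax (some p) hp'
      obtain ⟨m₂, h1, h2, h3⟩ := O.exists_move (by omega) hr hm (hp'.trans hi) hy'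
        (unit_some_le (Nat.pos_of_ne_zero hmp)) (e1.trans hf)
      obtain ⟨m', K, g1, g2, g3⟩ := ih m₂ (hm.conn h1) (by omega) (by
        refine Nat.le_of_lt_succ (lt_of_lt_of_le (Finset.sum_lt_sum ?_ ⟨p, hp, ?_⟩) hk)
        · intro r hr'
          have := h2 r (by rw [O.mem_layerSet.1 hr']; omega)
          split_ifs with hry
          · exact le_rfl
          · have : (unit y r) = 0 := by rw [unit, if_neg hry]
            omega
        · have := h2 p (by rw [hp']; omega)
          rw [if_neg hpy, if_neg hpy]
          have : (unit y p) = 0 := by rw [unit, if_neg hpy]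
          have : (unit (some p) p) = 1 := by simp [unit]
          omega)
      exact ⟨m', K, h1.trans g1, g2, g3⟩
  obtain ⟨m₂, k, g1, g2, g3⟩ := gather _ m₁ (hm.conn h1) hfree le_rfl
  -- further tokens can be created in `y`
  refine ⟨k, fun K hK => ?_⟩
  obtain ⟨j, rfl⟩ := Nat.exists_eq_add_of_le hK
  suffices h : ∃ m', O.Conn m₂ m' ∧ O.str.pot y ≤ O.count i m' ∧
      ∀ p ∈ O.layerSet O.N, m' p = (k + j) * unit y p by
    obtain ⟨m', f1, _, f2⟩ := h
    exact ⟨m', (h1.trans g1).trans f1, f2⟩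
  clear hK
  induction j with
  | zero => exact ⟨m₂, Relation.ReflTransGen.refl, g2, g3⟩
  | succ j ih =>
    obtain ⟨m', f1, f2, f3⟩ := ih
    have e1 := hmax none O.layer_ext
    obtain ⟨m₃, q1, q2, q3⟩ := O.exists_move (by omega) hr (hm.conn ((h1.trans g1).trans f1))
      (x := none) (by rw [O.layer_ext, hi]) hy' (fun p => by simp [unit]) (e1.trans f2)
    refine ⟨m₃, f1.trans q1, by omega, fun p hp => ?_⟩
    have := q2 p (by rw [O.mem_layerSet.1 hp]; omega)
    have h0 : (unit (none : Option P) p) = 0 := by simp [unit]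
    rw [h0, f3 p hp] at this
    rw [show k + (j + 1) = k + j + 1 by ring, add_mul]
    omega

/-- Work downwards. If the markings agree above layer `i`, the invariant of that layer forces equal
numbers of tokens in it, so both can be brought to the same distribution there. The redistribution
changes only this layer and lower ones. -/
lemma conn_of_agree {i : ℕ} (hi : i < O.N) : ∀ m m' : P → ℕ, O.Full m → O.Full m' →
    (∀ j, 1 ≤ j → j < O.N → O.invConst j m = O.invConst j m') →
    (∀ p, i < O.str.layer (some p) → m p = m' p) → O.Conn m m' := by
  induction i with
  | zero =>
    intro m m' _ _ _ h
    have : m = m' := funext fun p => h p (O.str.one_le_layer _)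
    rw [this]
  | succ i ih =>
    intro m m' hm hm' hinv h
    have hc : O.count (i + 1) m = O.count (i + 1) m' := by
      have h1 := hinv (i + 1) (by omega) hi
      simp only [invConst] at h1
      have h2 : ∑ p ∈ O.layerSet (i + 1 + 1), O.cin p * (m p : ℤ) =
          ∑ p ∈ O.layerSet (i + 1 + 1), O.cin p * (m' p : ℤ) :=
        Finset.sum_congr rfl fun p hp => by rw [h p (by rw [O.mem_layerSet.1 hp]; omega)]
      rw [h2, add_left_inj] at h1
      simp only [count]
      exact_mod_cast h1
    obtain ⟨d, hd1, hd2⟩ := O.exists_dist (i := i + 1) (n := O.count (i + 1) m) (by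
      intro h
      by_contra hne
      rw [Finset.not_nonempty_iff_eq_empty] at hne
      simp [count, hne] at h)
    obtain ⟨m₁, a1, a2, a3⟩ := O.redistributable (i + 1) hi m hm d hd1 hd2
    obtain ⟨m₂, b1, b2, b3⟩ := O.redistributable (i + 1) hi m' hm' d hd1 (hd2.trans hc)
    refine a1.trans (Relation.ReflTransGen.trans ?_ (Conn.symm b1))
    refine ih (by omega) m₁ m₂ (hm.conn a1) (hm'.conn b1) (fun j hj hj' => ?_) fun p hp => ?_
    · rw [O.invConst_conn hj' a1, O.invConst_conn hj' b1, hinv j hj hj']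
    · rcases Nat.lt_or_ge (i + 1) (O.str.layer (some p)) with h1 | h1
      · rw [a3 p h1, b3 p h1, h p h1]
      · have h2 : p ∈ O.layerSet (i + 1) := O.mem_layerSet.2 (by omega)
        rw [a2 p h2, b2 p h2]

/-- Two markings whose layers are all active and that have the same invariants are mutually
reachable. -/
theorem conn_of_full {m m' : P → ℕ} (hm : O.Full m) (hm' : O.Full m')
    (hinv : ∀ j, 1 ≤ j → j < O.N → O.invConst j m = O.invConst j m') : O.Conn m m' := by
  classical
  obtain ⟨y, hy, hmax⟩ := Finset.exists_max_image
    (Finset.univ.filter fun x => O.str.layer x = O.N) O.str.pot ⟨none, by simp [O.layer_ext]⟩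
  simp only [Finset.mem_filter, Finset.mem_univ, true_and] at hy hmax
  obtain ⟨k, hk⟩ := O.exists_gather hy hmax hm
  obtain ⟨k', hk'⟩ := O.exists_gather hy hmax hm'
  -- The common value makes the last layers equal; if `y` is the deleted place both are simply
  -- empty.
  obtain ⟨m₁, a1, a2⟩ := hk (max k k') (le_max_left _ _)
  obtain ⟨m₂, b1, b2⟩ := hk' (max k k') (le_max_right _ _)
  refine a1.trans (Relation.ReflTransGen.trans ?_ (Conn.symm b1))
  have hN := O.one_le_N
  refine O.conn_of_agree (i := O.N - 1) (by omega) m₁ m₂ (hm.conn a1) (hm'.conn b1)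
    (fun j hj hj' => ?_) fun p hp => ?_
  · rw [O.invConst_conn hj' a1, O.invConst_conn hj' b1, hinv j hj hj']
  · have h1 : p ∈ O.layerSet O.N := O.mem_layerSet.2 (by
      have := O.str.layer_le (some p); omega)
    rw [a2 p h1, b2 p h1]

/-- The reachability set of a live open `Π³`-net. -/
theorem mem_reach_iff {m₀ : P → ℕ} (hm₀ : O.Full m₀) (m : P → ℕ) : m ∈ O.net.reach m₀ ↔
    O.Full m ∧ ∀ j, 1 ≤ j → j < O.N → O.invConst j m = O.invConst j m₀ := by
  constructor
  · intro h
    exact ⟨hm₀.conn h, fun j _ hj => O.invConst_conn hj h⟩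
  · rintro ⟨h1, h2⟩
    exact O.conn_of_full hm₀ h1 fun j hj hj' => (h2 j hj hj').symm

end OpenPi3

end


noncomputable section

namespace OpenPi3

/-! ### The classes of reachable markings -/

variable {P T : Type} [Fintype P] [Fintype T] (O : OpenPi3 P T)

lemma count_zero (m : P → ℕ) : O.count 0 m = 0 := by
  refine Finset.sum_eq_zero fun p hp => ?_
  have := O.str.one_le_layer (some p)
  rw [O.mem_layerSet.1 hp] at this
  omega

lemma pot_layer_one {x : Option P} (hx : O.str.layer x = 1) : O.str.pot x = 0 := by
  rw [← O.sum_rho_univ]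
  refine Finset.sum_eq_zero fun p _ => ?_
  by_contra h
  have h1 := (O.mem_maxSet_of_rho_pos (Nat.pos_of_ne_zero h)).1
  have h2 := O.str.one_le_layer (some p)
  omega

lemma POT_one : O.POT 1 = 0 := by
  by_cases h : 1 = O.N
  · rw [POT, if_pos h]
    exact O.pot_layer_one (O.layer_ext.trans h.symm)
  · rw [POT, if_neg h]
    exact Nat.le_zero.1 (Finset.sup_le fun p hp => (O.pot_layer_one (O.mem_layerSet.1 hp)).le)

lemma act_zero (m : P → ℕ) : O.Act 0 m := by
  left
  rw [zero_add, POT_one]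
  exact Nat.zero_le _

lemma count_mono (i : ℕ) {m m' : P → ℕ} (h : m ≤ m') : O.count i m ≤ O.count i m' :=
  Finset.sum_le_sum fun p _ => h p

variable {O} in
lemma Act.mono {i : ℕ} {m m' : P → ℕ} (hm : O.Act i m) (h : m ≤ m') : O.Act i m' := by
  have hc := O.count_mono i h
  rcases hm with hm | ⟨p, hp, h1, h2⟩
  · exact Or.inl (hm.trans hc)
  · exact Or.inr ⟨p, hp, lt_of_lt_of_le h1 (h p), h2.trans hc⟩

lemma invConst_eq (i : ℕ) (m : P → ℕ) :
    O.invConst i m = (O.count i m : ℤ) + ∑ p ∈ O.layerSet (i + 1), O.cin p * (m p : ℤ) := by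
  simp [invConst, count]

lemma cin_eq {i : ℕ} {p : P} (h : O.str.layer (some p) = i) :
    O.cin p = (O.POT i : ℤ) - O.pot p := by
  rw [cin, h]

lemma cin_nonneg {i : ℕ} (hi : i < O.N) {p : P} (h : O.str.layer (some p) = i) : 0 ≤ O.cin p := by
  rw [O.cin_eq h]
  have := O.pot_le_POT hi h
  omega

/-- In the second case of activity the tokens below number at least pot(p), and the token in `p`
adds at least cin(p); together these are the maximal potential. -/
lemma POT_le_invConst {i : ℕ} (hi : i + 1 < O.N) {m : P → ℕ} (hm : O.Full m) :
    (O.POT (i + 1) : ℤ) ≤ O.invConst i m := by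
  have hnn : ∀ p ∈ O.layerSet (i + 1), 0 ≤ O.cin p * (m p : ℤ) := fun p hp =>
    mul_nonneg (O.cin_nonneg hi (O.mem_layerSet.1 hp)) (Int.natCast_nonneg _)
  rw [invConst_eq]
  rcases hm i (by omega) with h | ⟨p, hp, hmp, hpot⟩
  · have := Finset.sum_nonneg hnn
    omega
  · have h1 := Finset.single_le_sum hnn hp
    have h2 := O.cin_nonneg hi (O.mem_layerSet.1 hp)
    have h3 := O.cin_eq (O.mem_layerSet.1 hp)
    have h4 : O.cin p * 1 ≤ O.cin p * (m p : ℤ) :=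
      mul_le_mul_of_nonneg_left (by omega) h2
    omega

/-! ### Which classes contain a reachable marking -/

/-- The number of tokens of `y` in the places of maximal potential of the last but one layer. -/
def tot (y : P → ℕ) : ℕ := ∑ p ∈ O.maxSet (O.N - 1), y p

/-- It is possible to have exactly `c` tokens in the places of the last but one layer whose
potential is not maximal. -/
def Feasible (m₀ : P → ℕ) (c : ℕ) : Prop :=
  c = 0 ∨ ∃ p, O.str.layer (some p) = O.N - 1 ∧ O.pot p < O.POT (O.N - 1) ∧
    ((c : ℤ) - 1) * ((O.POT (O.N - 1) : ℤ) - O.pot p) + O.POT (O.N - 1) ≤ O.invConst (O.N - 2) m₀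

/-- The last layer is active when the last but one layer has `c` tokens in places of non-maximal
potential. -/
def LastAct (c : ℕ) (y : P → ℕ) : Prop :=
  O.POT O.N ≤ c + O.tot y ∨ ∃ p ∈ O.layerSet O.N, 0 < y p ∧ O.pot p ≤ c + O.tot y

open Classical in
lemma sum_layer_split (hN : 1 < O.N) (f : P → ℤ) :
    ∑ p ∈ O.layerSet (O.N - 1), f p = ∑ p ∈ O.maxSet (O.N - 1), f p +
      ∑ p ∈ O.layerSet (O.N - 1) with O.pot p ≠ O.POT (O.N - 1), f p := by
  rw [← Finset.sum_filter_add_sum_filter_not (O.layerSet (O.N - 1))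
    (fun p => O.pot p = O.POT (O.N - 1))]
  congr 1
  refine Finset.sum_congr ?_ fun _ _ => rfl
  ext p
  rw [Finset.mem_filter, mem_layerSet, O.mem_maxSet_iff (by omega)]

lemma Y_subset {p : P} : p ∈ O.Y ↔ p ∈ O.maxSet (O.N - 1) ∨ p ∈ O.layerSet O.N := by
  simp [Y]

/-- The last invariant shows that exactly `c` tokens lie in non-maximal places of layer N-1, so the
activity of the last layer is that expressed by `LastAct`. Feasibility compares the actual positions
of these tokens with the cheapest one, the place of least cin. -/
lemma feasible_of_mem_reach {m₀ m : P → ℕ} (hm₀ : O.Full m₀) (hm : m ∈ O.net.reach m₀) {c : ℕ}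
    (h : (c : ℤ) + O.tot m + ∑ p ∈ O.layerSet O.N, O.cin p * (m p : ℤ) = O.invConst (O.N - 1) m₀) :
    O.Feasible m₀ c ∧ O.LastAct c m := by
  classical
  obtain ⟨hfull, hinv⟩ := (O.mem_reach_iff hm₀ m).1 hm
  have hN := O.one_le_N
  rcases Nat.lt_or_ge 1 O.N with hN1 | hN1
  swap
  -- With a single layer all potentials and all cin vanish, so the constraint itself forces c = 0.
  · have hN' : O.N = 1 := by omega
    have hcin : ∀ p ∈ O.layerSet 1, O.cin p = 0 := fun p hp => by
      have hp := O.mem_layerSet.1 hp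
      rw [O.cin_eq hp, POT_one]
      have : O.pot p = 0 := O.pot_layer_one hp
      omega
    have hz : ∀ m : P → ℕ, ∑ p ∈ O.layerSet 1, O.cin p * (m p : ℤ) = 0 := fun m =>
      Finset.sum_eq_zero fun p hp => by rw [hcin p hp, zero_mul]
    rw [hN', invConst_eq, hz, O.count_zero, hz] at h
    refine ⟨Or.inl (by omega), Or.inl ?_⟩
    rw [hN', POT_one]
    exact Nat.zero_le _
  have h1 := hinv (O.N - 1) (by omega) (by omega)
  rw [invConst_eq, show O.N - 1 + 1 = O.N by omega] at h1
  have hcount : O.count (O.N - 1) m = c + O.tot m := by omega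
  refine ⟨?_, ?_⟩
  swap
  · have := hfull (O.N - 1) (by omega)
    rwa [Act, show O.N - 1 + 1 = O.N by omega, hcount] at this
  rcases Nat.eq_zero_or_pos c with hc | hc
  · exact Or.inl hc
  right
  set A := (O.layerSet (O.N - 1)).filter fun p => O.pot p ≠ O.POT (O.N - 1) with hA
  have hAm : ∀ p ∈ A, O.str.layer (some p) = O.N - 1 ∧ O.pot p < O.POT (O.N - 1) := by
    intro p hp
    obtain ⟨h2, h3⟩ := Finset.mem_filter.1 hp
    have h4 := O.mem_layerSet.1 h2
    exact ⟨h4, lt_of_le_of_ne (O.pot_le_POT (by omega) h4) h3⟩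
  have hsplit : ∀ f : P → ℤ, ∑ p ∈ O.layerSet (O.N - 1), f p =
      ∑ p ∈ O.maxSet (O.N - 1), f p + ∑ p ∈ A, f p := by
    intro f
    rw [O.sum_layer_split hN1]
  have hAc : ∑ p ∈ A, (m p : ℤ) = c := by
    have h2 := hsplit (fun p => (m p : ℤ))
    have h3 : ∑ p ∈ O.layerSet (O.N - 1), (m p : ℤ) = (O.count (O.N - 1) m : ℤ) := by simp [count]
    have h4 : ∑ p ∈ O.maxSet (O.N - 1), (m p : ℤ) = (O.tot m : ℤ) := by simp [tot]
    rw [h3, h4] at h2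
    omega
  obtain ⟨p₁, hp₁, hmp₁⟩ : ∃ p ∈ A, 0 < m p := by
    by_contra! hcon
    have : ∑ p ∈ A, (m p : ℤ) = 0 := Finset.sum_eq_zero fun p hp => by
      have := hcon p hp; omega
    omega
  -- All potentials of layer one are zero, so a non-maximal place cannot lie there.
  have hN2 : 2 < O.N := by
    by_contra hcon
    have h2 := hAm p₁ hp₁
    rw [show O.N - 1 = 1 by omega, POT_one] at h2
    omega
  -- If activity is due to a maximal potential, then `p₁`, whose potential is smaller, serves as
  -- well.
  obtain ⟨p₂, hp₂, hmp₂, hpot₂⟩ : ∃ p ∈ A, 0 < m p ∧ O.pot p ≤ O.count (O.N - 2) m := by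
    have h2 := hfull (O.N - 2) (by omega)
    rw [Act, show O.N - 2 + 1 = O.N - 1 by omega] at h2
    rcases h2 with h2 | ⟨p, hp, hmp, hpot⟩
    · exact ⟨p₁, hp₁, hmp₁, (hAm p₁ hp₁).2.le.trans h2⟩
    · by_cases h3 : O.pot p = O.POT (O.N - 1)
      · exact ⟨p₁, hp₁, hmp₁, by have := (hAm p₁ hp₁).2; omega⟩
      · exact ⟨p, Finset.mem_filter.2 ⟨hp, h3⟩, hmp, hpot⟩
  -- Each of the c tokens costs at least cin(q) in the invariant of layer N-2. The one in `p₂` costs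
  -- cin(p₂) and comes with pot(p₂) tokens below, which sum to the maximal potential; this is the
  -- required inequality.
  obtain ⟨q, hq, hmin⟩ := Finset.exists_min_image A O.cin ⟨p₁, hp₁⟩
  refine ⟨q, (hAm q hq).1, (hAm q hq).2, ?_⟩
  rw [← hinv (O.N - 2) (by omega) (by omega), invConst_eq, show O.N - 2 + 1 = O.N - 1 by omega,
    hsplit]
  have h2 : ∑ p ∈ O.maxSet (O.N - 1), O.cin p * (m p : ℤ) = 0 := Finset.sum_eq_zero fun p hp => by
    rw [O.cin_of_mem_maxSet (by omega) hp, zero_mul]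
  have h3 : O.cin p₂ - O.cin q ≤ ∑ p ∈ A, (O.cin p - O.cin q) * (m p : ℤ) := by
    have h4 := Finset.single_le_sum (f := fun p => (O.cin p - O.cin q) * (m p : ℤ))
      (fun p hp => mul_nonneg (sub_nonneg.2 (hmin p hp)) (Int.natCast_nonneg _)) hp₂
    have h5 : (O.cin p₂ - O.cin q) * 1 ≤ (O.cin p₂ - O.cin q) * (m p₂ : ℤ) :=
      mul_le_mul_of_nonneg_left (by omega) (sub_nonneg.2 (hmin p₂ hp₂))
    omega
  simp only [sub_mul, Finset.sum_sub_distrib, ← Finset.mul_sum] at h3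
  rw [hAc] at h3
  have h6 := O.cin_eq (hAm q hq).1
  have h7 := O.cin_eq (hAm p₂ hp₂).1
  rw [h2, ← h6, sub_mul, mul_comm (c : ℤ)]
  omega

/-- A marking is built from the prescribed values on Y by placing all `c` remaining tokens of layer
N-1 in one feasible place, and the tokens of each lower layer in one place of maximal potential.
Such places have cin zero, so the invariants determine the numbers of tokens layer by layer. -/
lemma exists_mem_reach {m₀ : P → ℕ} (hm₀ : O.Full m₀) {y : P → ℕ} {c : ℕ}
    (h : (c : ℤ) + O.tot y + ∑ p ∈ O.layerSet O.N, O.cin p * (y p : ℤ) = O.invConst (O.N - 1) m₀)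
    (hc : O.Feasible m₀ c) (hy : O.LastAct c y) :
    ∃ m ∈ O.net.reach m₀, ∀ p ∈ O.Y, m p = y p := by
  classical
  have hN := O.one_le_N
  rcases Nat.lt_or_ge 1 O.N with hN1 | hN1
  swap
  · refine ⟨y, (O.mem_reach_iff hm₀ y).2 ⟨fun i hi => ?_, fun j hj hj' => by omega⟩, fun _ _ => rfl⟩
    rw [show i = 0 by omega]
    exact O.act_zero y
  set M := O.POT (O.N - 1) with hM
  have hPOT := O.POT_le_invConst (i := O.N - 2) (by omega) hm₀
  rw [show O.N - 2 + 1 = O.N - 1 by omega, ← hM] at hPOT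
  -- the tokens in the places of non-maximal potential
  obtain ⟨a, ha1, ha2, ha3, ha4⟩ : ∃ a : P → ℕ,
      (∀ p, 0 < a p → O.str.layer (some p) = O.N - 1 ∧ O.pot p ≠ M) ∧
      O.count (O.N - 1) a = c ∧
      0 ≤ O.invConst (O.N - 2) m₀ - ∑ p ∈ O.layerSet (O.N - 1), O.cin p * (a p : ℤ) ∧
      ((M : ℤ) ≤ O.invConst (O.N - 2) m₀ - ∑ p ∈ O.layerSet (O.N - 1), O.cin p * (a p : ℤ) ∨
        ∃ p, 0 < a p ∧
          (O.pot p : ℤ) ≤ O.invConst (O.N - 2) m₀ -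
            ∑ p ∈ O.layerSet (O.N - 1), O.cin p * (a p : ℤ)) := by
    rcases Nat.eq_zero_or_pos c with rfl | hcpos
    · refine ⟨0, by simp, by simp [count], ?_, Or.inl ?_⟩
      · simp only [Pi.zero_apply, Nat.cast_zero, mul_zero, Finset.sum_const_zero]
        omega
      · simpa using hPOT
    · rcases hc with hc | ⟨p, hp1, hp2, hp3⟩
      · omega
      have hs : ∑ q ∈ O.layerSet (O.N - 1), O.cin q * ((if q = p then c else 0 : ℕ) : ℤ) =
          c * O.cin p := by
        rw [Finset.sum_eq_single_of_mem p (O.mem_layerSet.2 hp1)]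
        · simp [mul_comm]
        · intro q _ hq
          simp [hq]
      have h6 := O.cin_eq hp1
      rw [← h6, sub_mul, one_mul] at hp3
      -- Feasibility says c cin(p) + pot(p) ≤ C: the tokens left for layer N-2 suffice to move one
      -- of these.
      refine ⟨fun q => if q = p then c else 0, fun q hq => ?_, ?_, ?_, Or.inr ⟨p, ?_, ?_⟩⟩
      · by_cases hqp : q = p
        · subst hqp; exact ⟨hp1, hp2.ne⟩
        · simp [hqp] at hq
      · simp [count, hp1]
      · rw [hs]; omega
      · simpa using hcpos
      · rw [hs]; omega
  set v := O.invConst (O.N - 2) m₀ - ∑ p ∈ O.layerSet (O.N - 1), O.cin p * (a p : ℤ) with hv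
  -- Totalised in `j` so as to allow a choice; values outside the range are arbitrary.
  have hz : ∀ j, ∃ z, 1 ≤ j → j < O.N → z ∈ O.maxSet j := by
    intro j
    obtain ⟨x, hx⟩ := O.str.layer_surj (O.N - 1) (by omega) (by omega)
    have hpl : ∀ j, 1 ≤ j → j < O.N → (O.layerSet j).Nonempty := by
      intro j hj hj'
      obtain ⟨x, hx⟩ := O.str.layer_surj j hj hj'.le
      cases x with
      | none => rw [O.layer_ext] at hx; omega
      | some p => exact ⟨p, O.mem_layerSet.2 hx⟩
    by_cases hj : 1 ≤ j ∧ j < O.N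
    · obtain ⟨z, hz⟩ := O.maxSet_nonempty (hpl j hj.1 hj.2)
      exact ⟨z, fun _ _ => hz⟩
    · obtain ⟨z, hz⟩ := hpl (O.N - 1) (by omega) (by omega)
      exact ⟨z, fun h1 h2 => absurd ⟨h1, h2⟩ hj⟩
  choose z hz using hz
  -- Layer N-2 alone has to pay for the non-maximal tokens above it.
  set val : ℕ → ℕ := fun j => if j = O.N - 2 then v.toNat else (O.invConst j m₀).toNat with hval
  set m : P → ℕ := fun p => if O.str.layer (some p) = O.N then y p
    else if O.str.layer (some p) = O.N - 1 then (if O.pot p = M then y p else a p)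
    else if p = z (O.str.layer (some p)) then val (O.str.layer (some p)) else 0 with hm
  have hmY : ∀ p ∈ O.Y, m p = y p := by
    intro p hp
    rcases O.Y_subset.1 hp with hp | hp
    · obtain ⟨h1, h2⟩ := (O.mem_maxSet_iff (by omega)).1 hp
      simp only [hm]
      rw [if_neg (by omega), if_pos h1, if_pos h2]
    · have := O.mem_layerSet.1 hp
      simp only [hm]
      rw [if_pos this]
  have hmA : ∀ p ∈ O.layerSet (O.N - 1), O.pot p ≠ M → m p = a p := by
    intro p hp hne
    have hp := O.mem_layerSet.1 hp
    simp only [hm]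
    rw [if_neg (by omega), if_pos hp, if_neg hne]
  have hamax : ∀ p ∈ O.maxSet (O.N - 1), a p = 0 := by
    intro p hp
    by_contra h0
    exact (ha1 p (Nat.pos_of_ne_zero h0)).2 (O.pot_of_mem_maxSet (by omega) hp)
  have hmlow : ∀ p j, O.str.layer (some p) = j → j < O.N - 1 → m p = if p = z j then val j else 0 := by
    intro p j hp hj
    simp only [hm, hp]
    rw [if_neg (by omega), if_neg (by omega)]
  have hcount : ∀ j, 1 ≤ j → j < O.N - 1 → O.count j m = val j := by
    intro j hj hj'
    rw [count, Finset.sum_congr rfl fun p hp => hmlow p j (O.mem_layerSet.1 hp) hj']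
    simp [(O.mem_maxSet.1 (hz j hj (by omega))).1]
  have hcount1 : O.count (O.N - 1) m = c + O.tot y := by
    have h1 := O.sum_layer_split hN1 (fun p => (m p : ℤ))
    have h2 := O.sum_layer_split hN1 (fun p => (a p : ℤ))
    have h3 : ∑ p ∈ O.maxSet (O.N - 1), (m p : ℤ) = ∑ p ∈ O.maxSet (O.N - 1), (y p : ℤ) :=
      Finset.sum_congr rfl fun p hp => by rw [hmY p (O.Y_subset.2 (Or.inl hp))]
    have h4 : ∑ p ∈ O.maxSet (O.N - 1), (a p : ℤ) = 0 :=
      Finset.sum_eq_zero fun p hp => by rw [hamax p hp]; rfl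
    have h5 : ∑ p ∈ O.layerSet (O.N - 1) with O.pot p ≠ O.POT (O.N - 1), (m p : ℤ) =
        ∑ p ∈ O.layerSet (O.N - 1) with O.pot p ≠ O.POT (O.N - 1), (a p : ℤ) :=
      Finset.sum_congr rfl fun p hp => by
        rw [hmA p (Finset.mem_filter.1 hp).1 (Finset.mem_filter.1 hp).2]
    have h6 : ∑ p ∈ O.layerSet (O.N - 1), (a p : ℤ) = c := by
      rw [← ha2]; simp [count]
    have h7 : ((O.count (O.N - 1) m : ℕ) : ℤ) = c + O.tot y := by
      simp only [count, tot, Nat.cast_sum]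
      linarith
    exact_mod_cast h7
  have hcin1 : ∑ p ∈ O.layerSet (O.N - 1), O.cin p * (m p : ℤ) =
      ∑ p ∈ O.layerSet (O.N - 1), O.cin p * (a p : ℤ) := by
    refine Finset.sum_congr rfl fun p hp => ?_
    by_cases hpM : O.pot p = M
    · rw [O.cin_of_mem_maxSet (i := O.N - 1) (by omega)
        ((O.mem_maxSet_iff (by omega)).2 ⟨O.mem_layerSet.1 hp, hpM⟩), zero_mul, zero_mul]
    · rw [hmA p hp hpM]
  refine ⟨m, (O.mem_reach_iff hm₀ m).2 ⟨fun i hi => ?_, fun j hj hj' => ?_⟩, hmY⟩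
  · rcases Nat.eq_zero_or_pos i with rfl | hi0
    · exact O.act_zero m
    by_cases h1 : i = O.N - 1
    · subst h1
      rw [Act, hcount1, show O.N - 1 + 1 = O.N by omega]
      rcases hy with hy | ⟨p, hp, hyp, hpot⟩
      · exact Or.inl hy
      · exact Or.inr ⟨p, hp, by rwa [hmY p (O.Y_subset.2 (Or.inr hp))], hpot⟩
    by_cases h2 : i = O.N - 2
    · rw [Act, hcount i hi0 (by omega), show i + 1 = O.N - 1 by omega]
      simp only [hval, if_pos h2]
      rcases ha4 with h3 | ⟨p, hp, hpot⟩
      · exact Or.inl (by omega)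
      · obtain ⟨h4, h5⟩ := ha1 p hp
        refine Or.inr ⟨p, O.mem_layerSet.2 h4, ?_, by omega⟩
        rwa [hmA p (O.mem_layerSet.2 h4) h5]
    · left
      rw [hcount i hi0 (by omega)]
      simp only [hval, if_neg h2]
      have := O.POT_le_invConst (i := i) (by omega) hm₀
      omega
  · rw [invConst_eq]
    by_cases h1 : j = O.N - 1
    · subst h1
      rw [hcount1, ← h, show O.N - 1 + 1 = O.N by omega, Nat.cast_add]
      congr 1
      exact Finset.sum_congr rfl fun p hp => by rw [hmY p (O.Y_subset.2 (Or.inr hp))]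
    rw [hcount j hj (by omega)]
    by_cases h2 : j = O.N - 2
    · simp only [hval, if_pos h2]
      rw [show j + 1 = O.N - 1 by omega, hcin1, Int.toNat_of_nonneg ha3, h2]
      omega
    · simp only [hval, if_neg h2]
      have h3 := O.POT_le_invConst (i := j) (by omega) hm₀
      have h4 : ∑ p ∈ O.layerSet (j + 1), O.cin p * (m p : ℤ) = 0 := by
        refine Finset.sum_eq_zero fun p hp => ?_
        rw [hmlow p (j + 1) (O.mem_layerSet.1 hp) (by omega)]
        split_ifs with h5
        · rw [h5, O.cin_of_mem_maxSet (by omega) (hz (j + 1) (by omega) (by omega)), zero_mul]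
        · simp
      rw [h4, Int.toNat_of_nonneg (by omega)]
      omega

/-! ### Directions of weight zero and the exponential tilt -/

/-- The weight of a place in the last invariant. -/
def wt (p : P) : ℤ := if O.str.layer (some p) = O.N then O.cin p else 1

open Classical in
lemma sum_wt {d : P → ℕ} (hd : ∀ p, 0 < d p → p ∈ O.Y) : ∑ p, O.wt p * (d p : ℤ) =
    (O.tot d : ℤ) + ∑ p ∈ O.layerSet O.N, O.cin p * (d p : ℤ) := by
  have hdisj : Disjoint (O.maxSet (O.N - 1)) (O.layerSet O.N) := by
    rw [Finset.disjoint_left]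
    intro p hp hp'
    have h1 := (O.mem_maxSet.1 hp).1
    have h2 := O.mem_layerSet.1 hp'
    have := O.one_le_N
    omega
  have h1 : ∑ p, O.wt p * (d p : ℤ) = ∑ p ∈ O.Y, O.wt p * (d p : ℤ) := by
    refine (Finset.sum_subset (Finset.subset_univ _) fun p _ hp => ?_).symm
    have : d p = 0 := by
      by_contra h0
      exact hp (hd p (Nat.pos_of_ne_zero h0))
    simp [this]
  have hY : O.Y = O.maxSet (O.N - 1) ∪ O.layerSet O.N := by
    ext p
    rw [O.Y_subset, Finset.mem_union]
  rw [h1, hY, Finset.sum_union hdisj, tot, Nat.cast_sum]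
  congr 1
  · refine Finset.sum_congr rfl fun p hp => ?_
    have h1 := (O.mem_maxSet.1 hp).1
    have := O.one_le_N
    rw [wt, if_neg (by omega), one_mul]
  · refine Finset.sum_congr rfl fun p hp => ?_
    rw [wt, if_pos (O.mem_layerSet.1 hp)]

/-- Adding tokens preserves activity. Places of Y lie in the last layer or have cin zero in layer
N-1, so only the last invariant can see `d`, and its value on `d` is zero. -/
lemma add_mem_reach {m₀ m d : P → ℕ} (hm₀ : O.Full m₀) (hm : m ∈ O.net.reach m₀)
    (hd : ∀ p, 0 < d p → p ∈ O.Y) (hw : ∑ p, O.wt p * (d p : ℤ) = 0) :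
    m + d ∈ O.net.reach m₀ := by
  classical
  obtain ⟨h1, h2⟩ := (O.mem_reach_iff hm₀ m).1 hm
  refine (O.mem_reach_iff hm₀ _).2 ⟨fun i hi => (h1 i hi).mono le_self_add, fun j hj hj' => ?_⟩
  rw [invConst_add, h2 j hj hj', add_eq_left, invConst_eq]
  rw [O.sum_wt hd] at hw
  have hd0 : ∀ p, O.str.layer (some p) < O.N - 1 → d p = 0 := by
    intro p hp
    by_contra h0
    rcases O.Y_subset.1 (hd p (Nat.pos_of_ne_zero h0)) with h3 | h3
    · have := (O.mem_maxSet.1 h3).1; omega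
    · have := O.mem_layerSet.1 h3; omega
  by_cases hjN : j = O.N - 1
  · have h3 : O.count j d = O.tot d := by
      rw [count, tot, ← hjN]
      refine (Finset.sum_subset (fun p hp => O.mem_layerSet.2 (O.mem_maxSet.1 hp).1)
        fun p hp hp' => ?_).symm
      by_contra h0
      rcases O.Y_subset.1 (hd p (Nat.pos_of_ne_zero h0)) with h3 | h3
      · exact hp' (hjN ▸ h3)
      · have := O.mem_layerSet.1 h3
        have := O.mem_layerSet.1 hp
        omega
    rw [h3, show j + 1 = O.N by omega, hw]
  · have h3 : O.count j d = 0 := Finset.sum_eq_zero fun p hp =>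
      hd0 p (by rw [O.mem_layerSet.1 hp]; omega)
    have h4 : ∑ p ∈ O.layerSet (j + 1), O.cin p * (d p : ℤ) = 0 := by
      refine Finset.sum_eq_zero fun p hp => ?_
      have hp' := O.mem_layerSet.1 hp
      by_cases h0 : d p = 0
      · simp [h0]
      rcases O.Y_subset.1 (hd p (Nat.pos_of_ne_zero h0)) with h3 | h3
      · rw [O.cin_of_mem_maxSet (by omega) h3, zero_mul]
      · have := O.mem_layerSet.1 h3; omega
    rw [h3, h4]
    rfl

open PetriNet in
-- The markings m₀ + k d are distinct and reachable, and along them the summable product form is a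
-- geometric sequence.
lemma weightOf_lt_one {μ : P → ℝ} (hμ : ∀ p, 0 < μ p) {m₀ : P → ℕ} (hm₀ : O.Full m₀)
    (hs : Summable fun m : O.net.reach m₀ => weightOf μ m) {d : P → ℕ} (hd0 : d ≠ 0)
    (hd : ∀ p, 0 < d p → p ∈ O.Y) (hw : ∑ p, O.wt p * (d p : ℤ) = 0) : weightOf μ d < 1 := by
  have hmem : ∀ k : ℕ, m₀ + k • d ∈ O.net.reach m₀ := by
    intro k
    refine O.add_mem_reach hm₀ Relation.ReflTransGen.refl (fun p hp => hd p ?_) ?_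
    · by_contra h0
      have : d p = 0 := by omega
      simp [this] at hp
    · have : ∀ p, O.wt p * (((k • d) p : ℕ) : ℤ) = k * (O.wt p * (d p : ℤ)) := by
        intro p
        simp only [Pi.smul_apply, smul_eq_mul, Nat.cast_mul]
        ring
      rw [Finset.sum_congr rfl fun p _ => this p, ← Finset.mul_sum, hw, mul_zero]
  have hinj : Function.Injective fun k : ℕ => (⟨m₀ + k • d, hmem k⟩ : O.net.reach m₀) := by
    intro k k' h
    obtain ⟨p, hp⟩ := Function.ne_iff.1 hd0
    have h1 := congrFun (add_left_cancel (congrArg Subtype.val h)) p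
    simp only [Pi.smul_apply, smul_eq_mul] at h1
    exact Nat.eq_of_mul_eq_mul_right (Nat.pos_of_ne_zero hp) h1
  have h1 := hs.comp_injective hinj
  have h2 : ∀ k : ℕ, weightOf μ (k • d) = weightOf μ d ^ k := by
    intro k
    simp only [weightOf, Pi.smul_apply, smul_eq_mul, ← Finset.prod_pow, ← pow_mul]
    exact Finset.prod_congr rfl fun p _ => by rw [mul_comm]
  have h3 : Summable fun k : ℕ => weightOf μ d ^ k := by
    have h4 : Summable fun k : ℕ => weightOf μ m₀ * weightOf μ d ^ k := by
      refine h1.congr fun k => ?_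
      simp only [Function.comp]
      rw [weightOf_add, h2]
    exact (summable_mul_left_iff (weightOf_pos hμ m₀).ne').1 h4
  have h5 := summable_geometric_iff_norm_lt_one.1 h3
  rwa [Real.norm_of_nonneg (weightOf_pos hμ d).le] at h5

open PetriNet in
/-- For ergodic nets there is an exponential change of measure that makes all constants `μ_p`
smaller than `1`. -/
theorem exists_tilt {μ : P → ℝ} (hμ : ∀ p, 0 < μ p) {m₀ : P → ℕ} (hm₀ : O.Full m₀)
    (hs : Summable fun m : O.net.reach m₀ => weightOf μ m) :
    ∃ τ : ℝ, ∀ p ∈ O.Y, μ p * Real.exp (τ * O.wt p) < 1 := by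
  classical
  have hzero : ∀ p ∈ O.Y, O.wt p = 0 → μ p < 1 := by
    intro p hp hw
    have h := O.weightOf_lt_one hμ hm₀ hs (d := Pi.single p 1) (by simp) (fun q hq => by
      by_cases hqp : q = p
      · exact hqp ▸ hp
      · simp [hqp] at hq) (by
      rw [Finset.sum_eq_single p]
      · simp [hw]
      · intro q _ hq; simp [hq]
      · simp)
    rw [weightOf, Finset.prod_eq_single p] at h
    · simpa using h
    · intro q _ hq; simp [hq]
    · simp
  have hpair : ∀ p ∈ O.Y, ∀ q ∈ O.Y, 0 < O.wt p → O.wt q < 0 →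
      Real.log (μ q) / (-O.wt q : ℤ) < - (Real.log (μ p) / (O.wt p : ℤ)) := by
    intro p hp q hq hwp hwq
    have hpq : p ≠ q := by rintro rfl; omega
    -- The direction with -wt(q) tokens in `p` and wt(p) tokens in `q` has weight zero; the
    -- logarithm of its product gives the inequality.
    have h := O.weightOf_lt_one hμ hm₀ hs
      (d := fun r => if r = p then (-O.wt q).toNat else if r = q then (O.wt p).toNat else 0)
      (fun h => by
        have := congrFun h p
        simp at this
        omega)
      (fun r hr => by
        by_cases hrp : r = p
        · exact hrp ▸ hp
        by_cases hrq : r = q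
        · exact hrq ▸ hq
        · simp [hrp, hrq] at hr) (by
      rw [← Finset.sum_subset (Finset.subset_univ {p, q}), Finset.sum_pair hpq]
      · simp only [if_true, hpq.symm, if_false]
        rw [Int.toNat_of_nonneg (by omega), Int.toNat_of_nonneg (by omega)]
        ring
      · intro r _ hr
        simp only [Finset.mem_insert, Finset.mem_singleton, not_or] at hr
        simp [hr.1, hr.2])
    rw [weightOf, ← Finset.prod_subset (Finset.subset_univ {p, q}), Finset.prod_pair hpq] at h
    · simp only [if_true, hpq.symm, if_false] at h
      have h1 := Real.log_neg (mul_pos (pow_pos (hμ p) _) (pow_pos (hμ q) _)) h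
      rw [Real.log_mul (pow_pos (hμ p) _).ne' (pow_pos (hμ q) _).ne', Real.log_pow,
        Real.log_pow] at h1
      have ha : (0 : ℝ) < ((O.wt p : ℤ) : ℝ) := by exact_mod_cast hwp
      have hb : (0 : ℝ) < ((-O.wt q : ℤ) : ℝ) := by exact_mod_cast (by omega : 0 < -O.wt q)
      have ha' : (((O.wt p).toNat : ℕ) : ℝ) = ((O.wt p : ℤ) : ℝ) := by
        exact_mod_cast congrArg (Int.cast : ℤ → ℝ) (Int.toNat_of_nonneg hwp.le)
      have hb' : (((-O.wt q).toNat : ℕ) : ℝ) = ((-O.wt q : ℤ) : ℝ) := by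
        exact_mod_cast congrArg (Int.cast : ℤ → ℝ) (Int.toNat_of_nonneg (by omega : 0 ≤ -O.wt q))
      rw [ha', hb'] at h1
      rw [← neg_div, div_lt_div_iff₀ hb ha]
      linarith
    · intro r _ hr
      simp only [Finset.mem_insert, Finset.mem_singleton, not_or] at hr
      simp [hr.1, hr.2]
  -- Places of negative weight bound τ from below, those of positive weight from above, and `hpair`
  -- puts all lower bounds below all upper ones. Weight zero imposes no condition on τ.
  obtain ⟨τ, h1, h2⟩ := Order.exists_between_finsets
    ((O.Y.filter fun q => O.wt q < 0).image fun q => Real.log (μ q) / (-O.wt q : ℤ))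
    ((O.Y.filter fun p => 0 < O.wt p).image fun p => -(Real.log (μ p) / (O.wt p : ℤ)))
    (by
      intro x hx y hy
      simp only [Finset.mem_image, Finset.mem_filter] at hx hy
      obtain ⟨q, ⟨hq, hwq⟩, rfl⟩ := hx
      obtain ⟨p, ⟨hp, hwp⟩, rfl⟩ := hy
      exact hpair p hp q hq hwp hwq)
  refine ⟨τ, fun p hp => ?_⟩
  have hlog : μ p * Real.exp (τ * O.wt p) = Real.exp (Real.log (μ p) + τ * O.wt p) := by
    rw [Real.exp_add, Real.exp_log (hμ p)]
  rcases lt_trichotomy (O.wt p) 0 with hw | hw | hw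
  · have h3 := h1 _ (Finset.mem_image_of_mem _ (Finset.mem_filter.2 ⟨hp, hw⟩))
    have hb : (0 : ℝ) < ((-O.wt p : ℤ) : ℝ) := by exact_mod_cast (by omega : 0 < -O.wt p)
    rw [div_lt_iff₀ hb] at h3
    push_cast at h3
    rw [hlog, Real.exp_lt_one_iff]
    linarith
  · rw [hw]
    simpa using hzero p hp hw
  · have h3 := h2 _ (Finset.mem_image_of_mem _ (Finset.mem_filter.2 ⟨hp, hw⟩))
    have ha : (0 : ℝ) < ((O.wt p : ℤ) : ℝ) := by exact_mod_cast hw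
    rw [← neg_div, lt_div_iff₀ ha] at h3
    rw [hlog, Real.exp_lt_one_iff]
    linarith

end OpenPi3

end


noncomputable section

/-! ### Partition functions with a linear constraint -/

namespace PartFun

open PetriNet

variable {ι : Type} [Fintype ι]

/-- The scalar product of integer weights and a marking. -/
def dot (w : ι → ℤ) (x : ι → ℕ) : ℤ := ∑ p, w p * (x p : ℤ)

/-- The term of the partition function at `x`. -/
def term (w : ι → ℤ) (ν : ι → ℝ) (K : ℤ) (x : ι → ℕ) : ℝ :=
  if dot w x = K then weightOf ν x else 0

/-- The sum of `∏ ν_p ^ x_p` over the `x` with `w · x = K`. -/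
def part (w : ι → ℤ) (ν : ι → ℝ) (K : ℤ) : ℝ := ∑' x, term w ν K x

/-- The constants `ν` are non-negative and become smaller than `1` under an exponential tilt. -/
def Tilted (w : ι → ℤ) (ν : ι → ℝ) (τ : ℝ) : Prop :=
  ∀ p, 0 ≤ ν p ∧ ν p * Real.exp (τ * w p) < 1

/-- A finite set of vectors lies in a box, over which the sum factorises into partial geometric
sums. -/
lemma summable_weightOf_of_lt_one {c : ι → ℝ} (h0 : ∀ p, 0 ≤ c p) (h1 : ∀ p, c p < 1) :
    Summable (weightOf c) := by
  classical
  refine summable_of_sum_le (c := ∏ p, (1 - c p)⁻¹)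
    (fun x => Finset.prod_nonneg fun p _ => pow_nonneg (h0 p) _) fun u => ?_
  set M := u.sup fun x => Finset.univ.sup x with hM
  have hsub : u ⊆ Fintype.piFinset fun _ : ι => Finset.range (M + 1) := by
    intro x hx
    rw [Fintype.mem_piFinset]
    intro p
    rw [Finset.mem_range, Nat.lt_succ_iff]
    exact (Finset.le_sup (f := x) (Finset.mem_univ p)).trans
      (Finset.le_sup (f := fun x : ι → ℕ => Finset.univ.sup x) hx)
  refine (Finset.sum_le_sum_of_subset_of_nonneg hsub fun x _ _ =>
    Finset.prod_nonneg fun p _ => pow_nonneg (h0 p) _).trans ?_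
  have h2 := Finset.prod_univ_sum (fun _ : ι => Finset.range (M + 1)) fun p k => c p ^ k
  change ∑ x ∈ Fintype.piFinset fun _ : ι => Finset.range (M + 1), ∏ p, c p ^ x p ≤ _
  rw [← h2]
  refine Finset.prod_le_prod (fun p _ => Finset.sum_nonneg fun k _ => pow_nonneg (h0 p) _)
    fun p _ => ?_
  rw [← tsum_geometric_of_lt_one (h0 p) (h1 p)]
  exact (summable_geometric_of_lt_one (h0 p) (h1 p)).sum_le_tsum _
    fun k _ => pow_nonneg (h0 p) _

lemma term_nonneg {w : ι → ℤ} {ν : ι → ℝ} {τ : ℝ} (h : Tilted w ν τ) (K : ℤ) (x : ι → ℕ) :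
    0 ≤ term w ν K x := by
  unfold term
  split_ifs
  · exact Finset.prod_nonneg fun p _ => pow_nonneg (h p).1 _
  · exact le_rfl

lemma weightOf_tilt (w : ι → ℤ) (ν : ι → ℝ) (τ : ℝ) (x : ι → ℕ) :
    weightOf (fun p => ν p * Real.exp (τ * w p)) x = weightOf ν x * Real.exp (τ * dot w x) := by
  simp only [weightOf, mul_pow, Finset.prod_mul_distrib, dot]
  congr 1
  push_cast
  rw [Finset.mul_sum, Real.exp_sum]
  refine Finset.prod_congr rfl fun p _ => ?_
  rw [← Real.exp_nat_mul]
  congr 1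
  ring

/-- On the hyperplane w · x = K the tilt multiplies every term by the same factor exp(τ K), so the
tilted summable series dominates. -/
lemma summable_term {w : ι → ℤ} {ν : ι → ℝ} {τ : ℝ} (h : Tilted w ν τ) (K : ℤ) :
    Summable (term w ν K) := by
  have h1 := summable_weightOf_of_lt_one (c := fun p => ν p * Real.exp (τ * w p))
    (fun p => mul_nonneg (h p).1 (Real.exp_pos _).le) fun p => (h p).2
  refine Summable.of_nonneg_of_le (term_nonneg h K) (fun x => ?_)
    (h1.mul_left (Real.exp (-(τ * K))))
  unfold term
  split_ifs with hx
  · rw [weightOf_tilt, hx, mul_left_comm, ← Real.exp_add]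
    simp
  · exact mul_nonneg (Real.exp_pos _).le
      (Finset.prod_nonneg fun p _ => pow_nonneg (mul_nonneg (h p).1 (Real.exp_pos _).le) _)

lemma Tilted.mono {w : ι → ℤ} {ν ν' : ι → ℝ} {τ : ℝ} (h : Tilted w ν τ) (h0 : ∀ p, 0 ≤ ν' p)
    (h1 : ∀ p, ν' p ≤ ν p) : Tilted w ν' τ := fun p =>
  ⟨h0 p, lt_of_le_of_lt (mul_le_mul_of_nonneg_right (h1 p) (Real.exp_pos _).le) (h p).2⟩

lemma dot_add (w : ι → ℤ) (x y : ι → ℕ) : dot w (x + y) = dot w x + dot w y := by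
  simp [dot, mul_add, Finset.sum_add_distrib]

open Classical in
lemma dot_single (w : ι → ℤ) (p : ι) (k : ℕ) : dot w (Pi.single p k) = w p * k := by
  rw [dot, Finset.sum_eq_single p]
  · simp
  · intro q _ hq; simp [hq]
  · simp

open Classical in
lemma weightOf_single (ν : ι → ℝ) (p : ι) (k : ℕ) : weightOf ν (Pi.single p k) = ν p ^ k := by
  rw [weightOf, Finset.prod_eq_single p]
  · simp
  · intro q _ hq; simp [hq]
  · simp

open Classical in
/-- The restriction of the constants to a set of places. -/
def restr (S : ι → Prop) (ν : ι → ℝ) : ι → ℝ := fun p => if S p then ν p else 0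

lemma Tilted.restr {w : ι → ℤ} {ν : ι → ℝ} {τ : ℝ} (h : Tilted w ν τ) (S : ι → Prop) :
    Tilted w (restr S ν) τ := by
  refine h.mono (fun p => ?_) fun p => ?_
  · unfold PartFun.restr
    split_ifs
    · exact (h p).1
    · exact le_rfl
  · unfold PartFun.restr
    split_ifs
    · exact le_rfl
    · exact (h p).1

/-! ### Recurrences and boundary values of partition functions -/

/-- Adding a place to the partition function. -/
lemma part_insert {w : ι → ℤ} {ν : ι → ℝ} {τ : ℝ} (h : Tilted w ν τ) {S S' : ι → Prop} {p : ι}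
    (hp : ¬ S p) (hS : ∀ q, S' q ↔ S q ∨ q = p) (K : ℤ) :
    part w (restr S' ν) K = part w (restr S ν) K + ν p * part w (restr S' ν) (K - w p) := by
  classical
  have hinj : Function.Injective fun x : ι → ℕ => x + Pi.single p 1 := add_left_injective _
  -- Vectors with a token in `p`: removing it shifts K by w_p and takes out a factor ν_p.
  have h1 : HasSum (fun x => if x p = 0 then 0 else term w (restr S' ν) K x)
      (ν p * part w (restr S' ν) (K - w p)) := by
    refine (hinj.hasSum_iff ?_).1 ?_
    · intro x hx
      refine if_pos ?_
      by_contra h0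
      refine hx ⟨x - Pi.single p 1, tsub_add_cancel_of_le ?_⟩
      intro q
      by_cases hq : q = p
      · subst hq
        simpa using Nat.one_le_iff_ne_zero.2 h0
      · simp [hq]
    · have h2 : ((fun x => if x p = 0 then 0 else term w (restr S' ν) K x) ∘
          fun x : ι → ℕ => x + Pi.single p 1) =
          fun x => ν p * term w (restr S' ν) (K - w p) x := by
        funext x
        simp only [Function.comp, Pi.add_apply, Pi.single_eq_same, Nat.add_one_ne_zero, if_false,
          term, dot_add, dot_single, weightOf_add, weightOf_single]
        have h3 : restr S' ν p = ν p := by simp [restr, hS]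
        rw [h3]
        by_cases h4 : dot w x = K - w p
        · rw [if_pos (by rw [h4]; simp), if_pos h4]
          ring
        · rw [if_neg (by intro h5; apply h4; rw [← h5]; simp), if_neg h4, mul_zero]
      rw [h2]
      exact (summable_term (h.restr S') _).hasSum.mul_left _
  have h2 : HasSum (fun x => if x p = 0 then term w (restr S' ν) K x else 0)
      (part w (restr S ν) K) := by
    have h3 : (fun x => if x p = 0 then term w (restr S' ν) K x else 0) = term w (restr S ν) K := by
      funext x
      have hzero : restr S ν p = 0 := by simp [restr, hp]
      have hcongr : ∀ q, q ≠ p → restr S' ν q = restr S ν q := by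
        intro q hq
        simp [restr, hS, hq]
      unfold term
      by_cases h5 : dot w x = K
      swap
      · simp [h5]
      rw [if_pos h5, if_pos h5]
      split_ifs with h0
      · refine Finset.prod_congr rfl fun q _ => ?_
        by_cases hq : q = p
        · subst hq; rw [h0]; simp
        · rw [hcongr q hq]
      · symm
        refine Finset.prod_eq_zero (Finset.mem_univ p) ?_
        rw [hzero, zero_pow h0]
    rw [h3]
    exact (summable_term (h.restr S) K).hasSum
  have h3 := (summable_term (h.restr S') K).hasSum.unique (by
    convert h2.add h1 using 1
    funext x
    by_cases h0 : x p = 0 <;> simp [h0])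
  exact h3

lemma part_eq_zero {w : ι → ℤ} {ν : ι → ℝ} (h : ∀ p, ν p ≠ 0 → 0 ≤ w p) {K : ℤ} (hK : K < 0) :
    part w ν K = 0 := by
  have : ∀ x, term w ν K x = 0 := by
    intro x
    unfold term
    split_ifs with hx
    · obtain ⟨p, hp⟩ : ∃ p, w p * (x p : ℤ) < 0 := by
        by_contra! hcon
        have := Finset.sum_nonneg fun p (_ : p ∈ Finset.univ) => hcon p
        change 0 ≤ dot w x at this
        omega
      refine Finset.prod_eq_zero (Finset.mem_univ p) ?_
      have hx0 : x p ≠ 0 := by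
        intro h0
        rw [h0] at hp
        simp at hp
      have hν : ν p = 0 := by
        by_contra h0
        have := mul_nonneg (h p h0) (Int.natCast_nonneg (x p))
        omega
      rw [hν, zero_pow hx0]
    · rfl
  simp [part, this]

lemma part_neg (w : ι → ℤ) (ν : ι → ℝ) (K : ℤ) : part (-w) ν (-K) = part w ν K := by
  refine tsum_congr fun x => ?_
  have : dot (-w) x = - dot w x := by simp [dot]
  unfold term
  rw [this]
  simp only [neg_inj]

lemma part_empty {w : ι → ℤ} {ν : ι → ℝ} {S : ι → Prop} (hS : ∀ p, ¬ S p) (K : ℤ) :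
    part w (restr S ν) K = if K = 0 then 1 else 0 := by
  have h0 : restr S ν = fun _ => 0 := by
    funext p; simp [restr, hS p]
  rw [part, tsum_eq_single 0, term]
  · simp [dot, weightOf, eq_comm]
  · intro x hx
    obtain ⟨p, hp⟩ := Function.ne_iff.1 hx
    unfold term
    split_ifs
    · refine Finset.prod_eq_zero (Finset.mem_univ p) ?_
      rw [h0]
      exact zero_pow hp
    · rfl

/-! #### The dynamic programme -/

section Walk

variable {a b : ℕ} {u v : ℝ} {δ : ℕ → ℤ} {pr : ℕ → ℝ}

lemma walk_bounds (h0 : δ 0 = 0)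
    (hδ : ∀ s < a + b, δ (s + 1) = if 0 ≤ δ s then δ s - a else δ s + b) :
    ∀ s ≤ a + b, -(a : ℤ) ≤ δ s ∧ δ s ≤ b := by
  intro s
  induction s with
  | zero => intro _; rw [h0]; omega
  | succ s ih =>
    intro hs
    have := ih (by omega)
    rw [hδ s (by omega)]
    split_ifs <;> omega

/-- After k steps down and l steps up the position is b l - a k. At time a + b this is (a + b)(b -
k), and as the walk stays in [-a, b) it must be zero with k = b and l = a. -/
lemma walk_end (ha : 0 < a) (hb : 0 < b) (h0 : δ 0 = 0) (hp0 : pr 0 = 1)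
    (hδ : ∀ s < a + b, δ (s + 1) = if 0 ≤ δ s then δ s - a else δ s + b)
    (hpr : ∀ s < a + b, pr (s + 1) = pr s * if 0 ≤ δ s then u else v) :
    δ (a + b) = 0 ∧ pr (a + b) = u ^ b * v ^ a := by
  have key : ∀ s ≤ a + b, ∃ k l : ℕ, k + l = s ∧ δ s = b * l - a * k ∧ pr s = u ^ k * v ^ l ∧
      -(a : ℤ) ≤ δ s ∧ δ s < b := by
    intro s
    induction s with
    | zero => intro _; exact ⟨0, 0, rfl, by simp [h0], by simp [hp0], by rw [h0]; omega, by omega⟩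
    | succ s ih =>
      intro hs
      obtain ⟨k, l, h1, h2, h3, h4, h5⟩ := ih (by omega)
      rw [hδ s (by omega), hpr s (by omega)]
      split_ifs with h6
      · refine ⟨k + 1, l, by omega, by rw [h2]; push_cast; ring, by rw [h3]; ring, by omega, ?_⟩
        omega
      · refine ⟨k, l + 1, by omega, by rw [h2]; push_cast; ring, by rw [h3]; ring, by omega, ?_⟩
        omega
  obtain ⟨k, l, h1, h2, h3, h4, h5⟩ := key (a + b) le_rfl
  have h6 : δ (a + b) = (a + b : ℤ) * (b - k) := by
    have : (l : ℤ) = a + b - k := by omega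
    rw [h2, this]
    ring
  have h7 : k = b := by
    rw [h6] at h4 h5
    rcases lt_trichotomy k b with h | h | h
    · have h8 : (1 : ℤ) ≤ (b : ℤ) - k := by omega
      have h9 : (a + b : ℤ) * 1 ≤ (a + b : ℤ) * (b - k) :=
        mul_le_mul_of_nonneg_left h8 (by omega)
      omega
    · exact h
    · have h8 : (b : ℤ) - k ≤ -1 := by omega
      have h9 : (a + b : ℤ) * (b - k) ≤ (a + b : ℤ) * (-1) :=
        mul_le_mul_of_nonneg_left h8 (by omega)
      omega
  subst h7
  have : l = a := by omega
  subst this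
  exact ⟨by rw [h6]; ring, h3⟩

/-- The value of a function satisfying two linear recurrences in opposite directions. -/
lemma walk_value (ha : 0 < a) (hb : 0 < b) {acc : ℕ → ℝ} {g gp gq : ℤ → ℝ} {K : ℤ}
    (h0 : δ 0 = 0) (hp0 : pr 0 = 1)
    (hδ : ∀ s < a + b, δ (s + 1) = if 0 ≤ δ s then δ s - a else δ s + b)
    (hpr : ∀ s < a + b, pr (s + 1) = pr s * if 0 ≤ δ s then u else v)
    (hacc0 : acc 0 = 0)
    (hacc : ∀ s < a + b, acc (s + 1) = acc s +
      pr s * if 0 ≤ δ s then gp (K + δ s) else gq (K + δ s))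
    (hgp : ∀ K, g K = gp K + u * g (K - a)) (hgq : ∀ K, g K = gq K + v * g (K + b))
    (huv : u ^ b * v ^ a < 1) : g K = acc (a + b) / (1 - pr (a + b)) := by
  have key : ∀ s ≤ a + b, g K = acc s + pr s * g (K + δ s) := by
    intro s
    induction s with
    | zero => intro _; simp [h0, hp0, hacc0]
    | succ s ih =>
      intro hs
      rw [ih (by omega), hδ s (by omega), hpr s (by omega), hacc s (by omega)]
      split_ifs
      · rw [hgp (K + δ s), ← add_sub_assoc]
        ring
      · rw [hgq (K + δ s), ← add_assoc]
        ring
  obtain ⟨h1, h2⟩ := walk_end ha hb h0 hp0 hδ hpr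
  -- The walk is back at its start, so this is a linear equation for g K with coefficient u^b v^a <
  -- 1.
  have h3 := key (a + b) le_rfl
  rw [h1, add_zero, h2] at h3
  rw [h2, eq_div_iff (by linarith)]
  linarith

end Walk

end PartFun

/-! ### The sum over the classes as a combination of partition functions -/

namespace OpenPi3

open PetriNet PartFun

variable {P T : Type} [Fintype P] [Fintype T] (O : OpenPi3 P T)

lemma Y_disjoint {p : P} (hp : p ∈ O.maxSet (O.N - 1)) (hp' : p ∈ O.layerSet O.N) : False := by
  have h1 := (O.mem_maxSet.1 hp).1
  have h2 := O.mem_layerSet.1 hp'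
  have := O.one_le_N
  omega

/-- The places of the last layer with potential greater than `s`. -/
def High (s : ℕ) (p : P) : Prop := p ∈ O.layerSet O.N ∧ s < O.pot p

open Classical in
/-- The extension by zero of a class of markings. -/
def extend (M : MarkingClass O.Y) : P → ℕ := fun p => if h : p ∈ O.Y then M.coord ⟨p, h⟩ else 0

lemma mk_extend (M : MarkingClass O.Y) : MarkingClass.mk O.Y (O.extend M) = M := by
  induction M using Quotient.inductionOn with
  | h m =>
    refine Quotient.sound fun p hp => ?_
    simp only [extend, hp, dif_pos]
    rfl

lemma extend_mk (m : P → ℕ) {p : P} (hp : p ∈ O.Y) :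
    O.extend (MarkingClass.mk O.Y m) p = m p := by
  simp only [extend, hp, dif_pos]
  rfl

lemma weight_eq (μ : P → ℝ) (M : MarkingClass O.Y) :
    MarkingClass.weight μ M = weightOf (restr (· ∈ O.Y) μ) (O.extend M) := by
  classical
  have h1 : weightOf (restr (· ∈ O.Y) μ) (O.extend M) =
      ∏ p ∈ O.Y, restr (· ∈ O.Y) μ p ^ O.extend M p := by
    refine (Finset.prod_subset (Finset.subset_univ _) fun p _ hp => ?_).symm
    simp [extend, hp]
  rw [h1, ← Finset.prod_coe_sort, MarkingClass.weight]
  refine Finset.prod_congr rfl fun p _ => ?_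
  simp [extend, restr]

/-- This removes the quantifier over reachable representatives, by `feasible_of_mem_reach` and
`exists_mem_reach`. -/
lemma mem_classesD_iff {m₀ : P → ℕ} (hm₀ : O.Full m₀) {c : ℕ} (M : MarkingClass O.Y) :
    M ∈ O.classesD m₀ c ↔ dot O.wt (O.extend M) = O.invConst (O.N - 1) m₀ - c ∧
      O.Feasible m₀ c ∧ O.LastAct c (O.extend M) := by
  classical
  have hext : ∀ p, 0 < O.extend M p → p ∈ O.Y := by
    intro p hp
    by_contra h
    simp [extend, h] at hp
  have h1 : ∑ p : {p // p ∈ O.Y} with p.1 ∈ O.maxSet (O.N - 1), (M.coord p : ℤ) =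
      O.tot (O.extend M) := by
    rw [tot, Nat.cast_sum]
    refine Finset.sum_bij (fun p _ => p.1) ?_ ?_ ?_ ?_
    · intro p hp; exact (Finset.mem_filter.1 hp).2
    · intro p _ q _ h; exact Subtype.ext h
    · intro p hp
      exact ⟨⟨p, O.Y_subset.2 (Or.inl hp)⟩, by simpa using hp, rfl⟩
    · intro p _
      simp [extend]
  have h2 : ∑ p : {p // p ∈ O.Y} with p.1 ∈ O.layerSet O.N, O.cin p.1 * (M.coord p : ℤ) =
      ∑ p ∈ O.layerSet O.N, O.cin p * (O.extend M p : ℤ) := by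
    refine Finset.sum_bij (fun p _ => p.1) ?_ ?_ ?_ ?_
    · intro p hp; exact (Finset.mem_filter.1 hp).2
    · intro p _ q _ h; exact Subtype.ext h
    · intro p hp
      exact ⟨⟨p, O.Y_subset.2 (Or.inr hp)⟩, by simpa using hp, rfl⟩
    · intro p _
      simp [extend]
  have h3 : M ∈ O.classesD m₀ c ↔ ((c : ℤ) + O.tot (O.extend M) +
      ∑ p ∈ O.layerSet O.N, O.cin p * (O.extend M p : ℤ) = O.invConst (O.N - 1) m₀ ∧
      ∃ m ∈ O.net.reach m₀, MarkingClass.mk O.Y m = M) := by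
    rw [← h1, ← h2]
    rfl
  have h4 : dot O.wt (O.extend M) = O.invConst (O.N - 1) m₀ - c ↔ (c : ℤ) + O.tot (O.extend M) +
      ∑ p ∈ O.layerSet O.N, O.cin p * (O.extend M p : ℤ) = O.invConst (O.N - 1) m₀ := by
    rw [dot, O.sum_wt hext]
    constructor <;> intro h <;> linarith
  rw [h3, h4]
  refine and_congr_right fun h => ?_
  constructor
  · rintro ⟨m, hm, rfl⟩
    have e1 : O.tot (O.extend (MarkingClass.mk O.Y m)) = O.tot m :=
      Finset.sum_congr rfl fun p hp => O.extend_mk m (O.Y_subset.2 (Or.inl hp))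
    have e2 : ∀ p ∈ O.layerSet O.N, O.extend (MarkingClass.mk O.Y m) p = m p :=
      fun p hp => O.extend_mk m (O.Y_subset.2 (Or.inr hp))
    have e3 : ∑ p ∈ O.layerSet O.N, O.cin p * (O.extend (MarkingClass.mk O.Y m) p : ℤ) =
        ∑ p ∈ O.layerSet O.N, O.cin p * (m p : ℤ) :=
      Finset.sum_congr rfl fun p hp => by rw [e2 p hp]
    rw [e1, e3] at h
    obtain ⟨f1, f2⟩ := O.feasible_of_mem_reach hm₀ hm h
    refine ⟨f1, ?_⟩
    rw [LastAct, e1]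
    rcases f2 with f2 | ⟨p, hp, f3, f4⟩
    · exact Or.inl f2
    · exact Or.inr ⟨p, hp, by rwa [e2 p hp], f4⟩
  · rintro ⟨f1, f2⟩
    obtain ⟨m, hm, hmY⟩ := O.exists_mem_reach hm₀ h f1 f2
    refine ⟨m, hm, ?_⟩
    rw [← O.mk_extend M]
    exact Quotient.sound hmY

/-! ### Subtracting the vectors for which the last layer is inactive -/

open Classical in
/-- The term at `x` of the sum over the classes. -/
def goodTerm (μ : P → ℝ) (C : ℤ) (c : ℕ) (x : P → ℕ) : ℝ :=
  if dot O.wt x = C - c ∧ O.LastAct c x then weightOf (restr (· ∈ O.Y) μ) x else 0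

-- Classes correspond to vectors supported on Y. All other vectors contribute zero because the
-- restricted constants vanish outside Y, so the sum may run over all vectors.
open Classical in
lemma hasSum_classesD {m₀ : P → ℕ} (hm₀ : O.Full m₀) {c : ℕ} (hc : O.Feasible m₀ c) (μ : P → ℝ)
    {S : ℝ} (hS : HasSum (O.goodTerm μ (O.invConst (O.N - 1) m₀) c) S) :
    HasSum (fun M : O.classesD m₀ c => MarkingClass.weight μ (M : MarkingClass O.Y)) S := by
  have hinj : Function.Injective fun M : O.classesD m₀ c => O.extend M := by
    intro M M' h
    refine Subtype.ext ?_
    rw [← O.mk_extend M, ← O.mk_extend M']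
    exact congrArg _ h
  have h1 : (fun M : O.classesD m₀ c => MarkingClass.weight μ (M : MarkingClass O.Y)) =
      O.goodTerm μ (O.invConst (O.N - 1) m₀) c ∘ fun M : O.classesD m₀ c => O.extend M := by
    funext M
    have h2 := (O.mem_classesD_iff hm₀ M.1).1 M.2
    simp only [Function.comp, goodTerm]
    rw [if_pos ⟨h2.1, h2.2.2⟩, weight_eq]
  rw [h1, hinj.hasSum_iff]
  · exact hS
  intro x hx
  unfold goodTerm
  split_ifs with h
  swap
  · rfl
  by_cases hxY : ∀ p, p ∉ O.Y → x p = 0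
  · have h2 : O.extend (MarkingClass.mk O.Y x) = x := by
      funext p
      by_cases hp : p ∈ O.Y
      · exact O.extend_mk x hp
      · rw [hxY p hp]; simp [extend, hp]
    refine absurd ?_ hx
    refine ⟨⟨MarkingClass.mk O.Y x, (O.mem_classesD_iff hm₀ _).2 ?_⟩, h2⟩
    rw [h2]
    exact ⟨h.1, hc, h.2⟩
  · push Not at hxY
    obtain ⟨p, hp, hxp⟩ := hxY
    refine Finset.prod_eq_zero (Finset.mem_univ p) ?_
    simp [restr, hp, hxp]

open Classical in
/-- The term at `x` of the part of the partition function with `s` tokens in the last but one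
layer in which the last layer is not active. -/
def badTerm (μ : P → ℝ) (C : ℤ) (c s : ℕ) (x : P → ℕ) : ℝ :=
  if dot O.wt x = C - c ∧ c + O.tot x = s ∧ ∀ p ∈ O.layerSet O.N, 0 < x p → s < O.pot p
    then weightOf (restr (· ∈ O.Y) μ) x else 0

-- Inactivity fixes the number s of tokens in layer N-1, which is below POT_N. Thus at most one bad
-- term is non-zero, and it is so only where `LastAct` fails.
open Classical in
lemma goodTerm_eq (μ : P → ℝ) (C : ℤ) (c : ℕ) (x : P → ℕ) : O.goodTerm μ C c x =
    term O.wt (restr (· ∈ O.Y) μ) (C - c) x -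
      ∑ s ∈ Finset.range (O.POT O.N), if c ≤ s then O.badTerm μ C c s x else 0 := by
  unfold goodTerm term
  by_cases h1 : dot O.wt x = C - c
  swap
  · rw [if_neg (fun h => h1 h.1), if_neg h1, Finset.sum_eq_zero, sub_zero]
    intro s _
    simp [badTerm, h1]
  rw [if_pos h1]
  by_cases h2 : O.LastAct c x
  · rw [if_pos ⟨h1, h2⟩, Finset.sum_eq_zero, sub_zero]
    intro s hs
    split_ifs
    · refine if_neg ?_
      rintro ⟨_, h3, h4⟩
      have hs := Finset.mem_range.1 hs
      rcases h2 with h2 | ⟨p, hp, h5, h6⟩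
      · omega
      · have := h4 p hp h5; omega
    · rfl
  · rw [if_neg (fun h => h2 h.2)]
    simp only [LastAct, not_or, not_exists, not_and, not_le] at h2
    rw [Finset.sum_eq_single (c + O.tot x)]
    · rw [if_pos (Nat.le_add_right _ _), badTerm, if_pos ⟨h1, rfl, h2.2⟩, sub_self]
    · intro s _ hs
      split_ifs
      · exact if_neg fun h => hs h.2.1.symm
      · rfl
    · intro h
      exact absurd (Finset.mem_range.2 h2.1) h

-- Once s is fixed, the two kinds of places decouple: places of maximal potential carry s - c tokens
-- of weight one, and places of the last layer of potential greater than s carry the rest of the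
-- constraint.
open Classical in
lemma hasSum_badTerm {μ : P → ℝ} {τ : ℝ} (hμ : Tilted O.wt (restr (· ∈ O.Y) μ) τ) (C : ℤ)
    (c s : ℕ) :
    HasSum (O.badTerm μ C c s) (part O.wt (restr (· ∈ O.maxSet (O.N - 1)) μ) (s - c) *
      part O.wt (restr (O.High s) μ) (C - s)) := by
  set ν₁ := restr (· ∈ O.maxSet (O.N - 1)) μ with hν₁
  set ν₂ := restr (O.High s) μ with hν₂
  have hpos : ∀ p ∈ O.Y, 0 ≤ μ p := fun p hp => by
    have := (hμ p).1; simpa [restr, hp] using this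
  have ht : ∀ S : P → Prop, (∀ p, S p → p ∈ O.Y) → Tilted O.wt (restr S μ) τ := by
    intro S hS
    have := hμ.restr S
    have h1 : restr S (restr (· ∈ O.Y) μ) = restr S μ := by
      funext p
      by_cases hp : S p
      · simp [restr, hp, hS p hp]
      · simp [restr, hp]
    rwa [h1] at this
  have ht₁ : Tilted O.wt ν₁ τ := ht _ fun p hp => O.Y_subset.2 (Or.inl hp)
  have ht₂ : Tilted O.wt ν₂ τ := ht _ fun p hp => O.Y_subset.2 (Or.inr hp.1)
  have hs₁ := summable_term ht₁ ((s : ℤ) - c)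
  have hs₂ := summable_term ht₂ (C - s)
  have hprod := hs₁.hasSum.mul hs₂.hasSum
    (hs₁.mul_of_nonneg hs₂ (term_nonneg ht₁ _) (term_nonneg ht₂ _))
  -- Splits a vector into its part on the maximal places of layer N-1 and the remainder; the product
  -- series is pulled back along this injection.
  set φ : (P → ℕ) → (P → ℕ) × (P → ℕ) := fun x =>
    (fun p => if p ∈ O.maxSet (O.N - 1) then x p else 0,
      fun p => if p ∈ O.maxSet (O.N - 1) then 0 else x p) with hφ
  have hφadd : ∀ x, (φ x).1 + (φ x).2 = x := by
    intro x
    funext p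
    by_cases hp : p ∈ O.maxSet (O.N - 1) <;> simp [hφ, hp]
  have hinj : Function.Injective φ := by
    intro x y h
    rw [← hφadd x, ← hφadd y, h]
  have hsupp : ∀ {S : P → Prop} {K : ℤ} {x : P → ℕ}, term O.wt (restr S μ) K x ≠ 0 →
      ∀ p, x p ≠ 0 → S p := by
    intro S K x h p hp
    by_contra hS
    refine h ?_
    unfold term
    split_ifs
    · refine Finset.prod_eq_zero (Finset.mem_univ p) ?_
      simp [restr, hS, hp]
    · rfl
  have hcomp : O.badTerm μ C c s = (fun z : (P → ℕ) × (P → ℕ) =>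
      term O.wt ν₁ (s - c) z.1 * term O.wt ν₂ (C - s) z.2) ∘ φ := by
    funext x
    simp only [Function.comp]
    have hd1 : dot O.wt (φ x).1 = O.tot x := by
      rw [dot, tot, Nat.cast_sum, ← Finset.sum_subset (Finset.subset_univ (O.maxSet (O.N - 1)))]
      · refine Finset.sum_congr rfl fun p hp => ?_
        have h1 := (O.mem_maxSet.1 hp).1
        have h2 := O.one_le_N
        rw [wt, if_neg (by omega), one_mul]
        simp [hφ, hp]
      · intro p _ hp
        simp [hφ, hp]
    have hd2 : dot O.wt (φ x).2 = dot O.wt x - O.tot x := by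
      have := dot_add O.wt (φ x).1 (φ x).2
      rw [hφadd, hd1] at this
      omega
    have hw : weightOf ν₁ (φ x).1 * weightOf ν₂ (φ x).2 =
        if ∀ p ∈ O.layerSet O.N, 0 < x p → s < O.pot p then weightOf (restr (· ∈ O.Y) μ) x
        else 0 := by
      rw [weightOf, weightOf, ← Finset.prod_mul_distrib]
      split_ifs with h
      · refine Finset.prod_congr rfl fun p _ => ?_
        by_cases hp : p ∈ O.maxSet (O.N - 1)
        · have hpY : p ∈ O.Y := O.Y_subset.2 (Or.inl hp)
          simp [hφ, hp, hν₁, restr, hpY]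
        · by_cases hp' : p ∈ O.layerSet O.N
          · have hpY : p ∈ O.Y := O.Y_subset.2 (Or.inr hp')
            by_cases hx : x p = 0
            · simp [hφ, hx]
            · have := h p hp' (Nat.pos_of_ne_zero hx)
              simp only [hφ, hp, if_false, pow_zero, one_mul, hν₂, restr, hpY, if_true]
              rw [if_pos (show O.High s p from ⟨hp', this⟩)]
          · have hpY : p ∉ O.Y := fun h => by
              rcases O.Y_subset.1 h with h | h
              · exact hp h
              · exact hp' h
            simp only [hφ, hp, if_false, pow_zero, one_mul, hν₂, restr, hpY]
            rw [if_neg (fun h : O.High s p => hp' h.1)]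
      · push Not at h
        obtain ⟨p, hp, hx, hpot⟩ := h
        refine Finset.prod_eq_zero (Finset.mem_univ p) ?_
        have hp' : p ∉ O.maxSet (O.N - 1) := fun h => O.Y_disjoint h hp
        have hx' : x p ≠ 0 := hx.ne'
        have hh : ¬ O.High s p := fun h => absurd h.2 (by omega)
        simp [hφ, hp', hν₂, restr, hh, hx']
    unfold badTerm term
    rw [hd1, hd2]
    by_cases e1 : (O.tot x : ℤ) = s - c
    · by_cases e2 : dot O.wt x - O.tot x = C - s
      · rw [if_pos e1, if_pos e2, hw]
        by_cases e3 : ∀ p ∈ O.layerSet O.N, 0 < x p → s < O.pot p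
        · rw [if_pos e3, if_pos ⟨by omega, by omega, e3⟩]
        · rw [if_neg e3, if_neg fun h => e3 h.2.2]
      · rw [if_neg e2, mul_zero, if_neg]
        rintro ⟨h1, h2, _⟩
        omega
    · rw [if_neg e1, zero_mul, if_neg]
      rintro ⟨h1, h2, _⟩
      omega
  rw [hcomp, hinj.hasSum_iff]
  · exact hprod
  -- If both factors are non-zero, the supports lie in the respective sets of places, and then the
  -- pair is the image of its sum.
  rintro ⟨x₁, x₂⟩ hz
  by_contra hne
  have hne₁ : term O.wt ν₁ (s - c) x₁ ≠ 0 := fun h => hne (by simp [h])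
  have hne₂ : term O.wt ν₂ (C - s) x₂ ≠ 0 := fun h => hne (by simp [h])
  refine hz ⟨x₁ + x₂, ?_⟩
  refine Prod.ext (funext fun p => ?_) (funext fun p => ?_)
  · by_cases hp : p ∈ O.maxSet (O.N - 1)
    · have : x₂ p = 0 := by
        by_contra h0
        exact O.Y_disjoint hp (hsupp hne₂ p h0).1
      simp [hφ, hp, this]
    · have : x₁ p = 0 := by
        by_contra h0
        exact hp (hsupp hne₁ p h0)
      simp [hφ, hp, this]
  · by_cases hp : p ∈ O.maxSet (O.N - 1)
    · have : x₂ p = 0 := by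
        by_contra h0
        exact O.Y_disjoint hp (hsupp hne₂ p h0).1
      simp [hφ, hp, this]
    · have : x₁ p = 0 := by
        by_contra h0
        exact hp (hsupp hne₁ p h0)
      simp [hφ, hp, this]

open Classical in
/-- The value of the sum over the classes. -/
def classSum (μ : P → ℝ) (m₀ : P → ℕ) (c : ℕ) : ℝ :=
  if O.Feasible m₀ c then
    part O.wt (restr (· ∈ O.Y) μ) (O.invConst (O.N - 1) m₀ - c) -
      ∑ s ∈ Finset.range (O.POT O.N), if c ≤ s then
        part O.wt (restr (· ∈ O.maxSet (O.N - 1)) μ) (s - c) *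
          part O.wt (restr (O.High s) μ) (O.invConst (O.N - 1) m₀ - s) else 0
  else 0

open Classical in
theorem hasSum_classSum {m₀ : P → ℕ} (hm₀ : O.Full m₀) {μ : P → ℝ} {τ : ℝ}
    (hμ : Tilted O.wt (restr (· ∈ O.Y) μ) τ) (c : ℕ) :
    HasSum (fun M : O.classesD m₀ c => MarkingClass.weight μ (M : MarkingClass O.Y))
      (O.classSum μ m₀ c) := by
  unfold classSum
  by_cases hc : O.Feasible m₀ c
  · rw [if_pos hc]
    refine O.hasSum_classesD hm₀ hc μ ?_
    rw [show O.goodTerm μ (O.invConst (O.N - 1) m₀) c = fun x => _ from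
      funext fun x => O.goodTerm_eq μ _ c x]
    refine (summable_term hμ _).hasSum.sub (hasSum_sum fun s _ => ?_)
    by_cases hcs : c ≤ s
    · simp only [if_pos hcs]
      exact O.hasSum_badTerm hμ _ c s
    · simp only [if_neg hcs]
      exact hasSum_zero
  · rw [if_neg hc]
    have : IsEmpty (O.classesD m₀ c) :=
      ⟨fun M => hc ((O.mem_classesD_iff hm₀ M.1).1 M.2).2.1⟩
    exact hasSum_empty

end OpenPi3

end


noncomputable section

namespace RealRAM

/-! ### The program

The right-hand side `phN` fills the array `N`, and the lemma `eqnN` is the resulting equation. -/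

namespace IExpr

/-- A cell of a one-dimensional array. -/
def get1 (a : ℕ) (e : IExpr) : IExpr := read a 1 ![e]

/-- A cell of a two-dimensional array. -/
def get2 (a : ℕ) (e₁ e₂ : IExpr) : IExpr := read a 2 ![e₁, e₂]

/-- A cell of a three-dimensional array. -/
def get3 (a : ℕ) (e₁ e₂ e₃ : IExpr) : IExpr := read a 3 ![e₁, e₂, e₃]

/-- The predecessor. -/
def pred (e : IExpr) : IExpr := sub e (const 1)

/-- The successor. -/
def succ (e : IExpr) : IExpr := add e (const 1)

/-- The double. -/
def dbl (e : IExpr) : IExpr := add e e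

variable (s : State)

lemma eval_get1 (a : ℕ) (e : IExpr) : (get1 a e).eval s = s.ints a [e.eval s] := by
  simp [get1, eval]

lemma eval_get2 (a : ℕ) (e₁ e₂ : IExpr) :
    (get2 a e₁ e₂).eval s = s.ints a [e₁.eval s, e₂.eval s] := by
  simp [get2, eval, List.ofFn_succ]

lemma eval_get3 (a : ℕ) (e₁ e₂ e₃ : IExpr) :
    (get3 a e₁ e₂ e₃).eval s = s.ints a [e₁.eval s, e₂.eval s, e₃.eval s] := by
  simp [get3, eval, List.ofFn_succ]

lemma eval_pred (e : IExpr) : (pred e).eval s = e.eval s - 1 := by simp [pred, eval]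

lemma eval_succ (e : IExpr) : (succ e).eval s = e.eval s + 1 := by simp [succ, eval]

lemma eval_dbl (e : IExpr) : (dbl e).eval s = e.eval s + e.eval s := by simp [dbl, eval]

end IExpr

namespace RExpr

/-- A scalar real variable. -/
def var (a : ℕ) : RExpr := read a 0 Fin.elim0

/-- A cell of a one-dimensional array. -/
def get1 (a : ℕ) (e : IExpr) : RExpr := read a 1 ![e]

/-- A cell of a two-dimensional array. -/
def get2 (a : ℕ) (e₁ e₂ : IExpr) : RExpr := read a 2 ![e₁, e₂]

/-- A cell of a three-dimensional array. -/
def get3 (a : ℕ) (e₁ e₂ e₃ : IExpr) : RExpr := read a 3 ![e₁, e₂, e₃]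

/-- A cell of a four-dimensional array. -/
def get4 (a : ℕ) (e₁ e₂ e₃ e₄ : IExpr) : RExpr := read a 4 ![e₁, e₂, e₃, e₄]

/-- A cell of a five-dimensional array. -/
def get5 (a : ℕ) (e₁ e₂ e₃ e₄ e₅ : IExpr) : RExpr := read a 5 ![e₁, e₂, e₃, e₄, e₅]

variable (s : State)

lemma eval_var (a : ℕ) : (var a).eval s = s.reals a [] := by simp [var, eval]

lemma eval_get1 (a : ℕ) (e : IExpr) : (get1 a e).eval s = s.reals a [e.eval s] := by
  simp [get1, eval]

lemma eval_get2 (a : ℕ) (e₁ e₂ : IExpr) :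
    (get2 a e₁ e₂).eval s = s.reals a [e₁.eval s, e₂.eval s] := by
  simp [get2, eval, List.ofFn_succ]

lemma eval_get3 (a : ℕ) (e₁ e₂ e₃ : IExpr) :
    (get3 a e₁ e₂ e₃).eval s = s.reals a [e₁.eval s, e₂.eval s, e₃.eval s] := by
  simp [get3, eval, List.ofFn_succ]

lemma eval_get4 (a : ℕ) (e₁ e₂ e₃ e₄ : IExpr) :
    (get4 a e₁ e₂ e₃ e₄).eval s = s.reals a [e₁.eval s, e₂.eval s, e₃.eval s, e₄.eval s] := by
  simp [get4, eval, List.ofFn_succ]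

lemma eval_get5 (a : ℕ) (e₁ e₂ e₃ e₄ e₅ : IExpr) : (get5 a e₁ e₂ e₃ e₄ e₅).eval s =
    s.reals a [e₁.eval s, e₂.eval s, e₃.eval s, e₄.eval s, e₅.eval s] := by
  simp [get5, eval, List.ofFn_succ]

end RExpr

/-- The test for equality. -/
def Test.eqInt (e₁ e₂ : IExpr) : Test := Test.and (Test.leInt e₁ e₂) (Test.leInt e₂ e₁)

lemma Test.holds_eqInt (s : State) (e₁ e₂ : IExpr) :
    (Test.eqInt e₁ e₂).Holds s ↔ e₁.eval s = e₂.eval s := by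
  simp only [eqInt, Holds]
  exact ⟨fun h => le_antisymm h.1 h.2, fun h => ⟨h.le, h.ge⟩⟩

/-- The test `e₁ < e₂`. -/
def Test.ltInt (e₁ e₂ : IExpr) : Test := Test.not (Test.leInt e₂ e₁)

lemma Test.holds_ltInt (s : State) (e₁ e₂ : IExpr) :
    (Test.ltInt e₁ e₂).Holds s ↔ e₁.eval s < e₂.eval s := by
  simp [ltInt, Holds]

/-- The intermediate state differs from the final one only in ways that the right-hand side does not
see: the right-hand sides read earlier arrays, the counters, and smaller addresses of their own
array. -/
lemma Phase.Ok.int_eqn {bs : List ℕ} {t : ITree} {a : ℕ} {s : State}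
    (h : (Phase.mk bs (Rhs.int t)).Ok a s) {l : List ℤ} (hl : l ∈ boxList (bs.map s.bound)) :
    ∃ tmp : State, tmp.addr bs.length = l ∧ (∀ a' < a, tmp.ints a' = s.ints a') ∧
      (∀ l' < l, tmp.ints a l' = s.ints a l') ∧ s.ints a l = t.eval tmp := by
  obtain ⟨tmp, h1, h2, h3, h4⟩ := h.2 l hl
  refine ⟨tmp, h1, fun a' ha' => State.ints_of_cell (h2 a' ha'),
    fun l' hl' => congrArg Prod.fst (h3 l' (Or.inr hl')), congrArg Prod.fst h4⟩

lemma Phase.Ok.real_eqn {bs : List ℕ} {t : RTree} {a : ℕ} {s : State}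
    (h : (Phase.mk bs (Rhs.real t)).Ok a s) {l : List ℤ} (hl : l ∈ boxList (bs.map s.bound)) :
    ∃ tmp : State, tmp.addr bs.length = l ∧ (∀ a' < a, tmp.ints a' = s.ints a') ∧
      (∀ a' < a, tmp.reals a' = s.reals a') ∧
      (∀ l' < l, tmp.reals a l' = s.reals a l') ∧ s.reals a l = t.eval tmp := by
  obtain ⟨tmp, h1, h2, h3, h4⟩ := h.2 l hl
  refine ⟨tmp, h1, fun a' ha' => State.ints_of_cell (h2 a' ha'),
    fun a' ha' => State.reals_of_cell (h2 a' ha'),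
    fun l' hl' => congrArg Prod.snd (h3 l' (Or.inr hl')), congrArg Prod.snd h4⟩

lemma Phase.Ok.reals_eq_zero {p : Phase} {a : ℕ} {s : State} (h : p.Ok a s) {l : List ℤ}
    (hl : l ∉ p.box s) : s.reals a l = 0 :=
  congrArg Prod.snd (h.1 l hl)

open IExpr

local notation "x₀" => ctr 0
local notation "x₁" => ctr 1
local notation "x₂" => ctr 2
local notation "x₃" => ctr 3
local notation "x₄" => ctr 4

/-- The number of places of the open net. -/
def nE : IExpr := var 0

/-- The potential of a place. -/
def potE (p : IExpr) : IExpr := get2 19 p (var 1)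

/-- The potential of the deleted place. -/
def extE : IExpr := potE nE

/-- The maximal potential of the last but one layer. -/
def maxE : IExpr := get1 20 nE

/-- The last layer. -/
def lastE : IExpr := var 2

/-- The offset of the tables indexed by an integer. -/
def offE : IExpr := var 16

/-- A value of a partition function. -/
def partE (σ K : IExpr) : RExpr :=
  RExpr.mul (RExpr.get2 26 σ nE) (RExpr.get5 31 σ nE nE (add K offE) offE)

/-- The bound for the loops that add up the input. -/
def ph10 : ITree := .leaf (add (add nE (var 1)) (const 3))

/-- The partial sums of the columns of the backward incidence matrix. -/
def ph11 : ITree := .ite (.leInt x₁ (const 0)) (.leaf (const 0))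
  (.leaf (add (get2 11 x₀ (pred x₁)) (get2 6 (pred x₁) x₀)))

/-- The partial sums of the column sums. -/
def ph12 : ITree := .ite (.leInt x₀ (const 0)) (.leaf (const 0))
  (.leaf (add (get1 12 (pred x₀)) (get2 11 (pred x₀) (succ nE))))

/-- The partial sums of the initial marking. -/
def ph13 : ITree := .ite (.leInt x₀ (const 0)) (.leaf (const 0))
  (.leaf (add (get1 13 (pred x₀)) (get1 5 (pred x₀))))

/-- A strict upper bound for the numbers occurring in the net. -/
def ph14 : ITree := .leaf
  (add (add (get1 12 (var 1)) (get1 13 nE)) (add (add nE (var 1)) (add (var 3) (const 3))))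

/-- The multiplication table. -/
def ph15 : ITree := .ite (.leInt x₁ (const 0)) (.leaf (const 0))
  (.leaf (add (get2 15 x₀ (pred x₁)) x₀))

/-- The offset of the tables indexed by an integer. -/
def ph16 : ITree := .leaf (dbl (dbl (dbl (get2 15 (pred (var 14)) (pred (var 14))))))

/-- The bound for the remaining loops. -/
def ph17 : ITree := .leaf (add offE (dbl offE))

/-- The partial sums of the tokens that a transition consumes in the layer after that of a place. -/
def ph18 : ITree := .ite (.leInt x₂ (const 0)) (.leaf (const 0))
  (.ite (.eqInt (get1 4 (pred x₂)) (succ (get1 4 x₀)))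
    (.leaf (add (get3 18 x₀ x₁ (pred x₂)) (get2 6 (pred x₂) x₁)))
    (.leaf (get3 18 x₀ x₁ (pred x₂))))

/-- The potential of a place, found by looking for a transition that consumes the bag of the place. -/
def ph19 : ITree := .ite (.leInt x₁ (const 0)) (.leaf (const 0))
  (.ite (.and (.leInt (const 1) (get2 6 x₀ (pred x₁)))
      (.leInt (get3 18 x₀ (pred x₁) (succ nE)) (const 0)))
    (.leaf (pred (get2 11 (pred x₁) (succ nE))))
    (.leaf (get2 19 x₀ (pred x₁))))

/-- The partial maxima of the potentials in the last but one layer. -/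
def ph20 : ITree := .ite (.leInt x₀ (const 0)) (.leaf (const 0))
  (.ite (.and (.eqInt (get1 4 (pred x₀)) (pred lastE))
      (.leInt (get1 20 (pred x₀)) (potE (pred x₀))))
    (.leaf (potE (pred x₀)))
    (.leaf (get1 20 (pred x₀))))

/-- The partial sums of the invariant of the last two layers. -/
def ph21 : ITree := .ite (.leInt x₀ (const 0)) (.leaf (const 0))
  (.ite (.eqInt (get1 4 (pred x₀)) (pred lastE))
    (.leaf (add (get1 21 (pred x₀)) (get1 5 (pred x₀))))
    (.ite (.eqInt (get1 4 (pred x₀)) lastE)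
      (.leaf (add (get1 21 (pred x₀)) (sub (get2 15 (get1 5 (pred x₀)) extE)
        (get2 15 (get1 5 (pred x₀)) (potE (pred x₀))))))
      (.leaf (get1 21 (pred x₀)))))

/-- The partial sums of the invariant of the two layers before the last. -/
def ph22 : ITree := .ite (.leInt x₀ (const 0)) (.leaf (const 0))
  (.ite (.eqInt (get1 4 (pred x₀)) (pred (pred lastE)))
    (.leaf (add (get1 22 (pred x₀)) (get1 5 (pred x₀))))
    (.ite (.eqInt (get1 4 (pred x₀)) (pred lastE))
      (.leaf (add (get1 22 (pred x₀)) (sub (get2 15 (get1 5 (pred x₀)) maxE)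
        (get2 15 (get1 5 (pred x₀)) (potE (pred x₀))))))
      (.leaf (get1 22 (pred x₀)))))

/-- Whether one of the first places witnesses the feasibility of the constant `c`. -/
def ph23 : ITree := .ite (.leInt x₀ (const 0)) (.leaf (const 0))
  (.ite (.and (.eqInt (get1 4 (pred x₀)) (pred lastE)) (.and (.ltInt (potE (pred x₀)) maxE)
      (.leInt (add (sub (get2 15 (pred (var 3)) maxE) (get2 15 (pred (var 3)) (potE (pred x₀))))
        maxE) (get1 22 nE))))
    (.leaf (const 1))
    (.leaf (get1 23 (pred x₀))))

/-- The weight of a place. -/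
def ph24 : ITree := .ite (.eqInt (get1 4 x₀) lastE) (.leaf (sub extE (potE x₀))) (.leaf (const 1))

/-- The constants of the places, restricted to the places of the last layer of potential greater than
the row number, to the places of `Y`, or to the places of maximal potential in the last but one
layer. -/
def ph25 : RTree := .ite (.eqInt (get1 4 x₁) lastE)
  (.ite (.ltInt x₀ extE)
    (.ite (.ltInt x₀ (potE x₁)) (.leaf (.get1 0 x₁)) (.leaf (.const 0)))
    (.ite (.leInt x₀ extE) (.leaf (.get1 0 x₁)) (.leaf (.const 0))))
  (.ite (.and (.leInt extE x₀) (.and (.eqInt (get1 4 x₁) (pred lastE)) (.eqInt (potE x₁) maxE)))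
    (.leaf (.get1 0 x₁)) (.leaf (.const 0)))

/-- The contribution of the places of weight zero to the partition function. -/
def ph26 : RTree := .ite (.leInt x₁ (const 0)) (.leaf (.const 1))
  (.ite (.eqInt (get1 24 (pred x₁)) (const 0))
    (.leaf (.div (.get2 26 x₀ (pred x₁)) (.sub (.const 1) (.get2 25 x₀ (pred x₁)))))
    (.leaf (.get2 26 x₀ (pred x₁))))

/-- The positions of the walk with the weights of two places of opposite signs. -/
def ph27 : ITree := .ite (.leInt x₂ (const 0)) (.leaf (const 0))
  (.ite (.leInt (const 0) (get3 27 x₀ x₁ (pred x₂)))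
    (.leaf (sub (get3 27 x₀ x₁ (pred x₂)) (get1 24 (pred x₀))))
    (.leaf (sub (get3 27 x₀ x₁ (pred x₂)) (get1 24 (pred x₁)))))

/-- The products of the constants along the walk. -/
def ph28 : RTree := .ite (.leInt x₃ (const 0)) (.leaf (.const 1))
  (.ite (.leInt (const 0) (get3 27 x₁ x₂ (pred x₃)))
    (.leaf (.mul (.get4 28 x₀ x₁ x₂ (pred x₃)) (.get2 25 x₀ (pred x₁))))
    (.leaf (.mul (.get4 28 x₀ x₁ x₂ (pred x₃)) (.get2 25 x₀ (pred x₂)))))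

/-- The partition functions of the places of positive weight. -/
def ph29 : RTree := .ite (.leInt x₁ (const 0))
  (.ite (.eqInt x₂ offE) (.leaf (.const 1)) (.leaf (.const 0)))
  (.ite (.ltInt (const 0) (get1 24 (pred x₁)))
    (.leaf (.add (.get3 29 x₀ (pred x₁) x₂) (.mul (.get2 25 x₀ (pred x₁))
      (.get3 29 x₀ x₁ (sub x₂ (get1 24 (pred x₁)))))))
    (.leaf (.get3 29 x₀ (pred x₁) x₂)))

/-- The partition functions of the places of negative weight. -/
def ph30 : RTree := .ite (.leInt x₁ (const 0))
  (.ite (.eqInt x₂ offE) (.leaf (.const 1)) (.leaf (.const 0)))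
  (.ite (.ltInt (get1 24 (pred x₁)) (const 0))
    (.leaf (.add (.get3 30 x₀ (pred x₁) x₂) (.mul (.get2 25 x₀ (pred x₁))
      (.get3 30 x₀ x₁ (add x₂ (get1 24 (pred x₁)))))))
    (.leaf (.get3 30 x₀ (pred x₁) x₂)))

/-- The partition functions of the first places of positive weight and the first places of negative
weight; the last index runs along the walk. -/
def ph31 : RTree := .ite (.leInt x₁ (const 0)) (.leaf (.get3 30 x₀ x₂ (sub (dbl offE) x₃)))
  (.ite (.leInt x₂ (const 0)) (.leaf (.get3 29 x₀ x₁ x₃))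
  (.ite (.leInt (get1 24 (pred x₁)) (const 0)) (.leaf (.get5 31 x₀ (pred x₁) x₂ x₃ offE))
  (.ite (.leInt (const 0) (get1 24 (pred x₂))) (.leaf (.get5 31 x₀ x₁ (pred x₂) x₃ offE))
  (.ite (.leInt x₄ (const 0)) (.leaf (.const 0))
  (.ite (.leInt x₄ (sub (get1 24 (pred x₁)) (get1 24 (pred x₂))))
    (.ite (.leInt (const 0) (get3 27 x₁ x₂ (pred x₄)))
      (.leaf (.add (.get5 31 x₀ x₁ x₂ x₃ (pred x₄)) (.mul (.get4 28 x₀ x₁ x₂ (pred x₄))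
        (.get5 31 x₀ (pred x₁) x₂ (add x₃ (get3 27 x₁ x₂ (pred x₄))) offE))))
      (.leaf (.add (.get5 31 x₀ x₁ x₂ x₃ (pred x₄)) (.mul (.get4 28 x₀ x₁ x₂ (pred x₄))
        (.get5 31 x₀ x₁ (pred x₂) (add x₃ (get3 27 x₁ x₂ (pred x₄))) offE)))))
  (.ite (.leInt x₄ (succ (sub (get1 24 (pred x₁)) (get1 24 (pred x₂)))))
    (.leaf (.div (.get5 31 x₀ x₁ x₂ x₃ (pred x₄))
      (.sub (.const 1) (.get4 28 x₀ x₁ x₂ (pred x₄)))))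
    (.leaf (.get5 31 x₀ x₁ x₂ x₃ (pred x₄)))))))))

/-- The partial sums of the contributions of the classes in which the last layer is not active. -/
def ph32 : RTree := .ite (.leInt x₀ (const 0)) (.leaf (.const 0))
  (.ite (.and (.leInt (var 3) (pred x₀)) (.leInt x₀ extE))
    (.leaf (.add (.get1 32 (pred x₀)) (.mul (partE (succ extE) (sub (pred x₀) (var 3)))
      (partE (pred x₀) (sub (get1 21 nE) (pred x₀))))))
    (.leaf (.get1 32 (pred x₀))))

/-- The result. -/
def ph33 : RTree :=
  .ite (.and (.not (.leInt (var 3) (const 0))) (.leInt (get1 23 nE) (const 0))) (.leaf (.const 0))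
    (.leaf (.sub (partE extE (sub (get1 21 nE) (var 3))) (.get1 32 extE)))

/-- The phases of the program. -/
def phases : List Phase := [
  ⟨[], .int ph10⟩, ⟨[10, 10], .int ph11⟩, ⟨[10], .int ph12⟩, ⟨[10], .int ph13⟩, ⟨[], .int ph14⟩,
  ⟨[14, 14], .int ph15⟩, ⟨[], .int ph16⟩, ⟨[], .int ph17⟩, ⟨[17, 17, 17], .int ph18⟩,
  ⟨[17, 17], .int ph19⟩, ⟨[17], .int ph20⟩, ⟨[17], .int ph21⟩, ⟨[17], .int ph22⟩,
  ⟨[17], .int ph23⟩, ⟨[17], .int ph24⟩, ⟨[17, 17], .real ph25⟩, ⟨[17, 17], .real ph26⟩,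
  ⟨[17, 17, 17], .int ph27⟩, ⟨[17, 17, 17, 17], .real ph28⟩, ⟨[17, 17, 17], .real ph29⟩,
  ⟨[17, 17, 17], .real ph30⟩, ⟨[17, 17, 17, 17, 17], .real ph31⟩, ⟨[17], .real ph32⟩,
  ⟨[], .real ph33⟩]

/-- The program. -/
def program : Prog :=
  Prog.seq (phasesProg 10 phases) (Prog.setReal 1 0 Fin.elim0 (RExpr.var 33))

/-! ### Recurrences satisfied by the final memory -/

section Equations

variable {s : State}

lemma eqn10 (h : (Phase.mk [] (.int ph10)).Ok 10 s) :
    s.ints 10 [] = s.ints 0 [] + s.ints 1 [] + 3 := by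
  obtain ⟨tmp, h1, h2, h3, h4⟩ := h.int_eqn (l := []) (by simp)
  rw [h4]
  simp [ph10, ITree.eval, IExpr.eval, nE, h2]

lemma eqn11 (h : (Phase.mk [10, 10] (.int ph11)).Ok 11 s) {x y : ℤ} (hx : 0 ≤ x)
    (hx' : x < s.bound 10) (hy : 0 ≤ y) (hy' : y < s.bound 10) :
    s.ints 11 [x, y] = if y ≤ 0 then 0 else s.ints 11 [x, y - 1] + s.ints 6 [y - 1, x] := by
  obtain ⟨tmp, h1, h2, h3, h4⟩ := h.int_eqn (l := [x, y]) (by simp [*])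
  simp [State.addr, List.ofFn_succ] at h1
  rw [h4]
  simp [ph11, ITree.eval, IExpr.eval, Test.Holds, eval_get2, eval_pred, h1, h2, h3,
    List.cons_lt_cons_iff]

/-- Every cell of array 31 on the right has a smaller i, a smaller j, or a smaller y. The column may
move either way along the walk, but only together with a decrease of i or j, which come first in the
order. -/
lemma eqn31 (h : (Phase.mk [17, 17, 17, 17, 17] (.real ph31)).Ok 31 s) {σ i j x y : ℤ}
    (h0 : 0 ≤ σ ∧ σ < s.bound 17) (h1 : 0 ≤ i ∧ i < s.bound 17) (h2 : 0 ≤ j ∧ j < s.bound 17)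
    (h3 : 0 ≤ x ∧ x < s.bound 17) (h4 : 0 ≤ y ∧ y < s.bound 17) :
    s.reals 31 [σ, i, j, x, y] =
      if i ≤ 0 then s.reals 30 [σ, j, s.ints 16 [] + s.ints 16 [] - x] else
      if j ≤ 0 then s.reals 29 [σ, i, x] else
      if s.ints 24 [i - 1] ≤ 0 then s.reals 31 [σ, i - 1, j, x, s.ints 16 []] else
      if 0 ≤ s.ints 24 [j - 1] then s.reals 31 [σ, i, j - 1, x, s.ints 16 []] else
      if y ≤ 0 then 0 else
      if y ≤ s.ints 24 [i - 1] - s.ints 24 [j - 1] then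
        if 0 ≤ s.ints 27 [i, j, y - 1] then
          s.reals 31 [σ, i, j, x, y - 1] + s.reals 28 [σ, i, j, y - 1] *
            s.reals 31 [σ, i - 1, j, x + s.ints 27 [i, j, y - 1], s.ints 16 []]
        else
          s.reals 31 [σ, i, j, x, y - 1] + s.reals 28 [σ, i, j, y - 1] *
            s.reals 31 [σ, i, j - 1, x + s.ints 27 [i, j, y - 1], s.ints 16 []] else
      if y ≤ s.ints 24 [i - 1] - s.ints 24 [j - 1] + 1 then
        s.reals 31 [σ, i, j, x, y - 1] / (1 - s.reals 28 [σ, i, j, y - 1])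
      else s.reals 31 [σ, i, j, x, y - 1] := by
  obtain ⟨tmp, t1, t2, t2', t3, t4⟩ := h.real_eqn (l := [σ, i, j, x, y]) (by simp [*])
  simp [State.addr, List.ofFn_succ] at t1
  rw [t4]
  simp [ph31, RTree.eval, RExpr.eval, IExpr.eval, Test.Holds, eval_get1, eval_get3, eval_pred,
    eval_succ, eval_dbl, RExpr.eval_get3, RExpr.eval_get4, RExpr.eval_get5, offE, t1, t2, t2', t3,
    List.cons_lt_cons_iff]

lemma eqn12 (h : (Phase.mk [10] (.int ph12)).Ok 12 s) {x : ℤ} (hx : 0 ≤ x ∧ x < s.bound 10) :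
    s.ints 12 [x] = if x ≤ 0 then 0 else
      s.ints 12 [x - 1] + s.ints 11 [x - 1, s.ints 0 [] + 1] := by
  obtain ⟨tmp, h1, h2, h3, h4⟩ := h.int_eqn (l := [x]) (by simp [*])
  simp [State.addr, List.ofFn_succ] at h1
  rw [h4]
  simp [ph12, ITree.eval, IExpr.eval, Test.Holds, eval_get1, eval_get2, eval_pred, eval_succ, nE,
    h1, h2, h3, List.cons_lt_cons_iff]

lemma eqn13 (h : (Phase.mk [10] (.int ph13)).Ok 13 s) {x : ℤ} (hx : 0 ≤ x ∧ x < s.bound 10) :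
    s.ints 13 [x] = if x ≤ 0 then 0 else s.ints 13 [x - 1] + s.ints 5 [x - 1] := by
  obtain ⟨tmp, h1, h2, h3, h4⟩ := h.int_eqn (l := [x]) (by simp [*])
  simp [State.addr, List.ofFn_succ] at h1
  rw [h4]
  simp [ph13, ITree.eval, IExpr.eval, Test.Holds, eval_get1, eval_pred,
    h1, h2, h3, List.cons_lt_cons_iff]

lemma eqn14 (h : (Phase.mk [] (.int ph14)).Ok 14 s) :
    s.ints 14 [] = s.ints 12 [s.ints 1 []] + s.ints 13 [s.ints 0 []] +
      (s.ints 0 [] + s.ints 1 [] + (s.ints 3 [] + 3)) := by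
  obtain ⟨tmp, h1, h2, h3, h4⟩ := h.int_eqn (l := []) (by simp)
  rw [h4]
  simp [ph14, ITree.eval, IExpr.eval, eval_get1, nE, h2]

lemma eqn15 (h : (Phase.mk [14, 14] (.int ph15)).Ok 15 s) {x y : ℤ}
    (hx : 0 ≤ x ∧ x < s.bound 14) (hy : 0 ≤ y ∧ y < s.bound 14) :
    s.ints 15 [x, y] = if y ≤ 0 then 0 else s.ints 15 [x, y - 1] + x := by
  obtain ⟨tmp, h1, h2, h3, h4⟩ := h.int_eqn (l := [x, y]) (by simp [*])
  simp [State.addr, List.ofFn_succ] at h1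
  rw [h4]
  simp [ph15, ITree.eval, IExpr.eval, Test.Holds, eval_get2, eval_pred, h1, h3,
    List.cons_lt_cons_iff]

lemma eqn16 (h : (Phase.mk [] (.int ph16)).Ok 16 s) :
    s.ints 16 [] = 8 * s.ints 15 [s.ints 14 [] - 1, s.ints 14 [] - 1] := by
  obtain ⟨tmp, h1, h2, h3, h4⟩ := h.int_eqn (l := []) (by simp)
  rw [h4]
  simp only [ph16, ITree.eval, eval_dbl, eval_get2, eval_pred, eval_var, h2, Nat.reduceLT]
  ring

lemma eqn17 (h : (Phase.mk [] (.int ph17)).Ok 17 s) : s.ints 17 [] = 3 * s.ints 16 [] := by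
  obtain ⟨tmp, h1, h2, h3, h4⟩ := h.int_eqn (l := []) (by simp)
  rw [h4]
  simp only [ph17, ITree.eval, IExpr.eval, eval_dbl, offE, eval_var, h2, Nat.reduceLT]
  ring

lemma eqn18 (h : (Phase.mk [17, 17, 17] (.int ph18)).Ok 18 s) {x y z : ℤ}
    (hx : 0 ≤ x ∧ x < s.bound 17) (hy : 0 ≤ y ∧ y < s.bound 17) (hz : 0 ≤ z ∧ z < s.bound 17) :
    s.ints 18 [x, y, z] = if z ≤ 0 then 0 else
      if s.ints 4 [z - 1] = s.ints 4 [x] + 1 then s.ints 18 [x, y, z - 1] + s.ints 6 [z - 1, y]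
      else s.ints 18 [x, y, z - 1] := by
  obtain ⟨tmp, h1, h2, h3, h4⟩ := h.int_eqn (l := [x, y, z]) (by simp [*])
  simp [State.addr, List.ofFn_succ] at h1
  rw [h4]
  simp [ph18, ITree.eval, IExpr.eval, Test.Holds, Test.holds_eqInt, eval_get1, eval_get2, eval_get3,
    eval_pred, eval_succ, h1, h2, h3, List.cons_lt_cons_iff]

lemma eqn19 (h : (Phase.mk [17, 17] (.int ph19)).Ok 19 s) {x y : ℤ}
    (hx : 0 ≤ x ∧ x < s.bound 17) (hy : 0 ≤ y ∧ y < s.bound 17) :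
    s.ints 19 [x, y] = if y ≤ 0 then 0 else
      if 1 ≤ s.ints 6 [x, y - 1] ∧ s.ints 18 [x, y - 1, s.ints 0 [] + 1] ≤ 0 then
        s.ints 11 [y - 1, s.ints 0 [] + 1] - 1
      else s.ints 19 [x, y - 1] := by
  obtain ⟨tmp, h1, h2, h3, h4⟩ := h.int_eqn (l := [x, y]) (by simp [*])
  simp [State.addr, List.ofFn_succ] at h1
  rw [h4]
  simp [ph19, ITree.eval, IExpr.eval, Test.Holds, eval_get2, eval_get3, eval_pred, eval_succ, nE,
    h1, h2, h3, List.cons_lt_cons_iff]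

lemma eqn20 (h : (Phase.mk [17] (.int ph20)).Ok 20 s) {x : ℤ} (hx : 0 ≤ x ∧ x < s.bound 17) :
    s.ints 20 [x] = if x ≤ 0 then 0 else
      if s.ints 4 [x - 1] = s.ints 2 [] - 1 ∧ s.ints 20 [x - 1] ≤ s.ints 19 [x - 1, s.ints 1 []]
      then s.ints 19 [x - 1, s.ints 1 []] else s.ints 20 [x - 1] := by
  obtain ⟨tmp, h1, h2, h3, h4⟩ := h.int_eqn (l := [x]) (by simp [*])
  simp [State.addr, List.ofFn_succ] at h1
  rw [h4]
  simp [ph20, ITree.eval, IExpr.eval, Test.Holds, Test.holds_eqInt, eval_get1, eval_get2, eval_pred,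
    potE, lastE, h1, h2, h3, List.cons_lt_cons_iff]

lemma eqn21 (h : (Phase.mk [17] (.int ph21)).Ok 21 s) {x : ℤ} (hx : 0 ≤ x ∧ x < s.bound 17) :
    s.ints 21 [x] = if x ≤ 0 then 0 else
      if s.ints 4 [x - 1] = s.ints 2 [] - 1 then s.ints 21 [x - 1] + s.ints 5 [x - 1] else
      if s.ints 4 [x - 1] = s.ints 2 [] then s.ints 21 [x - 1] +
        (s.ints 15 [s.ints 5 [x - 1], s.ints 19 [s.ints 0 [], s.ints 1 []]] -
          s.ints 15 [s.ints 5 [x - 1], s.ints 19 [x - 1, s.ints 1 []]])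
      else s.ints 21 [x - 1] := by
  obtain ⟨tmp, h1, h2, h3, h4⟩ := h.int_eqn (l := [x]) (by simp [*])
  simp [State.addr, List.ofFn_succ] at h1
  rw [h4]
  simp [ph21, ITree.eval, IExpr.eval, Test.Holds, Test.holds_eqInt, eval_get1, eval_get2, eval_pred,
    potE, lastE, extE, nE, h1, h2, h3, List.cons_lt_cons_iff]

lemma eqn22 (h : (Phase.mk [17] (.int ph22)).Ok 22 s) {x : ℤ} (hx : 0 ≤ x ∧ x < s.bound 17) :
    s.ints 22 [x] = if x ≤ 0 then 0 else
      if s.ints 4 [x - 1] = s.ints 2 [] - 1 - 1 then s.ints 22 [x - 1] + s.ints 5 [x - 1] else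
      if s.ints 4 [x - 1] = s.ints 2 [] - 1 then s.ints 22 [x - 1] +
        (s.ints 15 [s.ints 5 [x - 1], s.ints 20 [s.ints 0 []]] -
          s.ints 15 [s.ints 5 [x - 1], s.ints 19 [x - 1, s.ints 1 []]])
      else s.ints 22 [x - 1] := by
  obtain ⟨tmp, h1, h2, h3, h4⟩ := h.int_eqn (l := [x]) (by simp [*])
  simp [State.addr, List.ofFn_succ] at h1
  rw [h4]
  simp [ph22, ITree.eval, IExpr.eval, Test.Holds, Test.holds_eqInt, eval_get1, eval_get2, eval_pred,
    potE, lastE, maxE, nE, h1, h2, h3, List.cons_lt_cons_iff]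

lemma eqn23 (h : (Phase.mk [17] (.int ph23)).Ok 23 s) {x : ℤ} (hx : 0 ≤ x ∧ x < s.bound 17) :
    s.ints 23 [x] = if x ≤ 0 then 0 else
      if s.ints 4 [x - 1] = s.ints 2 [] - 1 ∧
        s.ints 19 [x - 1, s.ints 1 []] < s.ints 20 [s.ints 0 []] ∧
        s.ints 15 [s.ints 3 [] - 1, s.ints 20 [s.ints 0 []]] -
          s.ints 15 [s.ints 3 [] - 1, s.ints 19 [x - 1, s.ints 1 []]] + s.ints 20 [s.ints 0 []] ≤
            s.ints 22 [s.ints 0 []] then 1 else s.ints 23 [x - 1] := by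
  obtain ⟨tmp, h1, h2, h3, h4⟩ := h.int_eqn (l := [x]) (by simp [*])
  simp [State.addr, List.ofFn_succ] at h1
  rw [h4]
  simp [ph23, ITree.eval, IExpr.eval, Test.Holds, Test.holds_eqInt, Test.holds_ltInt, eval_get1,
    eval_get2, eval_pred, potE, lastE, maxE, nE, h1, h2, h3, List.cons_lt_cons_iff]

lemma eqn24 (h : (Phase.mk [17] (.int ph24)).Ok 24 s) {x : ℤ} (hx : 0 ≤ x ∧ x < s.bound 17) :
    s.ints 24 [x] = if s.ints 4 [x] = s.ints 2 [] then
      s.ints 19 [s.ints 0 [], s.ints 1 []] - s.ints 19 [x, s.ints 1 []] else 1 := by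
  obtain ⟨tmp, h1, h2, h3, h4⟩ := h.int_eqn (l := [x]) (by simp [*])
  simp [State.addr, List.ofFn_succ] at h1
  rw [h4]
  simp [ph24, ITree.eval, IExpr.eval, Test.holds_eqInt, eval_get1, eval_get2,
    potE, lastE, extE, nE, h1, h2]

lemma eqn25 (h : (Phase.mk [17, 17] (.real ph25)).Ok 25 s) {σ x : ℤ}
    (hσ : 0 ≤ σ ∧ σ < s.bound 17) (hx : 0 ≤ x ∧ x < s.bound 17) :
    s.reals 25 [σ, x] =
      if s.ints 4 [x] = s.ints 2 [] then
        if σ < s.ints 19 [s.ints 0 [], s.ints 1 []] then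
          if σ < s.ints 19 [x, s.ints 1 []] then s.reals 0 [x] else 0
        else if σ ≤ s.ints 19 [s.ints 0 [], s.ints 1 []] then s.reals 0 [x] else 0
      else if s.ints 19 [s.ints 0 [], s.ints 1 []] ≤ σ ∧ s.ints 4 [x] = s.ints 2 [] - 1 ∧
        s.ints 19 [x, s.ints 1 []] = s.ints 20 [s.ints 0 []] then s.reals 0 [x] else 0 := by
  obtain ⟨tmp, t1, t2, t2', t3, t4⟩ := h.real_eqn (l := [σ, x]) (by simp [*])
  simp [State.addr, List.ofFn_succ] at t1
  rw [t4]
  simp [ph25, RTree.eval, RExpr.eval, Test.Holds, Test.holds_eqInt, Test.holds_ltInt,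
    eval_get1, eval_get2, eval_pred, RExpr.eval_get1, potE, lastE, extE, maxE, nE, t1, t2, t2']

lemma eqn26 (h : (Phase.mk [17, 17] (.real ph26)).Ok 26 s) {σ x : ℤ}
    (hσ : 0 ≤ σ ∧ σ < s.bound 17) (hx : 0 ≤ x ∧ x < s.bound 17) :
    s.reals 26 [σ, x] = if x ≤ 0 then 1 else
      if s.ints 24 [x - 1] = 0 then s.reals 26 [σ, x - 1] / (1 - s.reals 25 [σ, x - 1])
      else s.reals 26 [σ, x - 1] := by
  obtain ⟨tmp, t1, t2, t2', t3, t4⟩ := h.real_eqn (l := [σ, x]) (by simp [*])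
  simp [State.addr, List.ofFn_succ] at t1
  rw [t4]
  simp [ph26, RTree.eval, RExpr.eval, IExpr.eval, Test.Holds, Test.holds_eqInt,
    eval_get1, eval_pred, RExpr.eval_get2, t1, t2, t2', t3, List.cons_lt_cons_iff]

lemma eqn27 (h : (Phase.mk [17, 17, 17] (.int ph27)).Ok 27 s) {x y z : ℤ}
    (hx : 0 ≤ x ∧ x < s.bound 17) (hy : 0 ≤ y ∧ y < s.bound 17) (hz : 0 ≤ z ∧ z < s.bound 17) :
    s.ints 27 [x, y, z] = if z ≤ 0 then 0 else
      if 0 ≤ s.ints 27 [x, y, z - 1] then s.ints 27 [x, y, z - 1] - s.ints 24 [x - 1]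
      else s.ints 27 [x, y, z - 1] - s.ints 24 [y - 1] := by
  obtain ⟨tmp, h1, h2, h3, h4⟩ := h.int_eqn (l := [x, y, z]) (by simp [*])
  simp [State.addr, List.ofFn_succ] at h1
  rw [h4]
  simp [ph27, ITree.eval, IExpr.eval, Test.Holds, eval_get1, eval_get3, eval_pred,
    h1, h2, h3, List.cons_lt_cons_iff]

lemma eqn28 (h : (Phase.mk [17, 17, 17, 17] (.real ph28)).Ok 28 s) {σ i j x : ℤ}
    (h0 : 0 ≤ σ ∧ σ < s.bound 17) (h1 : 0 ≤ i ∧ i < s.bound 17) (h2 : 0 ≤ j ∧ j < s.bound 17)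
    (h3 : 0 ≤ x ∧ x < s.bound 17) :
    s.reals 28 [σ, i, j, x] = if x ≤ 0 then 1 else
      if 0 ≤ s.ints 27 [i, j, x - 1] then s.reals 28 [σ, i, j, x - 1] * s.reals 25 [σ, i - 1]
      else s.reals 28 [σ, i, j, x - 1] * s.reals 25 [σ, j - 1] := by
  obtain ⟨tmp, t1, t2, t2', t3, t4⟩ := h.real_eqn (l := [σ, i, j, x]) (by simp [*])
  simp [State.addr, List.ofFn_succ] at t1
  rw [t4]
  simp [ph28, RTree.eval, RExpr.eval, IExpr.eval, Test.Holds, eval_get3, eval_pred,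
    RExpr.eval_get2, RExpr.eval_get4, t1, t2, t2', t3, List.cons_lt_cons_iff]

lemma eqn29 (h : (Phase.mk [17, 17, 17] (.real ph29)).Ok 29 s) {σ i x : ℤ}
    (h0 : 0 ≤ σ ∧ σ < s.bound 17) (h1 : 0 ≤ i ∧ i < s.bound 17) (h2 : 0 ≤ x ∧ x < s.bound 17) :
    s.reals 29 [σ, i, x] = if i ≤ 0 then (if x = s.ints 16 [] then 1 else 0) else
      if 0 < s.ints 24 [i - 1] then s.reals 29 [σ, i - 1, x] +
        s.reals 25 [σ, i - 1] * s.reals 29 [σ, i, x - s.ints 24 [i - 1]]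
      else s.reals 29 [σ, i - 1, x] := by
  obtain ⟨tmp, t1, t2, t2', t3, t4⟩ := h.real_eqn (l := [σ, i, x]) (by simp [*])
  simp [State.addr, List.ofFn_succ] at t1
  rw [t4]
  -- Positivity of the weight is what makes the address with column `x - w` smaller.
  by_cases hw : 0 < s.ints 24 [i - 1]
  · simp [ph29, RTree.eval, RExpr.eval, IExpr.eval, Test.Holds, Test.holds_eqInt, Test.holds_ltInt,
      eval_get1, eval_pred, RExpr.eval_get2, RExpr.eval_get3, offE, t1, t2, t2', t3,
      List.cons_lt_cons_iff, hw]
  · simp [ph29, RTree.eval, RExpr.eval, IExpr.eval, Test.Holds, Test.holds_eqInt, Test.holds_ltInt,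
      eval_get1, eval_pred, RExpr.eval_get3, offE, t1, t2, t3,
      List.cons_lt_cons_iff, hw]

lemma eqn30 (h : (Phase.mk [17, 17, 17] (.real ph30)).Ok 30 s) {σ i x : ℤ}
    (h0 : 0 ≤ σ ∧ σ < s.bound 17) (h1 : 0 ≤ i ∧ i < s.bound 17) (h2 : 0 ≤ x ∧ x < s.bound 17) :
    s.reals 30 [σ, i, x] = if i ≤ 0 then (if x = s.ints 16 [] then 1 else 0) else
      if s.ints 24 [i - 1] < 0 then s.reals 30 [σ, i - 1, x] +
        s.reals 25 [σ, i - 1] * s.reals 30 [σ, i, x + s.ints 24 [i - 1]]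
      else s.reals 30 [σ, i - 1, x] := by
  obtain ⟨tmp, t1, t2, t2', t3, t4⟩ := h.real_eqn (l := [σ, i, x]) (by simp [*])
  simp [State.addr, List.ofFn_succ] at t1
  rw [t4]
  by_cases hw : s.ints 24 [i - 1] < 0
  · simp [ph30, RTree.eval, RExpr.eval, IExpr.eval, Test.Holds, Test.holds_eqInt, Test.holds_ltInt,
      eval_get1, eval_pred, RExpr.eval_get2, RExpr.eval_get3, offE, t1, t2, t2', t3,
      List.cons_lt_cons_iff, hw]
  · simp [ph30, RTree.eval, RExpr.eval, IExpr.eval, Test.Holds, Test.holds_eqInt, Test.holds_ltInt,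
      eval_get1, eval_pred, RExpr.eval_get3, offE, t1, t2, t3,
      List.cons_lt_cons_iff, hw]

/-- The product read by `partE`. -/
def partV (s : State) (σ K : ℤ) : ℝ :=
  s.reals 26 [σ, s.ints 0 []] *
    s.reals 31 [σ, s.ints 0 [], s.ints 0 [], K + s.ints 16 [], s.ints 16 []]

lemma eqn32 (h : (Phase.mk [17] (.real ph32)).Ok 32 s) {x : ℤ} (hx : 0 ≤ x ∧ x < s.bound 17) :
    s.reals 32 [x] = if x ≤ 0 then 0 else
      if s.ints 3 [] ≤ x - 1 ∧ x ≤ s.ints 19 [s.ints 0 [], s.ints 1 []] then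
        s.reals 32 [x - 1] +
          partV s (s.ints 19 [s.ints 0 [], s.ints 1 []] + 1) (x - 1 - s.ints 3 []) *
          partV s (x - 1) (s.ints 21 [s.ints 0 []] - (x - 1))
      else s.reals 32 [x - 1] := by
  obtain ⟨tmp, t1, t2, t2', t3, t4⟩ := h.real_eqn (l := [x]) (by simp [*])
  simp [State.addr, List.ofFn_succ] at t1
  rw [t4]
  simp [ph32, RTree.eval, RExpr.eval, IExpr.eval, Test.Holds, eval_get1, eval_get2, eval_pred,
    eval_succ, RExpr.eval_get1, RExpr.eval_get2, RExpr.eval_get5, partE, partV, potE, extE, offE, nE,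
    t1, t2, t2', t3, List.cons_lt_cons_iff]

lemma eqn33 (h : (Phase.mk [] (.real ph33)).Ok 33 s) :
    s.reals 33 [] = if ¬ s.ints 3 [] ≤ 0 ∧ s.ints 23 [s.ints 0 []] ≤ 0 then 0 else
      partV s (s.ints 19 [s.ints 0 [], s.ints 1 []]) (s.ints 21 [s.ints 0 []] - s.ints 3 []) -
        s.reals 32 [s.ints 19 [s.ints 0 [], s.ints 1 []]] := by
  obtain ⟨tmp, t1, t2, t2', t3, t4⟩ := h.real_eqn (l := []) (by simp)
  rw [t4]
  simp [ph33, RTree.eval, RExpr.eval, IExpr.eval, Test.Holds, eval_get1, eval_get2,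
    RExpr.eval_get1, RExpr.eval_get2, RExpr.eval_get5, partE, partV, potE, extE, offE, nE,
    t2, t2']

end Equations

end RealRAM

end


noncomputable section

/-! ### The dynamic programme computes partition functions -/

namespace PartFun

section Allowed

variable {n : ℕ} (w : Fin n → ℤ)

/-- The indices below `i`, `j`, `l` if their weight is positive, negative, zero, respectively. -/
def Allowed (i j l : ℕ) (p : Fin n) : Prop :=
  (0 < w p ∧ (p : ℕ) < i) ∨ (w p < 0 ∧ (p : ℕ) < j) ∨ (w p = 0 ∧ (p : ℕ) < l)

/-- The partition function restricted to the allowed indices. -/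
def partial3 (ν : Fin n → ℝ) (i j l : ℕ) (K : ℤ) : ℝ := part w (restr (Allowed w i j l) ν) K

variable {w} {ν : Fin n → ℝ} {τ : ℝ} (h : Tilted w ν τ)

lemma partial3_congr {i j l i' j' l' : ℕ} (hS : ∀ p, Allowed w i j l p ↔ Allowed w i' j' l' p)
    (K : ℤ) : partial3 w ν i j l K = partial3 w ν i' j' l' K := by
  have : Allowed w i j l = Allowed w i' j' l' := funext fun p => propext (hS p)
  simp only [partial3, this]

lemma val_lt_succ {p q : Fin n} : (q : ℕ) < p + 1 ↔ (q : ℕ) < p ∨ q = p := by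
  rw [Fin.ext_iff]; omega

lemma partial3_succ_left_of_nonpos {p : Fin n} (hp : w p ≤ 0) (j l : ℕ) (K : ℤ) :
    partial3 w ν (p + 1) j l K = partial3 w ν p j l K := by
  refine partial3_congr (fun q => ?_) K
  simp only [Allowed, val_lt_succ]
  by_cases hq : q = p
  · subst hq; omega
  · simp [hq]

lemma partial3_succ_mid_of_nonneg {p : Fin n} (hp : 0 ≤ w p) (i l : ℕ) (K : ℤ) :
    partial3 w ν i (p + 1) l K = partial3 w ν i p l K := by
  refine partial3_congr (fun q => ?_) K
  simp only [Allowed, val_lt_succ]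
  by_cases hq : q = p
  · subst hq; omega
  · simp [hq]

lemma partial3_succ_right_of_ne {p : Fin n} (hp : w p ≠ 0) (i j : ℕ) (K : ℤ) :
    partial3 w ν i j (p + 1) K = partial3 w ν i j p K := by
  refine partial3_congr (fun q => ?_) K
  simp only [Allowed, val_lt_succ]
  by_cases hq : q = p
  · subst hq; omega
  · simp [hq]

include h

lemma partial3_succ_left {p : Fin n} (hp : 0 < w p) (j l : ℕ) (K : ℤ) :
    partial3 w ν (p + 1) j l K = partial3 w ν p j l K +
      ν p * partial3 w ν (p + 1) j l (K - w p) := by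
  refine part_insert h ?_ (fun q => ?_) K
  · simp only [Allowed]; omega
  · simp only [Allowed, val_lt_succ]
    by_cases hq : q = p
    · subst hq; simp [hp]
    · simp [hq]

lemma partial3_succ_mid {p : Fin n} (hp : w p < 0) (i l : ℕ) (K : ℤ) :
    partial3 w ν i (p + 1) l K = partial3 w ν i p l K +
      ν p * partial3 w ν i (p + 1) l (K - w p) := by
  refine part_insert h ?_ (fun q => ?_) K
  · simp only [Allowed]; omega
  · simp only [Allowed, val_lt_succ]
    by_cases hq : q = p
    · subst hq; simp [hp]
    · simp [hq]

/-- At weight zero the recurrence is G = G' + ν G, and the tilt condition reduces to ν < 1. -/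
lemma partial3_succ_right {p : Fin n} (hp : w p = 0) (i j : ℕ) (K : ℤ) :
    partial3 w ν i j (p + 1) K = partial3 w ν i j p K / (1 - ν p) := by
  have h1 := part_insert h (S := Allowed w i j p) (S' := Allowed w i j (p + 1)) (p := p)
    (by simp only [Allowed]; omega) (fun q => by
      simp only [Allowed, val_lt_succ]
      by_cases hq : q = p
      · subst hq; simp [hp]
      · simp [hq]) K
  have h2 := (h p).2
  rw [hp] at h1 h2
  simp only [Int.cast_zero, mul_zero, Real.exp_zero, mul_one] at h2
  rw [sub_zero] at h1
  rw [eq_div_iff (by linarith)]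
  change partial3 w ν i j (p + 1) K = partial3 w ν i j p K + ν p * partial3 w ν i j (p + 1) K at h1
  linarith

/-- The combination of b copies of `p` and a copies of `q` has weight zero, so the tilting factors
cancel and the bound for the tilted constants applies. -/
lemma pow_mul_pow_lt_one {p q : Fin n} {a b : ℕ} (ha : 0 < a) (hb : 0 < b) (hp : w p = a)
    (hq : w q = -b) : ν p ^ b * ν q ^ a < 1 := by
  have h1 := pow_lt_one₀ (mul_nonneg (h p).1 (Real.exp_pos (τ * w p)).le) (h p).2 hb.ne'
  have h2 := pow_lt_one₀ (mul_nonneg (h q).1 (Real.exp_pos (τ * w q)).le) (h q).2 ha.ne'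
  have h3 := mul_lt_one_of_nonneg_of_lt_one_left (pow_nonneg
    (mul_nonneg (h p).1 (Real.exp_pos (τ * w p)).le) b) h1 h2.le
  have h4 : Real.exp (τ * w p) ^ b * Real.exp (τ * w q) ^ a = 1 := by
    rw [← Real.exp_nat_mul, ← Real.exp_nat_mul, ← Real.exp_add, hp, hq, Real.exp_eq_one_iff]
    push_cast
    ring
  rw [mul_pow, mul_pow] at h3
  calc ν p ^ b * ν q ^ a = ν p ^ b * ν q ^ a *
        (Real.exp (τ * w p) ^ b * Real.exp (τ * w q) ^ a) := by rw [h4, mul_one]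
    _ < 1 := by linarith

end Allowed

lemma partial3_zero {n : ℕ} (w : Fin n → ℤ) (ν : Fin n → ℝ) (K : ℤ) :
    partial3 w ν 0 0 0 K = if K = 0 then 1 else 0 :=
  part_empty (fun p => by simp [Allowed]) K

lemma partial3_of_neg {n : ℕ} (w : Fin n → ℤ) (ν : Fin n → ℝ) (i : ℕ) {K : ℤ} (hK : K < 0) :
    partial3 w ν i 0 0 K = 0 := by
  refine part_eq_zero (fun p hp => ?_) hK
  by_contra hneg
  apply hp
  rw [restr, if_neg]
  simp only [Allowed]
  omega

lemma partial3_of_pos {n : ℕ} (w : Fin n → ℤ) (ν : Fin n → ℝ) (j : ℕ) {K : ℤ} (hK : 0 < K) :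
    partial3 w ν 0 j 0 K = 0 := by
  rw [partial3, ← part_neg]
  refine part_eq_zero (fun p hp => ?_) (by omega)
  by_contra hneg
  apply hp
  rw [restr, if_neg]
  simp only [Allowed, Pi.neg_apply] at hneg ⊢
  omega

lemma partial3_all {n : ℕ} (w : Fin n → ℤ) (ν : Fin n → ℝ) (K : ℤ) :
    partial3 w ν n n n K = part w ν K := by
  have : restr (Allowed w n n n) ν = ν := by
    funext p
    rw [restr, if_pos]
    have := p.2
    simp only [Allowed]
    omega
  rw [partial3, this]

end PartFun

namespace RealRAM

open PartFun

/-! ### Correctness of the dynamic programme -/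

/-- The tables of the dynamic programme have been filled for the weights `w` and, in the row `σ`,
for the constants `ν`. -/
structure Tables (s : State) (T : ℕ) {n : ℕ} (w : Fin n → ℤ) (σ : ℤ) (ν : Fin n → ℝ) : Prop where
  size : s.ints 0 [] = n
  off : s.ints 16 [] = 8 * (T : ℤ) ^ 2
  bound : s.bound 17 = 24 * T ^ 2
  le_T : n + 2 ≤ T
  row : 0 ≤ σ ∧ σ < s.bound 17
  weight : ∀ i : Fin n, s.ints 24 [(i : ℤ)] = w i
  weight_le : ∀ i, |w i| ≤ T
  const : ∀ i : Fin n, s.reals 25 [σ, (i : ℤ)] = ν i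
  ok26 : (Phase.mk [17, 17] (.real ph26)).Ok 26 s
  ok27 : (Phase.mk [17, 17, 17] (.int ph27)).Ok 27 s
  ok28 : (Phase.mk [17, 17, 17, 17] (.real ph28)).Ok 28 s
  ok29 : (Phase.mk [17, 17, 17] (.real ph29)).Ok 29 s
  ok30 : (Phase.mk [17, 17, 17] (.real ph30)).Ok 30 s
  ok31 : (Phase.mk [17, 17, 17, 17, 17] (.real ph31)).Ok 31 s

namespace Tables

variable {s : State} {T n : ℕ} {w : Fin n → ℤ} {σ : ℤ} {ν : Fin n → ℝ} {τ : ℝ}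
  (D : Tables s T w σ ν) (h : Tilted w ν τ)

include D

lemma T_le : 2 * T ≤ T ^ 2 := by
  have := D.le_T
  nlinarith

lemma small {i : ℕ} (hi : i ≤ n) : 0 ≤ (i : ℤ) ∧ (i : ℤ) < s.bound 17 := by
  have := D.T_le
  have := D.le_T
  rw [D.bound]
  refine ⟨by omega, ?_⟩
  exact_mod_cast (by omega : i < 24 * T ^ 2)

include h

/-- Column x stands for K = x - offset. A read at a negative column falls outside the box and
returns zero, the correct value since positive weights never give a negative K. -/
lemma table29 : ∀ i ≤ n, ∀ x : ℕ, (x : ℤ) < s.bound 17 →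
    s.reals 29 [σ, (i : ℤ), (x : ℤ)] = partial3 w ν i 0 0 (x - s.ints 16 []) := by
  intro i
  induction i with
  | zero =>
    intro hi x hx
    rw [eqn29 D.ok29 D.row (D.small hi) ⟨by omega, hx⟩, partial3_zero]
    simp only [Nat.cast_zero, le_refl, if_true, sub_eq_zero]
  | succ i ih =>
    intro hi x
    induction x using Nat.strong_induction_on with
    | h x ihx =>
      intro hx
      have hc : ((i + 1 : ℕ) : ℤ) - 1 = i := by push_cast; ring
      have hwi := D.weight ⟨i, hi⟩
      have hνi := D.const ⟨i, hi⟩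
      simp only at hwi hνi
      rw [eqn29 D.ok29 D.row (D.small hi) ⟨by omega, hx⟩, if_neg (by omega), hc, hwi, hνi,
        ih (by omega) x hx]
      split_ifs with hw
      · rw [partial3_succ_left (p := ⟨i, hi⟩) h hw]
        congr 2
        by_cases hlt : 0 ≤ (x : ℤ) - w ⟨i, hi⟩
        · obtain ⟨y, hy⟩ := Int.eq_ofNat_of_zero_le hlt
          rw [hy, ihx y (by omega) (by omega), ← hy]
          congr 1
          ring
        · rw [D.ok29.reals_eq_zero (by simp [Phase.box]; omega), partial3_of_neg]
          rw [D.off]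
          have : (0 : ℤ) ≤ 8 * (T : ℤ) ^ 2 := by positivity
          omega
      · exact (partial3_succ_left_of_nonpos (p := ⟨i, hi⟩) (not_lt.1 hw) 0 0 _).symm

/-- The mirror image: column x stands for K = offset - x, so that negative weights also refer to
smaller columns. -/
lemma table30 : ∀ i ≤ n, ∀ x : ℕ, (x : ℤ) < s.bound 17 →
    s.reals 30 [σ, (i : ℤ), (x : ℤ)] = partial3 w ν 0 i 0 (s.ints 16 [] - x) := by
  intro i
  induction i with
  | zero =>
    intro hi x hx
    rw [eqn30 D.ok30 D.row (D.small hi) ⟨by omega, hx⟩, partial3_zero]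
    simp only [Nat.cast_zero, le_refl, if_true, sub_eq_zero, eq_comm (a := (x : ℤ))]
  | succ i ih =>
    intro hi x
    induction x using Nat.strong_induction_on with
    | h x ihx =>
      intro hx
      have hc : ((i + 1 : ℕ) : ℤ) - 1 = i := by push_cast; ring
      have hwi := D.weight ⟨i, hi⟩
      have hνi := D.const ⟨i, hi⟩
      simp only at hwi hνi
      rw [eqn30 D.ok30 D.row (D.small hi) ⟨by omega, hx⟩, if_neg (by omega), hc, hwi, hνi,
        ih (by omega) x hx]
      split_ifs with hw
      · rw [partial3_succ_mid (p := ⟨i, hi⟩) h hw]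
        congr 2
        by_cases hlt : 0 ≤ (x : ℤ) + w ⟨i, hi⟩
        · obtain ⟨y, hy⟩ := Int.eq_ofNat_of_zero_le hlt
          rw [hy, ihx y (by omega) (by omega), ← hy]
          congr 1
          ring
        · rw [D.ok30.reals_eq_zero (by simp [Phase.box]; omega), partial3_of_pos]
          rw [D.off]
          have : (0 : ℤ) ≤ 8 * (T : ℤ) ^ 2 := by positivity
          omega
      · exact (partial3_succ_mid_of_nonneg (p := ⟨i, hi⟩) (not_lt.1 hw) 0 0 _).symm

lemma table26 (K : ℤ) : ∀ l ≤ n, s.reals 26 [σ, (l : ℤ)] * partial3 w ν n n 0 K =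
    partial3 w ν n n l K := by
  intro l
  induction l with
  | zero =>
    intro hl
    rw [eqn26 D.ok26 D.row (D.small hl)]
    simp
  | succ l ih =>
    intro hl
    have hc : ((l + 1 : ℕ) : ℤ) - 1 = l := by push_cast; ring
    have hwi := D.weight ⟨l, hl⟩
    have hνi := D.const ⟨l, hl⟩
    simp only at hwi hνi
    rw [eqn26 D.ok26 D.row (D.small hl), if_neg (by omega), hc, hwi, hνi]
    split_ifs with hw
    · rw [partial3_succ_right (p := ⟨l, hl⟩) h hw]
      rw [div_mul_eq_mul_div, ih (by omega)]
    · rw [partial3_succ_right_of_ne (p := ⟨l, hl⟩) hw]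
      exact ih (by omega)

/-- An instance of `walk_value` with step sizes w_i and -w_j. The walk never leaves [-T, T], so
smaller tables are needed only at distance at most T from K. -/
lemma table31_walk {i j : ℕ} (hi : i + 1 ≤ n) (hj : j + 1 ≤ n) {K : ℤ}
    (hK : 0 ≤ K + s.ints 16 [] ∧ K + s.ints 16 [] < s.bound 17)
    (hwi : 0 < w ⟨i, hi⟩) (hwj : w ⟨j, hj⟩ < 0)
    (hgp : ∀ d : ℤ, |d| ≤ T → s.reals 31 [σ, (i : ℤ), ((j + 1 : ℕ) : ℤ), K + s.ints 16 [] + d,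
      s.ints 16 []] = partial3 w ν i (j + 1) 0 (K + d))
    (hgq : ∀ d : ℤ, |d| ≤ T → s.reals 31 [σ, ((i + 1 : ℕ) : ℤ), (j : ℤ), K + s.ints 16 [] + d,
      s.ints 16 []] = partial3 w ν (i + 1) j 0 (K + d)) :
    s.reals 31 [σ, ((i + 1 : ℕ) : ℤ), ((j + 1 : ℕ) : ℤ), K + s.ints 16 [], s.ints 16 []] =
      partial3 w ν (i + 1) (j + 1) 0 K := by
  obtain ⟨a, ha⟩ := Int.eq_ofNat_of_zero_le hwi.le
  obtain ⟨b, hb⟩ := Int.eq_ofNat_of_zero_le (neg_nonneg.2 hwj.le)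
  have hT := D.T_le
  have hnT := D.le_T
  have haT := abs_le.1 (D.weight_le ⟨i, hi⟩)
  have hbT := abs_le.1 (D.weight_le ⟨j, hj⟩)
  have hc : ((i + 1 : ℕ) : ℤ) - 1 = i := by push_cast; ring
  have hc' : ((j + 1 : ℕ) : ℤ) - 1 = j := by push_cast; ring
  have h24i : s.ints 24 [(i : ℤ)] = a := (D.weight ⟨i, hi⟩).trans ha
  have h24j : s.ints 24 [(j : ℤ)] = -b := (D.weight ⟨j, hj⟩).trans (by omega)
  have h25i : s.reals 25 [σ, (i : ℤ)] = ν ⟨i, hi⟩ := D.const ⟨i, hi⟩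
  have h25j : s.reals 25 [σ, (j : ℤ)] = ν ⟨j, hj⟩ := D.const ⟨j, hj⟩
  have hoff : s.ints 16 [] = ((8 * T ^ 2 : ℕ) : ℤ) := by rw [D.off]; push_cast; ring
  have hbd : (s.bound 17 : ℤ) = ((24 * T ^ 2 : ℕ) : ℤ) := by rw [D.bound]
  have hst : ∀ {y : ℕ}, y ≤ 8 * T ^ 2 → 0 ≤ (y : ℤ) ∧ (y : ℤ) < s.bound 17 := by
    intro y hy
    rw [hbd]
    omega
  set δ : ℕ → ℤ := fun y => s.ints 27 [((i + 1 : ℕ) : ℤ), ((j + 1 : ℕ) : ℤ), (y : ℤ)] with hδdef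
  set pr : ℕ → ℝ := fun y => s.reals 28 [σ, ((i + 1 : ℕ) : ℤ), ((j + 1 : ℕ) : ℤ), (y : ℤ)] with hpr
  set acc : ℕ → ℝ := fun y => s.reals 31 [σ, ((i + 1 : ℕ) : ℤ), ((j + 1 : ℕ) : ℤ),
    K + s.ints 16 [], (y : ℤ)] with hacc
  have hab : a + b + 1 ≤ 8 * T ^ 2 := by omega
  have hcs : ∀ y : ℕ, ((y + 1 : ℕ) : ℤ) - 1 = y := fun y => by push_cast; ring
  have e27 : ∀ y < a + b, δ (y + 1) = if 0 ≤ δ y then δ y - a else δ y + b := by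
    intro y hy
    simp only [hδdef]
    rw [eqn27 D.ok27 (D.small hi) (D.small hj) (hst (by omega)), if_neg (by omega), hcs, hc, hc',
      h24i, h24j, sub_neg_eq_add]
  have e28 : ∀ y < a + b, pr (y + 1) = pr y * if 0 ≤ δ y then ν ⟨i, hi⟩ else ν ⟨j, hj⟩ := by
    intro y hy
    simp only [hpr]
    rw [eqn28 D.ok28 D.row (D.small hi) (D.small hj) (hst (by omega)), if_neg (by omega), hcs, hc,
      hc', h25i, h25j]
    simp only [mul_ite, hδdef]
  have e270 : δ 0 = 0 := by
    simp only [hδdef]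
    rw [eqn27 D.ok27 (D.small hi) (D.small hj) (hst (by omega))]
    simp
  have e280 : pr 0 = 1 := by
    simp only [hpr]
    rw [eqn28 D.ok28 D.row (D.small hi) (D.small hj) (hst (by omega))]
    simp
  have hwalk := walk_bounds e270 e27
  have e31 : ∀ y : ℕ, y ≤ 8 * T ^ 2 → acc y = if (y : ℤ) ≤ 0 then 0 else
      if (y : ℤ) ≤ a + b then
        if 0 ≤ δ (y - 1) then acc (y - 1) + pr (y - 1) *
          s.reals 31 [σ, (i : ℤ), ((j + 1 : ℕ) : ℤ), K + s.ints 16 [] + δ (y - 1), s.ints 16 []]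
        else acc (y - 1) + pr (y - 1) *
          s.reals 31 [σ, ((i + 1 : ℕ) : ℤ), (j : ℤ), K + s.ints 16 [] + δ (y - 1), s.ints 16 []]
      else if (y : ℤ) ≤ a + b + 1 then acc (y - 1) / (1 - pr (y - 1)) else acc (y - 1) := by
    intro y hy
    simp only [hacc]
    rw [eqn31 D.ok31 D.row (D.small hi) (D.small hj) hK (hst hy), if_neg (by omega),
      if_neg (by omega), hc, hc', h24i, h24j, if_neg (by omega), if_neg (by omega)]
    by_cases hy0 : (y : ℤ) ≤ 0
    · simp only [if_pos hy0]
    · have : (y : ℤ) - 1 = ((y - 1 : ℕ) : ℤ) := by omega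
      simp only [if_neg hy0, this, sub_neg_eq_add, hδdef, hpr]
  have hacc0 : acc 0 = 0 := by rw [e31 0 (by omega)]; simp
  have hval := walk_value (a := a) (b := b) (u := ν ⟨i, hi⟩) (v := ν ⟨j, hj⟩) (δ := δ) (pr := pr)
    (acc := acc) (g := partial3 w ν (i + 1) (j + 1) 0) (gp := partial3 w ν i (j + 1) 0)
    (gq := partial3 w ν (i + 1) j 0) (K := K) (by omega) (by omega) e270 e280 e27 e28 hacc0
    (fun y hy => by
      have hb' := hwalk y hy.le
      have hd : |δ y| ≤ T := by rw [abs_le]; omega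
      rw [e31 (y + 1) (by omega), if_neg (by omega), if_pos (by omega), Nat.add_sub_cancel,
        hgp _ hd, hgq _ hd]
      simp only [mul_ite, add_ite])
    (fun K => by
      have := partial3_succ_left h (p := ⟨i, hi⟩) hwi (j + 1) 0 K
      rw [this, ha])
    (fun K => by
      have := partial3_succ_mid h (p := ⟨j, hj⟩) hwj (i + 1) 0 K
      rw [this]
      congr 3
      omega)
    (pow_mul_pow_lt_one h (by omega) (by omega) ha (by omega))
  -- The quotient appears at index a + b + 1 and is copied from there on, so it can be read at one
  -- fixed index that is independent of the two weights.
  have hlast : ∀ y : ℕ, a + b + 1 + y ≤ 8 * T ^ 2 →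
      acc (a + b + 1 + y) = acc (a + b) / (1 - pr (a + b)) := by
    intro y
    induction y with
    | zero =>
      intro hy
      rw [e31 _ hy, if_neg (by omega), if_neg (by omega), if_pos (by omega)]
      rfl
    | succ y ih =>
      intro hy
      rw [e31 _ hy, if_neg (by omega), if_neg (by omega), if_neg (by omega)]
      exact ih (by omega)
  rw [hval, ← hlast (8 * T ^ 2 - (a + b + 1)) (by omega)]
  simp only [hacc]
  rw [Nat.add_sub_cancel' hab, ← hoff]

/-- Each reference to a smaller table lowers i + j by one and moves K by at most T, so |K| + (i + j)
T does not grow. The bound 8 T² keeps every column between 0 and 16 T², inside the box of side 24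
T². -/
lemma table31 : ∀ i ≤ n, ∀ j ≤ n, ∀ K : ℤ, |K| + (i + j) * T ≤ 8 * (T : ℤ) ^ 2 →
    s.reals 31 [σ, (i : ℤ), (j : ℤ), K + s.ints 16 [], s.ints 16 []] = partial3 w ν i j 0 K := by
  have hR : (0 : ℤ) < 8 * (T : ℤ) ^ 2 := by
    have := D.le_T
    have : (0 : ℤ) < T := by omega
    positivity
  have hbd : (s.bound 17 : ℤ) = 24 * (T : ℤ) ^ 2 := by rw [D.bound]; push_cast; ring
  have hoff := D.off
  have hKb : ∀ {K x : ℤ}, 0 ≤ x → |K| + x ≤ 8 * (T : ℤ) ^ 2 →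
      0 ≤ K + s.ints 16 [] ∧ K + s.ints 16 [] < s.bound 17 := by
    intro K x h0 hK
    have := abs_le.1 (show |K| ≤ 8 * (T : ℤ) ^ 2 by omega)
    omega
  have hRb : 0 ≤ s.ints 16 [] ∧ s.ints 16 [] < s.bound 17 := by omega
  have hT0 : (0 : ℤ) ≤ T := by omega
  intro i
  induction i with
  | zero =>
    intro hi j hj K hK
    have hk := hKb (by positivity) hK
    rw [eqn31 D.ok31 D.row (D.small hi) (D.small hj) hk hRb, if_pos (by simp)]
    have hk' := hKb (K := -K) (x := ((0 : ℕ) + j) * T) (by positivity) (by rwa [abs_neg])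
    have e : s.ints 16 [] + s.ints 16 [] - (K + s.ints 16 []) = -K + s.ints 16 [] := by ring
    rw [e]
    obtain ⟨y, hy⟩ := Int.eq_ofNat_of_zero_le hk'.1
    rw [hy, D.table30 h j hj y (by omega), ← hy]
    congr 1
    ring
  | succ i ih =>
    intro hi j
    induction j with
    | zero =>
      intro hj K hK
      have hk := hKb (by positivity) hK
      rw [eqn31 D.ok31 D.row (D.small hi) (D.small hj) hk hRb, if_neg (by omega), if_pos (by simp)]
      obtain ⟨y, hy⟩ := Int.eq_ofNat_of_zero_le hk.1
      rw [hy, D.table29 h (i + 1) hi y (by omega), ← hy]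
      congr 1
      ring
    | succ j ihj =>
      intro hj K hK
      have hk := hKb (by positivity) hK
      have e1 : |K| + ((i : ℤ) + (j + 1 : ℕ)) * T + T ≤ 8 * (T : ℤ) ^ 2 := by
        push_cast at hK ⊢
        linarith
      have e2 : |K| + (((i + 1 : ℕ) : ℤ) + j) * T + T ≤ 8 * (T : ℤ) ^ 2 := by
        push_cast at hK ⊢
        linarith
      by_cases hwi : 0 < w ⟨i, hi⟩
      · by_cases hwj : w ⟨j, hj⟩ < 0
        · refine D.table31_walk h hi hj hk hwi hwj (fun d hd => ?_) fun d hd => ?_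
          · rw [add_right_comm, ih (by omega) (j + 1) hj]
            have := abs_add_le K d
            omega
          · rw [add_right_comm, ihj (by omega)]
            have := abs_add_le K d
            omega
        · have hwi' := D.weight ⟨i, hi⟩
          have hwj' := D.weight ⟨j, hj⟩
          simp only at hwi' hwj'
          have hc : ((i + 1 : ℕ) : ℤ) - 1 = i := by push_cast; ring
          have hc' : ((j + 1 : ℕ) : ℤ) - 1 = j := by push_cast; ring
          rw [eqn31 D.ok31 D.row (D.small hi) (D.small hj) hk hRb, if_neg (by omega),
            if_neg (by omega), hc, hc', hwi', hwj', if_neg (by omega), if_pos (by omega),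
            ihj (by omega) K (by omega),
            partial3_succ_mid_of_nonneg (p := ⟨j, hj⟩) (not_lt.1 hwj)]
      · have hwi' := D.weight ⟨i, hi⟩
        simp only at hwi'
        have hc : ((i + 1 : ℕ) : ℤ) - 1 = i := by push_cast; ring
        rw [eqn31 D.ok31 D.row (D.small hi) (D.small hj) hk hRb, if_neg (by omega),
          if_neg (by omega), hc, hwi', if_pos (by omega),
          ih (by omega) (j + 1) hj K (by omega),
          partial3_succ_left_of_nonpos (p := ⟨i, hi⟩) (not_lt.1 hwi)]

/-- The tables contain the values of the partition function. -/
theorem partV_eq {K : ℤ} (hK : |K| ≤ 6 * (T : ℤ) ^ 2) : partV s σ K = part w ν K := by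
  have hn := D.le_T
  have : ((n : ℤ) + n) * T ≤ 2 * (T : ℤ) ^ 2 := by
    have h1 : (n : ℤ) ≤ T := by omega
    nlinarith
  rw [partV, D.size, D.table31 h n le_rfl n le_rfl K (by omega), D.table26 h K n le_rfl,
    partial3_all]

end Tables

end RealRAM

end


noncomputable section

/-! ### The tables of a run -/

namespace RealRAM

lemma table_apply {α : Type} [Zero α] {n : ℕ} (f : Fin n → α) {i : ℕ} (hi : i < n) :
    table f (i : ℤ) = f ⟨i, hi⟩ := by
  simp [table, hi]

lemma prefix_sum {F f : ℤ → ℤ} {N : ℕ}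
    (h : ∀ y : ℕ, y ≤ N → F y = if (y : ℤ) ≤ 0 then 0 else F (y - 1) + f (y - 1)) :
    ∀ y : ℕ, y ≤ N → F y = ∑ q ∈ Finset.range y, f q := by
  intro y
  induction y with
  | zero => intro hy; rw [h 0 hy]; simp
  | succ y ih =>
    intro hy
    have hc : ((y + 1 : ℕ) : ℤ) - 1 = y := by push_cast; ring
    rw [h _ hy, if_neg (by omega), hc, ih (by omega), Finset.sum_range_succ]

/-- The place of the closed net with a given number. -/
def place {n : ℕ} (i : Fin (n + 1)) : Option (Fin n) := finSuccEquivLast i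

lemma place_of_lt {n i : ℕ} (hi : i < n) :
    place (⟨i, by omega⟩ : Fin (n + 1)) = some ⟨i, hi⟩ :=
  finSuccEquivLast_castSucc (⟨i, hi⟩ : Fin n)

lemma place_last {n : ℕ} : place (⟨n, by omega⟩ : Fin (n + 1)) = none :=
  finSuccEquivLast_last

lemma exists_place {n : ℕ} (x : Option (Fin n)) : ∃ i : Fin (n + 1), place i = x :=
  ⟨finSuccEquivLast.symm x, by simp [place]⟩

variable {n k : ℕ}

/-- The state `s` is the final state of the phases on the given input. -/
structure Run (s : State) (O : OpenPi3 (Fin n) (Fin k)) (μ : Fin n → ℝ) (m₀ : Fin n → ℕ)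
    (c : ℕ) : Prop where
  input : ∀ a < 10, s.cell a = (input O μ m₀ c).cell a
  ok : ∀ (i : ℕ) (hi : i < phases.length), phases[i].Ok (10 + i) s

/-- The sum of the entries of the backward incidence matrix of the closed net. -/
def preSum (O : OpenPi3 (Fin n) (Fin k)) : ℕ := ∑ t, ∑ x, O.closed.pre x t

/-- The parameter that bounds all the numbers in the net. -/
def sizeOf (O : OpenPi3 (Fin n) (Fin k)) (m₀ : Fin n → ℕ) (c : ℕ) : ℕ :=
  preSum O + ∑ p, m₀ p + n + k + c + 2

namespace Run

variable {s : State} {O : OpenPi3 (Fin n) (Fin k)} {μ : Fin n → ℝ} {m₀ : Fin n → ℕ} {c : ℕ}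
  (r : Run s O μ m₀ c)

include r

lemma ints0 : s.ints 0 [] = n := by rw [State.ints_of_cell (r.input 0 (by omega))]; rfl

lemma ints1 : s.ints 1 [] = k := by rw [State.ints_of_cell (r.input 1 (by omega))]; rfl

lemma ints2 : s.ints 2 [] = O.N := by rw [State.ints_of_cell (r.input 2 (by omega))]; rfl

lemma ints3 : s.ints 3 [] = c := by rw [State.ints_of_cell (r.input 3 (by omega))]; rfl

lemma ints4 {i : ℕ} (hi : i < n + 1) : s.ints 4 [(i : ℤ)] = O.str.layer (place ⟨i, hi⟩) := by
  rw [State.ints_of_cell (r.input 4 (by omega))]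
  exact table_apply (fun i : Fin (n + 1) => (O.str.layer (finSuccEquivLast i) : ℤ)) hi

lemma ints5 {i : ℕ} (hi : i < n) : s.ints 5 [(i : ℤ)] = m₀ ⟨i, hi⟩ := by
  rw [State.ints_of_cell (r.input 5 (by omega))]
  exact table_apply (fun i : Fin n => (m₀ i : ℤ)) hi

lemma ints6 {i t : ℕ} (hi : i < n + 1) (ht : t < k) :
    s.ints 6 [(i : ℤ), (t : ℤ)] = O.closed.pre (place ⟨i, hi⟩) ⟨t, ht⟩ := by
  rw [State.ints_of_cell (r.input 6 (by omega))]
  change table (fun i : Fin (n + 1) =>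
    table (fun j : Fin k => (O.closed.pre (finSuccEquivLast i) j : ℤ)) (t : ℤ)) (i : ℤ) = _
  rw [table_apply _ hi, table_apply _ ht]
  rfl

lemma reals0 {i : ℕ} (hi : i < n) : s.reals 0 [(i : ℤ)] = μ ⟨i, hi⟩ := by
  rw [State.reals_of_cell (r.input 0 (by omega))]
  exact table_apply μ hi

lemma bound10 : s.bound 10 = n + k + 3 := by
  rw [State.bound, eqn10 (r.ok 0 (by decide)), r.ints0, r.ints1]
  omega

lemma ints11 {t : ℕ} (ht : t < k) : s.ints 11 [(t : ℤ), ((n + 1 : ℕ) : ℤ)] =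
    ∑ x, (O.closed.pre x ⟨t, ht⟩ : ℤ) := by
  rw [prefix_sum (F := fun y => s.ints 11 [(t : ℤ), y]) (f := fun y => s.ints 6 [y, (t : ℤ)])
    (N := n + 1) (fun y hy => eqn11 (r.ok 1 (by decide)) (by omega)
      (by rw [r.bound10]; push_cast; omega) (by omega) (by rw [r.bound10]; push_cast; omega))
    (n + 1) le_rfl, Finset.sum_range]
  rw [← finSuccEquivLast.sum_comp]
  exact Finset.sum_congr rfl fun i _ => r.ints6 i.2 ht

lemma ints12 : s.ints 12 [(k : ℤ)] = preSum O := by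
  rw [prefix_sum (F := fun y => s.ints 12 [y]) (f := fun y => s.ints 11 [y, s.ints 0 [] + 1])
    (N := k) (fun y hy => eqn12 (r.ok 2 (by decide))
      (by rw [r.bound10]; push_cast; omega)) k le_rfl, Finset.sum_range, preSum]
  push_cast
  refine Finset.sum_congr rfl fun t _ => ?_
  have := r.ints11 t.2
  rw [r.ints0]
  exact_mod_cast this

lemma ints13 : s.ints 13 [(n : ℤ)] = ∑ p, m₀ p := by
  rw [prefix_sum (F := fun y => s.ints 13 [y]) (f := fun y => s.ints 5 [y])
    (N := n) (fun y hy => eqn13 (r.ok 3 (by decide))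
      (by rw [r.bound10]; push_cast; omega)) n le_rfl, Finset.sum_range]
  push_cast
  exact Finset.sum_congr rfl fun p _ => r.ints5 p.2

lemma ints14 : s.ints 14 [] = sizeOf O m₀ c + 1 := by
  rw [eqn14 (r.ok 4 (by decide)), r.ints1, r.ints0, r.ints3, r.ints12, r.ints13, sizeOf]
  push_cast
  ring

/-- The machine has no integer multiplication; products are looked up in a table made by repeated
addition. -/
lemma ints15 {x y : ℕ} (hx : x ≤ sizeOf O m₀ c) (hy : y ≤ sizeOf O m₀ c) :
    s.ints 15 [(x : ℤ), (y : ℤ)] = x * y := by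
  have hb : s.bound 14 = sizeOf O m₀ c + 1 := by rw [State.bound, r.ints14]; omega
  rw [prefix_sum (F := fun y => s.ints 15 [(x : ℤ), y]) (f := fun _ => (x : ℤ))
    (N := sizeOf O m₀ c) (fun y hy => eqn15 (r.ok 5 (by decide))
      (by rw [hb]; push_cast; omega) (by rw [hb]; push_cast; omega)) y hy]
  simp [mul_comm]

lemma ints16 : s.ints 16 [] = 8 * (sizeOf O m₀ c : ℤ) ^ 2 := by
  rw [eqn16 (r.ok 6 (by decide)), r.ints14, add_sub_cancel_right, r.ints15 le_rfl le_rfl]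
  ring

lemma bound17 : s.bound 17 = 24 * sizeOf O m₀ c ^ 2 := by
  rw [State.bound, eqn17 (r.ok 7 (by decide)), r.ints16]
  have : (3 * (8 * (sizeOf O m₀ c : ℤ) ^ 2)) = ((24 * sizeOf O m₀ c ^ 2 : ℕ) : ℤ) := by
    push_cast; ring
  rw [this, Int.toNat_natCast]

lemma small {x : ℕ} (hx : x ≤ 2 * sizeOf O m₀ c) : 0 ≤ (x : ℤ) ∧ (x : ℤ) < s.bound 17 := by
  rw [r.bound17]
  have h1 : 2 ≤ sizeOf O m₀ c := by unfold sizeOf; omega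
  have h2 : 2 * sizeOf O m₀ c ≤ sizeOf O m₀ c ^ 2 := by nlinarith
  refine ⟨by omega, ?_⟩
  exact_mod_cast (by omega : x < 24 * sizeOf O m₀ c ^ 2)

lemma n_le : n + k + c + 2 ≤ sizeOf O m₀ c := by unfold sizeOf; omega

lemma m₀_le (p : Fin n) : m₀ p ≤ sizeOf O m₀ c := by
  have := Finset.single_le_sum (f := m₀) (fun _ _ => Nat.zero_le _) (Finset.mem_univ p)
  unfold sizeOf
  omega

/-- The cell is a sum of non-negative entries, so it is at most zero exactly if each of them
vanishes. -/
lemma ints18 {p t : ℕ} (hp : p < n + 1) (ht : t < k) :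
    s.ints 18 [(p : ℤ), (t : ℤ), ((n + 1 : ℕ) : ℤ)] ≤ 0 ↔
      ∀ x, O.str.layer x = O.str.layer (place ⟨p, hp⟩) + 1 → O.closed.pre x ⟨t, ht⟩ = 0 := by
  have hn := r.n_le
  rw [prefix_sum (F := fun y => s.ints 18 [(p : ℤ), (t : ℤ), y])
    (f := fun y => if s.ints 4 [y] = s.ints 4 [(p : ℤ)] + 1 then s.ints 6 [y, (t : ℤ)] else 0)
    (N := n + 1) (fun y hy => by
      have := eqn18 (r.ok 8 (by decide)) (r.small (x := p) (by omega)) (r.small (x := t) (by omega))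
        (r.small (x := y) (by omega))
      simp only [this]
      split_ifs <;> simp) (n + 1) le_rfl, Finset.sum_range]
  have hnn : ∀ i ∈ (Finset.univ : Finset (Fin (n + 1))),
      (0 : ℤ) ≤ if s.ints 4 [((i : ℕ) : ℤ)] = s.ints 4 [(p : ℤ)] + 1 then
        s.ints 6 [((i : ℕ) : ℤ), (t : ℤ)] else 0 := by
    intro i _
    split_ifs
    · rw [r.ints6 i.2 ht]; omega
    · exact le_rfl
  refine Iff.trans ⟨fun h => le_antisymm h (Finset.sum_nonneg hnn), fun h => h.le⟩ ?_
  rw [Finset.sum_eq_zero_iff_of_nonneg hnn]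
  constructor
  · intro h x hx
    obtain ⟨i, rfl⟩ := exists_place x
    have := h i (Finset.mem_univ _)
    rw [r.ints4 i.2, r.ints4 hp, r.ints6 i.2 ht, if_pos (by exact_mod_cast hx)] at this
    exact_mod_cast this
  · intro h i _
    rw [r.ints4 i.2, r.ints4 hp, r.ints6 i.2 ht]
    split_ifs with hx
    · exact_mod_cast h _ (by exact_mod_cast hx)
    · rfl

end Run

end RealRAM

/-! ### Recognising the bag of a place from the incidence matrix -/

namespace OpenPi3

variable {P T : Type} [Fintype P] [Fintype T] (O : OpenPi3 P T)

/-- The consumed bag belongs to some place z and contains z. If `x` occurs in it as a mere resource,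
then z lies in the layer after that of `x`, and the second condition excludes this. The criterion
uses only data in the input, where the bijection between places and bags is not given. -/
lemma inBag_eq_iff (x : Option P) (t : T) : O.closed.inBag t = O.str.bag x ↔
    1 ≤ O.closed.pre x t ∧ ∀ y, O.str.layer y = O.str.layer x + 1 → O.closed.pre y t = 0 := by
  obtain ⟨z, -, hz⟩ := O.str.bag_bij.surjOn (O.closed.inBag_mem_bags t)
  have hpre : ∀ y, O.closed.pre y t = O.str.bag z y := fun y => by rw [hz]; rfl
  constructor
  · intro h
    rw [← hz] at h
    obtain rfl := O.str.bag_bij.injOn (Set.mem_univ _) (Set.mem_univ _) h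
    refine ⟨by rw [hpre, O.str.bag_self], fun y hy => ?_⟩
    rw [hpre]
    by_contra h0
    have := O.str.resource z y (fun e => by rw [e] at hy; omega) (Nat.pos_of_ne_zero h0)
    omega
  · rintro ⟨h1, h2⟩
    rw [← hz]
    by_cases hx : x = z
    · rw [hx]
    · exfalso
      rw [hpre] at h1
      have := h2 z (O.str.resource z x hx h1).1.symm
      rw [hpre, O.str.bag_self] at this
      omega

lemma exists_inBag_eq_bag (x : Option P) : ∃ t, O.closed.inBag t = O.str.bag x := by
  classical
  have h : O.str.bag x ∈ O.closed.bags := O.str.bag_bij.mapsTo (Set.mem_univ x)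
  refine O.closed.exists_inBag (fun t => ?_) h
  obtain ⟨x, y, hx, hy, hxy, hne⟩ := O.exists_endpoints t
  have h := (O.str.component y x).1 hxy.symm
  rcases Relation.ReflTransGen.cases_head h with h | ⟨b, ⟨t', h1, _⟩, _⟩
  · exact absurd (O.str.bag_bij.injOn (Set.mem_univ _) (Set.mem_univ _) h) hne.symm
  · exact ⟨t', h1.trans hy.symm⟩

lemma sum_pre_eq {x : Option P} {t : T} (h : O.closed.inBag t = O.str.bag x) :
    ∑ y, O.closed.pre y t = O.str.pot x + 1 := by
  have h1 : ∑ y, O.closed.pre y t = ∑ y, O.str.bag x y := by rw [← h]; rfl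
  have h2 := Finset.single_le_sum (f := O.str.bag x) (fun _ _ => Nat.zero_le _)
    (Finset.mem_univ x)
  rw [O.str.bag_self] at h2
  rw [h1, ClosedPi3.pot]
  omega

end OpenPi3

namespace RealRAM

namespace Run

variable {n k : ℕ} {s : State} {O : OpenPi3 (Fin n) (Fin k)} {μ : Fin n → ℝ} {m₀ : Fin n → ℕ}
  {c : ℕ} (r : Run s O μ m₀ c)

include r

/-- Loop invariant: either the value is already correct or no transition seen so far consumes the
bag. Later matches rewrite the same value. -/
lemma ints19_aux {p : ℕ} (hp : p < n + 1) : ∀ y : ℕ, y ≤ k →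
    (s.ints 19 [(p : ℤ), (y : ℤ)] = O.str.pot (place ⟨p, hp⟩) ∨
      ∀ t : Fin k, (t : ℕ) < y → O.closed.inBag t ≠ O.str.bag (place ⟨p, hp⟩)) := by
  have hn := r.n_le
  intro y
  induction y with
  | zero => intro _; right; intro t ht; omega
  | succ y ih =>
    intro hy
    have hc : ((y + 1 : ℕ) : ℤ) - 1 = y := by push_cast; ring
    have hcn : (n : ℤ) + 1 = ((n + 1 : ℕ) : ℤ) := by push_cast; ring
    rw [eqn19 (r.ok 9 (by decide)) (r.small (x := p) (by omega)) (r.small (x := y + 1) (by omega)),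
      if_neg (by omega), hc, r.ints0, hcn, r.ints6 hp hy, r.ints11 hy]
    have hiff := O.inBag_eq_iff (place ⟨p, hp⟩) ⟨y, hy⟩
    rw [← r.ints18 hp hy] at hiff
    by_cases h : O.closed.inBag ⟨y, hy⟩ = O.str.bag (place ⟨p, hp⟩)
    · left
      have h1 := hiff.1 h
      rw [if_pos ⟨by exact_mod_cast h1.1, h1.2⟩]
      have h2 := O.sum_pre_eq h
      have h3 : (∑ x, (O.closed.pre x ⟨y, hy⟩ : ℤ)) = O.str.pot (place ⟨p, hp⟩) + 1 := by
        exact_mod_cast h2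
      rw [h3]
      ring
    · rw [if_neg (fun h1 => h (hiff.2 ⟨by exact_mod_cast h1.1, h1.2⟩))]
      refine (ih (by omega)).imp id fun h1 t ht => ?_
      by_cases ht' : (t : ℕ) < y
      · exact h1 t ht'
      · have : t = ⟨y, hy⟩ := Fin.ext (by simp only; omega)
        rw [this]
        exact h

lemma ints19 {p : ℕ} (hp : p < n + 1) :
    s.ints 19 [(p : ℤ), (k : ℤ)] = O.str.pot (place ⟨p, hp⟩) := by
  rcases r.ints19_aux hp k le_rfl with h | h
  · exact h
  · obtain ⟨t, ht⟩ := O.exists_inBag_eq_bag (place ⟨p, hp⟩)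
    exact absurd ht (h t t.2)

lemma ints19_some {p : ℕ} (hp : p < n) : s.ints 19 [(p : ℤ), (k : ℤ)] = O.pot ⟨p, hp⟩ := by
  rw [r.ints19 (by omega), place_of_lt hp]
  rfl

lemma ints19_none : s.ints 19 [(n : ℤ), (k : ℤ)] = O.POT O.N := by
  rw [r.ints19 (by omega), place_last, O.POT_N]

lemma ints4_some {p : ℕ} (hp : p < n) :
    s.ints 4 [(p : ℤ)] = O.str.layer (some ⟨p, hp⟩) := by
  rw [r.ints4 (by omega), place_of_lt hp]

lemma pot_le (x : Option (Fin n)) : O.str.pot x ≤ sizeOf O m₀ c := by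
  obtain ⟨t, ht⟩ := O.exists_inBag_eq_bag x
  have h1 := O.sum_pre_eq ht
  have h2 : ∑ y, O.closed.pre y t ≤ preSum O :=
    Finset.single_le_sum (f := fun t => ∑ y, O.closed.pre y t) (fun _ _ => Nat.zero_le _)
      (Finset.mem_univ t)
  unfold sizeOf
  omega

lemma POT_le (i : ℕ) : O.POT i ≤ sizeOf O m₀ c := by
  unfold OpenPi3.POT
  split_ifs
  · exact r.pot_le none
  · exact Finset.sup_le fun p _ => r.pot_le (some p)

lemma abs_cin_le (p : Fin n) : |O.cin p| ≤ sizeOf O m₀ c := by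
  have h1 := r.POT_le (O.str.layer (some p))
  have h2 : O.pot p ≤ sizeOf O m₀ c := r.pot_le (some p)
  rw [OpenPi3.cin, abs_le]
  omega

lemma abs_wt_le (p : Fin n) : |O.wt p| ≤ sizeOf O m₀ c := by
  have h1 := r.n_le
  unfold OpenPi3.wt
  split_ifs
  · exact r.abs_cin_le p
  · rw [abs_one]
    omega

/-- The total number of tokens and every |cin| are at most T, so the two sums are at most T and T².
Hence all arguments of the partition functions stay within the tabulated range. -/
lemma abs_invConst_le (i : ℕ) : |O.invConst i m₀| ≤ 2 * (sizeOf O m₀ c : ℤ) ^ 2 := by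
  set T := sizeOf O m₀ c with hT
  have hn := r.n_le
  have hsum : ∑ p, (m₀ p : ℤ) ≤ T := by
    rw [hT, sizeOf]
    push_cast
    have : (0 : ℤ) ≤ preSum O := Int.natCast_nonneg _
    omega
  have hsub : ∀ S : Finset (Fin n), ∑ p ∈ S, (m₀ p : ℤ) ≤ T := fun S =>
    (Finset.sum_le_sum_of_subset_of_nonneg (Finset.subset_univ S)
      fun p _ _ => Int.natCast_nonneg _).trans hsum
  have h1 : |∑ p ∈ O.layerSet i, (m₀ p : ℤ)| ≤ T := by
    rw [abs_of_nonneg (Finset.sum_nonneg fun p _ => Int.natCast_nonneg _)]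
    exact hsub _
  have h2 : |∑ p ∈ O.layerSet (i + 1), O.cin p * (m₀ p : ℤ)| ≤ T * T := by
    refine (Finset.abs_sum_le_sum_abs _ _).trans ?_
    refine (Finset.sum_le_sum (g := fun p => (T : ℤ) * m₀ p) fun p _ => ?_).trans ?_
    · rw [abs_mul, Nat.abs_cast]
      exact mul_le_mul_of_nonneg_right (r.abs_cin_le p) (Int.natCast_nonneg _)
    · rw [← Finset.mul_sum]
      exact mul_le_mul_of_nonneg_left (hsub _) (Int.natCast_nonneg _)
  have h3 : (T : ℤ) * 1 ≤ T * T := mul_le_mul_of_nonneg_left (by omega) (by omega)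
  have h4 := abs_add_le (∑ p ∈ O.layerSet i, (m₀ p : ℤ))
    (∑ p ∈ O.layerSet (i + 1), O.cin p * (m₀ p : ℤ))
  unfold OpenPi3.invConst
  linarith

lemma ints20 : s.ints 20 [(n : ℤ)] = O.POT (O.N - 1) := by
  have hn := r.n_le
  have hN := O.one_le_N
  have hle : ∀ {p : Fin n}, O.str.layer (some p) = O.N - 1 → O.pot p ≤ O.POT (O.N - 1) :=
    fun h => O.pot_le_POT (by omega) h
  have key : ∀ y : ℕ, y ≤ n → 0 ≤ s.ints 20 [(y : ℤ)] ∧ s.ints 20 [(y : ℤ)] ≤ O.POT (O.N - 1) ∧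
      ∀ p : Fin n, (p : ℕ) < y → O.str.layer (some p) = O.N - 1 →
        (O.pot p : ℤ) ≤ s.ints 20 [(y : ℤ)] := by
    intro y
    induction y with
    | zero =>
      intro _
      rw [eqn20 (r.ok 10 (by decide)) (r.small (x := 0) (by omega))]
      simp
    | succ y ih =>
      intro hy
      obtain ⟨i1, i2, i3⟩ := ih (by omega)
      have hc : ((y + 1 : ℕ) : ℤ) - 1 = y := by push_cast; ring
      rw [eqn20 (r.ok 10 (by decide)) (r.small (x := y + 1) (by omega)), if_neg (by omega), hc,
        r.ints4_some hy, r.ints2, r.ints1, r.ints19_some hy]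
      have hcases : ∀ p : Fin n, (p : ℕ) < y + 1 → (p : ℕ) < y ∨ p = ⟨y, hy⟩ := fun p hp => by
        rw [Fin.ext_iff]; simp only; omega
      split_ifs with h
      · refine ⟨by omega, ?_, fun p hp hl => ?_⟩
        · exact_mod_cast hle (p := ⟨y, hy⟩) (by omega)
        · rcases hcases p hp with h1 | rfl
          · exact (i3 p h1 hl).trans h.2
          · exact le_rfl
      · refine ⟨i1, i2, fun p hp hl => ?_⟩
        rcases hcases p hp with h1 | rfl
        · exact i3 p h1 hl
        · by_contra h2
          exact h ⟨by omega, by omega⟩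
  obtain ⟨h1, h2, h3⟩ := key n le_rfl
  refine le_antisymm h2 ?_
  rw [OpenPi3.POT, if_neg (by omega)]
  obtain ⟨y, hy⟩ := Int.eq_ofNat_of_zero_le h1
  rw [hy] at h3 ⊢
  norm_cast
  refine Finset.sup_le fun p hp => ?_
  exact_mod_cast h3 p p.2 (O.mem_layerSet.1 hp)

lemma sum_layers (i : ℕ) (f g : ℤ → ℤ) (f' g' : Fin n → ℤ) (hf : ∀ p : Fin n, f p = f' p)
    (hg : ∀ p : Fin n, O.str.layer (some p) = i + 1 → g p = g' p) :
    (∑ q ∈ Finset.range n, if s.ints 4 [(q : ℤ)] = i then f q else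
      if s.ints 4 [(q : ℤ)] = i + 1 then g q else 0) =
    ∑ p ∈ O.layerSet i, f' p + ∑ p ∈ O.layerSet (i + 1), g' p := by
  classical
  rw [Finset.sum_range, OpenPi3.layerSet, OpenPi3.layerSet, Finset.sum_filter, Finset.sum_filter,
    ← Finset.sum_add_distrib]
  refine Finset.sum_congr rfl fun p _ => ?_
  rw [r.ints4_some p.2, hf]
  simp only [Fin.eta]
  by_cases h1 : O.str.layer (some p) = i
  · rw [if_pos (by omega), if_pos h1, if_neg (by omega), add_zero]
  · rw [if_neg (by omega), if_neg h1, zero_add]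
    by_cases h2 : O.str.layer (some p) = i + 1
    · rw [if_pos (by omega), if_pos h2, hg p h2]
    · rw [if_neg (by omega), if_neg h2]

lemma ints21 : s.ints 21 [(n : ℤ)] = O.invConst (O.N - 1) m₀ := by
  have hn := r.n_le
  have hN := O.one_le_N
  rw [prefix_sum (F := fun y => s.ints 21 [y])
    (f := fun q => if s.ints 4 [q] = ((O.N - 1 : ℕ) : ℤ) then s.ints 5 [q] else
      if s.ints 4 [q] = ((O.N - 1 : ℕ) : ℤ) + 1 then
        s.ints 15 [s.ints 5 [q], s.ints 19 [(n : ℤ), (k : ℤ)]] -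
          s.ints 15 [s.ints 5 [q], s.ints 19 [q, (k : ℤ)]] else 0)
    (N := n) (fun y hy => by
      have := eqn21 (r.ok 11 (by decide)) (r.small (x := y) (by omega))
      have e : s.ints 2 [] = ((O.N - 1 : ℕ) : ℤ) + 1 := by rw [r.ints2]; omega
      simp only [this, e, add_sub_cancel_right, r.ints0, r.ints1]
      split_ifs <;> simp) n le_rfl]
  refine r.sum_layers (O.N - 1) (fun q => s.ints 5 [q])
    (fun q => s.ints 15 [s.ints 5 [q], s.ints 19 [(n : ℤ), (k : ℤ)]] -
      s.ints 15 [s.ints 5 [q], s.ints 19 [q, (k : ℤ)]])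
    (fun p => (m₀ p : ℤ)) (fun p => O.cin p * (m₀ p : ℤ)) (fun p => r.ints5 p.2) fun p hp => ?_
  rw [r.ints5 p.2, r.ints19_none, r.ints19_some p.2, r.ints15 (r.m₀_le _) (r.POT_le _),
    r.ints15 (y := O.pot p) (r.m₀_le _) (r.pot_le (some p)), O.cin_eq hp, Nat.sub_add_cancel hN]
  ring

lemma ints22 (h2 : 2 ≤ O.N) : s.ints 22 [(n : ℤ)] = O.invConst (O.N - 2) m₀ := by
  have hn := r.n_le
  rw [prefix_sum (F := fun y => s.ints 22 [y])
    (f := fun q => if s.ints 4 [q] = ((O.N - 2 : ℕ) : ℤ) then s.ints 5 [q] else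
      if s.ints 4 [q] = ((O.N - 2 : ℕ) : ℤ) + 1 then
        s.ints 15 [s.ints 5 [q], s.ints 20 [(n : ℤ)]] -
          s.ints 15 [s.ints 5 [q], s.ints 19 [q, (k : ℤ)]] else 0)
    (N := n) (fun y hy => by
      have := eqn22 (r.ok 12 (by decide)) (r.small (x := y) (by omega))
      have e : s.ints 2 [] = ((O.N - 2 : ℕ) : ℤ) + 1 + 1 := by rw [r.ints2]; omega
      simp only [this, e, add_sub_cancel_right, r.ints0, r.ints1]
      split_ifs <;> simp) n le_rfl]
  refine r.sum_layers (O.N - 2) (fun q => s.ints 5 [q])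
    (fun q => s.ints 15 [s.ints 5 [q], s.ints 20 [(n : ℤ)]] -
      s.ints 15 [s.ints 5 [q], s.ints 19 [q, (k : ℤ)]])
    (fun p => (m₀ p : ℤ)) (fun p => O.cin p * (m₀ p : ℤ)) (fun p => r.ints5 p.2) fun p hp => ?_
  rw [r.ints5 p.2, r.ints20, r.ints19_some p.2, r.ints15 (r.m₀_le _) (r.POT_le _),
    r.ints15 (y := O.pot p) (r.m₀_le _) (r.pot_le (some p)), O.cin_eq hp,
    show O.N - 2 + 1 = O.N - 1 by omega]
  ring

lemma ints23 (hc : 1 ≤ c) : s.ints 23 [(n : ℤ)] ≤ 0 ↔ ¬ O.Feasible m₀ c := by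
  have hn := r.n_le
  have hN := O.one_le_N
  set Q : Fin n → Prop := fun p => O.str.layer (some p) = O.N - 1 ∧ O.pot p < O.POT (O.N - 1) ∧
    ((c : ℤ) - 1) * ((O.POT (O.N - 1) : ℤ) - O.pot p) + O.POT (O.N - 1) ≤ O.invConst (O.N - 2) m₀
    with hQ
  have hfe : O.Feasible m₀ c ↔ ∃ p, Q p :=
    ⟨fun h => h.resolve_left (by omega), fun h => Or.inr h⟩
  rw [hfe]
  have key : ∀ y : ℕ, y ≤ n → (s.ints 23 [(y : ℤ)] ≤ 0 ↔ ∀ p : Fin n, (p : ℕ) < y → ¬ Q p) := by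
    intro y
    induction y with
    | zero =>
      intro _
      rw [eqn23 (r.ok 13 (by decide)) (r.small (x := 0) (by omega))]
      simp
    | succ y ih =>
      intro hy
      have hcy : ((y + 1 : ℕ) : ℤ) - 1 = y := by push_cast; ring
      have hcc : (c : ℤ) - 1 = ((c - 1 : ℕ) : ℤ) := by omega
      rw [eqn23 (r.ok 13 (by decide)) (r.small (x := y + 1) (by omega)), if_neg (by omega), hcy,
        r.ints4_some hy, r.ints2, r.ints1, r.ints0, r.ints19_some hy, r.ints20, r.ints3, hcc,
        r.ints15 (by omega) (r.POT_le _),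
        r.ints15 (y := O.pot ⟨y, hy⟩) (by omega) (r.pot_le (some ⟨y, hy⟩))]
      have hcond : ((O.str.layer (some ⟨y, hy⟩) : ℤ) = O.N - 1 ∧
          (O.pot ⟨y, hy⟩ : ℤ) < O.POT (O.N - 1) ∧ ((c - 1 : ℕ) : ℤ) * O.POT (O.N - 1) -
            ((c - 1 : ℕ) : ℤ) * O.pot ⟨y, hy⟩ + O.POT (O.N - 1) ≤ s.ints 22 [(n : ℤ)]) ↔
          Q ⟨y, hy⟩ := by
        -- For N = 1 the layer N-1 has no places, so both sides are false and array 22 is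
        -- irrelevant.
        by_cases hN2 : 2 ≤ O.N
        · rw [hQ, r.ints22 hN2, ← mul_sub, ← hcc]
          refine and_congr (by omega) (and_congr (by omega) Iff.rfl)
        · have := O.str.one_le_layer (some ⟨y, hy⟩)
          exact iff_of_false (fun h => by omega) fun h => by have := h.1; omega
      by_cases h : Q ⟨y, hy⟩
      · rw [if_pos (hcond.2 h)]
        refine iff_of_false (by omega) fun h' => h' _ (Nat.lt_succ_self y) h
      · rw [if_neg (fun h' => h (hcond.1 h')), ih (by omega)]
        refine ⟨fun h' p hp => ?_, fun h' p hp => h' p (by omega)⟩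
        by_cases hpy : (p : ℕ) < y
        · exact h' p hpy
        · have : p = ⟨y, hy⟩ := Fin.ext (by simp only; omega)
          rw [this]
          exact h
  rw [key n le_rfl, not_exists]
  exact ⟨fun h p => h p p.2, fun h p _ => h p⟩

lemma ints24 (p : Fin n) : s.ints 24 [((p : ℕ) : ℤ)] = O.wt p := by
  have hn := r.n_le
  rw [eqn24 (r.ok 14 (by decide)) (r.small (x := p) (by omega)), r.ints4_some p.2, r.ints2,
    r.ints0, r.ints1, r.ints19_none, r.ints19_some p.2, OpenPi3.wt]
  simp only [Fin.eta]
  by_cases h : O.str.layer (some p) = O.N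
  · rw [if_pos (by omega), if_pos h, O.cin_eq h]
  · rw [if_neg (by omega), if_neg h]

lemma reals25 {σ : ℕ} (hσ : σ ≤ O.POT O.N + 1) (p : Fin n) : s.reals 25 [(σ : ℤ), ((p : ℕ) : ℤ)] =
    if O.str.layer (some p) = O.N then
      if σ < O.POT O.N then if σ < O.pot p then μ p else 0
      else if σ ≤ O.POT O.N then μ p else 0
    else if O.POT O.N ≤ σ ∧ O.str.layer (some p) = O.N - 1 ∧ O.pot p = O.POT (O.N - 1) then μ p
    else 0 := by
  have hn := r.n_le
  have hN := O.one_le_N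
  have hP := r.POT_le O.N
  rw [eqn25 (r.ok 15 (by decide)) (r.small (x := σ) (by omega)) (r.small (x := p) (by omega)),
    r.ints4_some p.2, r.ints2, r.ints0, r.ints1, r.ints19_none, r.ints19_some p.2, r.ints20,
    r.reals0 p.2]
  simp only [Fin.eta, Nat.cast_inj, Nat.cast_lt, Nat.cast_le]
  have : ((O.str.layer (some p) : ℤ) = O.N - 1) ↔ O.str.layer (some p) = O.N - 1 := by omega
  simp only [this]

/-! ### The rows of constants and the final value -/

open PartFun

lemma row_high {σ : ℕ} (hσ : σ < O.POT O.N) (p : Fin n) :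
    s.reals 25 [(σ : ℤ), ((p : ℕ) : ℤ)] = restr (O.High σ) μ p := by
  rw [r.reals25 (by omega), restr]
  simp only [OpenPi3.High, O.mem_layerSet, hσ, if_true]
  by_cases h1 : O.str.layer (some p) = O.N
  · simp [h1]
  · rw [if_neg h1, if_neg (by omega), if_neg (by simp [h1])]

lemma row_Y (p : Fin n) :
    s.reals 25 [((O.POT O.N : ℕ) : ℤ), ((p : ℕ) : ℤ)] = restr (· ∈ O.Y) μ p := by
  have hN := O.one_le_N
  rw [r.reals25 (by omega), restr]
  simp only [O.Y_subset, O.mem_layerSet, O.mem_maxSet_iff (show O.N - 1 < O.N by omega)]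
  by_cases h1 : O.str.layer (some p) = O.N
  · simp [h1]
  · simp [h1]

lemma row_max (p : Fin n) : s.reals 25 [((O.POT O.N + 1 : ℕ) : ℤ), ((p : ℕ) : ℤ)] =
    restr (· ∈ O.maxSet (O.N - 1)) μ p := by
  have hN := O.one_le_N
  rw [r.reals25 (by omega), restr]
  simp only [O.mem_maxSet_iff (show O.N - 1 < O.N by omega)]
  by_cases h1 : O.str.layer (some p) = O.N
  · rw [if_pos h1, if_neg (by omega), if_neg (by omega), if_neg (by omega)]
  · simp [h1]

lemma tables {σ : ℕ} (hσ : σ ≤ O.POT O.N + 1) {ν : Fin n → ℝ}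
    (hν : ∀ p : Fin n, s.reals 25 [(σ : ℤ), ((p : ℕ) : ℤ)] = ν p) :
    Tables s (sizeOf O m₀ c) O.wt σ ν where
  size := r.ints0
  off := r.ints16
  bound := r.bound17
  le_T := by have := r.n_le; omega
  row := by
    have := r.n_le
    have := r.POT_le O.N
    exact r.small (by omega)
  weight := r.ints24
  weight_le := r.abs_wt_le
  const := hν
  ok26 := r.ok 16 (by decide)
  ok27 := r.ok 17 (by decide)
  ok28 := r.ok 18 (by decide)
  ok29 := r.ok 19 (by decide)
  ok30 := r.ok 20 (by decide)
  ok31 := r.ok 21 (by decide)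

variable {τ : ℝ} (hμ0 : ∀ p, 0 ≤ μ p) (hμ : Tilted O.wt (restr (· ∈ O.Y) μ) τ)

include hμ0 hμ

lemma tilted_restr {S : Fin n → Prop} (hS : ∀ p, S p → p ∈ O.Y) :
    Tilted O.wt (restr S μ) τ := by
  refine hμ.mono (fun p => ?_) fun p => ?_
  · unfold restr
    split_ifs
    · exact hμ0 p
    · exact le_rfl
  · unfold restr
    split_ifs with h1 h2 h2
    · exact le_rfl
    · exact absurd (hS p h1) h2
    · exact hμ0 p
    · exact le_rfl

lemma partV_high {σ : ℕ} (hσ : σ < O.POT O.N) {K : ℤ} (hK : |K| ≤ 6 * (sizeOf O m₀ c : ℤ) ^ 2) :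
    partV s σ K = part O.wt (restr (O.High σ) μ) K :=
  (r.tables (by omega) (r.row_high hσ)).partV_eq
    (r.tilted_restr hμ0 hμ fun _ h => O.Y_subset.2 (Or.inr h.1)) hK

lemma partV_Y {K : ℤ} (hK : |K| ≤ 6 * (sizeOf O m₀ c : ℤ) ^ 2) :
    partV s (O.POT O.N : ℕ) K = part O.wt (restr (· ∈ O.Y) μ) K :=
  (r.tables (by omega) r.row_Y).partV_eq hμ hK

lemma partV_max {K : ℤ} (hK : |K| ≤ 6 * (sizeOf O m₀ c : ℤ) ^ 2) :
    partV s (O.POT O.N + 1 : ℕ) K = part O.wt (restr (· ∈ O.maxSet (O.N - 1)) μ) K :=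
  (r.tables (by omega) r.row_max).partV_eq
    (r.tilted_restr hμ0 hμ fun _ h => O.Y_subset.2 (Or.inl h)) hK

lemma reals32 : ∀ y : ℕ, y ≤ O.POT O.N → s.reals 32 [(y : ℤ)] =
    ∑ q ∈ Finset.range y, if c ≤ q then
      part O.wt (restr (· ∈ O.maxSet (O.N - 1)) μ) (q - c) *
        part O.wt (restr (O.High q) μ) (O.invConst (O.N - 1) m₀ - q) else 0 := by
  have hn := r.n_le
  have hP := r.POT_le O.N
  have hC := abs_le.1 (r.abs_invConst_le (O.N - 1))
  have hT : (sizeOf O m₀ c : ℤ) * 1 ≤ sizeOf O m₀ c * sizeOf O m₀ c :=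
    mul_le_mul_of_nonneg_left (by omega) (by omega)
  have hT' : (sizeOf O m₀ c : ℤ) ≤ sizeOf O m₀ c ^ 2 := by linarith [sq (sizeOf O m₀ c : ℤ)]
  intro y
  induction y with
  | zero =>
    intro _
    rw [eqn32 (r.ok 22 (by decide)) (r.small (x := 0) (by omega))]
    simp
  | succ y ih =>
    intro hy
    have hc : ((y + 1 : ℕ) : ℤ) - 1 = y := by push_cast; ring
    rw [eqn32 (r.ok 22 (by decide)) (r.small (x := y + 1) (by omega)), if_neg (by omega), hc,
      r.ints3, r.ints0, r.ints1, r.ints19_none, r.ints21, ih (by omega), Finset.sum_range_succ]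
    by_cases hcy : c ≤ y
    · rw [if_pos ⟨by omega, by omega⟩, if_pos hcy]
      congr 2
      · rw [← r.partV_max hμ0 hμ (by rw [abs_le]; omega)]
        push_cast
        rfl
      · exact r.partV_high hμ0 hμ (by omega) (by rw [abs_le]; omega)
    · rw [if_neg (by omega), if_neg hcy, add_zero]

/-- The last phase computes the sum over the classes. -/
theorem reals33 : s.reals 33 [] = O.classSum μ m₀ c := by
  have hn := r.n_le
  have hP := r.POT_le O.N
  have hC := abs_le.1 (r.abs_invConst_le (O.N - 1))
  have hT : (sizeOf O m₀ c : ℤ) * 1 ≤ sizeOf O m₀ c * sizeOf O m₀ c :=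
    mul_le_mul_of_nonneg_left (by omega) (by omega)
  have hT' : (sizeOf O m₀ c : ℤ) ≤ sizeOf O m₀ c ^ 2 := by linarith [sq (sizeOf O m₀ c : ℤ)]
  rw [eqn33 (r.ok 23 (by decide)), r.ints3, r.ints0, r.ints1, r.ints19_none, r.ints21,
    r.reals32 hμ0 hμ _ le_rfl, r.partV_Y hμ0 hμ (by rw [abs_le]; omega), OpenPi3.classSum]
  by_cases hc : 1 ≤ c
  · have h23 := r.ints23 hc
    by_cases hf : O.Feasible m₀ c
    · rw [if_neg (fun h => h23.1 h.2 hf), if_pos hf]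
    · rw [if_pos ⟨by omega, h23.2 hf⟩, if_neg hf]
  · have hf : O.Feasible m₀ c := Or.inl (by omega)
    rw [if_neg (by omega), if_pos hf]

end Run

end RealRAM

end


noncomputable section

namespace RealRAM

variable {n k : ℕ}

/-! ### The running time and the output of the program -/

/-- The weights are bounded only for the open net. The extra row of the deleted place has entries at
most one, because this place occurs in no bag but its own. -/
lemma preSum_le (O : OpenPi3 (Fin n) (Fin k)) : preSum O ≤ k * (n * O.net.maxWeight + 1) := by
  have hnone : ∀ t, O.closed.pre none t ≤ 1 := by
    intro t
    obtain ⟨z, hz⟩ := O.exists_inBag_eq t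
    have h1 : O.closed.pre none t = O.str.bag z none := by rw [← hz]; rfl
    rw [h1]
    by_cases hz' : none = z
    · rw [← hz', O.str.bag_self]
    · by_contra h
      have h2 := (O.str.resource z none hz' (by omega)).1
      have h3 := O.layer_ext
      have h4 := O.str.layer_le z
      omega
  have hsome : ∀ p t, O.closed.pre (some p) t ≤ O.net.maxWeight := fun p t =>
    (le_max_left (O.net.pre p t) (O.net.post p t)).trans
      ((Finset.le_sup (f := fun t => max (O.net.pre p t) (O.net.post p t))
        (Finset.mem_univ t)).trans
      (Finset.le_sup (f := fun p => Finset.univ.sup fun t => max (O.net.pre p t) (O.net.post p t))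
        (Finset.mem_univ p)))
  have hcol : ∀ t, ∑ x, O.closed.pre x t ≤ n * O.net.maxWeight + 1 := by
    intro t
    rw [Fintype.sum_option, add_comm]
    refine add_le_add ((Finset.sum_le_sum fun p _ => hsome p t).trans ?_) (hnone t)
    simp
  refine (Finset.sum_le_sum fun t _ => hcol t).trans ?_
  simp

lemma sizeOf_le (O : OpenPi3 (Fin n) (Fin k)) (m₀ : Fin n → ℕ) (c : ℕ) {X : ℕ}
    (hX : X = n + k + O.net.maxWeight + c + ∑ p, m₀ p) : sizeOf O m₀ c ≤ X ^ 3 + 2 * X + 2 := by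
  have h1 : preSum O ≤ X * (X * X + 1) := (preSum_le O).trans (by gcongr <;> omega)
  have h2 : X * (X * X + 1) = X ^ 3 + X := by ring
  unfold sizeOf
  omega

/-- A bound for the loop bounds of the program. -/
def sizePoly : Polynomial ℕ :=
  24 * (Polynomial.X ^ 3 + 2 * Polynomial.X + 2) ^ 2

/-- A bound for the running time of the program. -/
def timePoly : Polynomial ℕ := (phasesPoly phases).comp sizePoly + 2

lemma mem_bounds_phases {p : Phase} (hp : p ∈ phases) {b : ℕ} (hb : b ∈ p.bounds) :
    b = 10 ∨ b = 14 ∨ b = 17 := by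
  simp only [phases, List.mem_cons, List.not_mem_nil, or_false] at hp
  rcases hp with rfl | rfl | rfl | rfl | rfl | rfl | rfl | rfl | rfl | rfl | rfl | rfl | rfl | rfl |
    rfl | rfl | rfl | rfl | rfl | rfl | rfl | rfl | rfl | rfl <;> simp_all

lemma input_eq_zero (O : OpenPi3 (Fin n) (Fin k)) (μ : Fin n → ℝ) (m₀ : Fin n → ℕ) (c : ℕ) {a : ℕ}
    (ha : 10 ≤ a) : (input O μ m₀ c).cell a = 0 := by
  obtain ⟨a, rfl⟩ := Nat.exists_eq_add_of_le' ha
  rfl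

/-- The program computes the sum over the classes in polynomial time. -/
theorem exec_program (O : OpenPi3 (Fin n) (Fin k)) {μ : Fin n → ℝ} (m₀ : Fin n → ℕ) (c : ℕ)
    (hμ0 : ∀ p, 0 ≤ μ p) {τ : ℝ} (hμ : PartFun.Tilted O.wt (PartFun.restr (· ∈ O.Y) μ) τ) :
    ∃ s steps, Exec program (input O μ m₀ c) s steps ∧
      steps ≤ timePoly.eval (n + k + O.net.maxWeight + c + ∑ p, m₀ p) ∧
      s.output = O.classSum μ m₀ c := by
  obtain ⟨s, N, h1, h2, h3, h4⟩ := exec_phases phases 10 (by decide) (input O μ m₀ c)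
    (by decide) (fun a _ ha => input_eq_zero O μ m₀ c ha)
  have r : Run s O μ m₀ c := ⟨h2, h4⟩
  refine ⟨_, _, Exec.seq h1 (Exec.setReal s 1 0 Fin.elim0 (RExpr.var 33)), ?_, ?_⟩
  · set X := n + k + O.net.maxWeight + c + ∑ p, m₀ p with hX
    have hT := sizeOf_le O m₀ c hX
    have hN := h3 (sizePoly.eval X) fun p hp b hb => by
      have hn := r.n_le
      have e : sizePoly.eval X = 24 * (X ^ 3 + 2 * X + 2) ^ 2 := by
        simp [sizePoly]
      have h5 : sizeOf O m₀ c ^ 2 ≤ (X ^ 3 + 2 * X + 2) ^ 2 := Nat.pow_le_pow_left hT 2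
      have h6 : sizeOf O m₀ c ≤ sizeOf O m₀ c ^ 2 := Nat.le_self_pow (by decide) _
      rw [e]
      rcases mem_bounds_phases hp hb with rfl | rfl | rfl
      · rw [r.bound10]
        omega
      · rw [State.bound, r.ints14]
        omega
      · rw [r.bound17]
        omega
    simp only [timePoly, Polynomial.eval_add, Polynomial.eval_comp]
    simp [RExpr.var, RExpr.cost]
    exact hN
  · simp only [State.output, State.writeReal]
    simp [RExpr.eval_var, r.reals33 hμ0 hμ]

end RealRAM

end

theorem mainTheorem7 :
    ∃ (prog : RealRAM.Prog) (f : Polynomial ℕ),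
      ∀ (n k : ℕ) (O : OpenPi3 (Fin n) (Fin k))
        (rate : Fin k → ℝ) (_hrate : ∀ t, 0 < rate t)
        (vis : (Fin n → ℕ) → ℝ) (_hvis : O.net.IsVisit rate vis)
        (wit : (Fin n → ℕ) → Fin n → ℚ) (_hwit : ∀ b ∈ O.net.bags, O.net.IsWitness b (wit b))
        (m₀ : Fin n → ℕ) (_hlive : O.net.Live m₀) (_hergodic : O.net.Ergodic rate m₀) (c : ℕ),
        ∃ (s : RealRAM.State) (steps : ℕ),
          RealRAM.Exec prog (RealRAM.input O (O.net.mu rate vis wit) m₀ c) s steps ∧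
          steps ≤ f.eval (n + k + O.net.maxWeight + c + ∑ p, m₀ p) ∧
          HasSum (fun M : O.classesD m₀ c =>
            MarkingClass.weight (O.net.mu rate vis wit) (M : MarkingClass O.Y)) s.output := by
  refine ⟨RealRAM.program, RealRAM.timePoly, ?_⟩
  intro n k O rate hrate vis hvis wit hwit m₀ hlive herg c
  have hμ : ∀ p, 0 < O.net.mu rate vis wit p :=
    fun p => PetriNet.mu_pos hrate O.allConsumed hvis p
  have hfull := O.full_of_live hlive
  -- Ergodicity enters only here, through the summability of the product form.
  obtain ⟨τ, hτ⟩ := O.exists_tilt hμ hfull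
    (PetriNet.summable_weightOf hrate O.allConsumed O.weaklyReversible hvis hwit m₀ herg)
  have htilt : PartFun.Tilted O.wt (PartFun.restr (· ∈ O.Y) (O.net.mu rate vis wit)) τ := by
    intro p
    unfold PartFun.restr
    split_ifs with hp
    · exact ⟨(hμ p).le, hτ p hp⟩
    · simp
  obtain ⟨s, steps, h1, h2, h3⟩ := RealRAM.exec_program O m₀ c (fun p => (hμ p).le) htilt
  refine ⟨s, steps, h1, h2, ?_⟩
  rw [h3]
  exact O.hasSum_classSum hfull htilt c
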